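/- **Setting.** A C²MAB‑T instance consists of base arms $[m]$, an action space $\mathcal S$, a set $\Phi$ of feature maps $\phi:[m]\to\mathbb R^d$ ($d\ge1$) with $\|\phi(i)\|_2\le 1$, a parameter space $\Theta\subseteq\mathbb R^d$ with $\langle\theta,\phi(i)\rangle\in[0,1]$ for all $\theta\in\Theta,\phi\in\Phi,i\in[m]$, a triggering function $D_{\rm trig}$ ($D_{\rm trig}(S,x)$ is a law on subsets of $[m]$ for $S\in\mathcal S$, $x\in\{0,1\}^m$) and a reward function $R(S,x,\tau)\ge0$. Triggering does not look at outcomes it does not reveal: for all $S$ and $A\subseteq[m]$, $\Pr_{\tau\sim D_{\rm trig}(S,x)}[\tau=A]$ depends on $x$ only through $(x_i)_{i\in A}$. For $\mu\in[0,1]^m$ let $X$ have independent Bernoulli($\mu_i$) coordinates and $\tau\sim D_{\rm trig}(S,X)$; put $r(S;\mu)=\mathbb E[R(S,X,\tau)]$, $p_i^{\mu,S}=\Pr[i\in\tau]$ and $r(S^*;\mu)=\sup_{S}r(S;\mu)$, which is assumed finite. Let $\mathcal M=\{(\langle\theta,\phi(i)\rangle)_{i}:\theta\in\Theta,\phi\in\Phi\}$,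 $\tilde S=\{i: p_i^{\mu,S}>0\ \forall\mu\in\mathcal M\}$, $K=\max_S|\tilde S|$, and let $p_{\min}$ be the infimum of all positive $p_i^{\mu,S}$ ($i\in[m],\mu\in\mathcal M,S\in\mathcal S$). Assume $p_{\min}>0$ and that, for each $S$ and $i$, whether $p_i^{\mu,S}>0$ is the same for all $\mu\in\mathcal M$ (automatic if $\mathcal M\subseteq(0,1)^m$). *Protocol.* A parameter $\theta^*\in\Theta$, $\|\theta^*\|_2\le1$, is fixed. In round $t=1,\dots,T$ the environment reveals $\phi_t\in\Phi$ (possibly depending on the past), the learner plays $S_t$, fresh outcomes $X_t$ with independent Bernoulli coordinates of mean vector $\mu_t=(\langle\theta^*,\phi_t(i)\rangle)_i$ are drawn, $\tau_t\sim D_{\rm trig}(S_t,X_t)$, and the learner sees $\tau_t$ and $(X_{t,i})_{i\in\tau_t}$. *Conditions.* Monotonicity: $r(S;\mu)\le r(S;\mu')$ whenever $\mu\le\mu'$ in $[0,1]^m$. VM $(B_v,B_1)$-smoothness: $|r(S;\mu')-r(S;\mu)|\le B_v\sqrt{\sum_{i\in\tilde S}\frac{\zeta_i^2}{(1-\mu_i)\mu_i}}+B_1\sum_{i\in\tilde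 S}|\eta_i|$ for all $S$, $\mu,\mu'\in(0,1)^m$, $\zeta,\eta\in[-1,1]^m$ with $\mu'=\mu+\zeta+\eta$. *Oracle.* For $\alpha,\beta\in[0,1]$, an $(\alpha,\beta)$-approximation oracle maps each $\mu\in[0,1]^m$ to a (discrete) random action $S$ with $\Pr[r(S;\mu)\ge\alpha\, r(S^*;\mu)]\ge\beta$. *VAC²‑UCB* with regularizer $\gamma\ge1$: $G_1=\gamma I$, $b_1=0$, $\delta=1/T$, $N=(4d^2K^4T^4)^d$, $\rho=1+\sqrt\gamma+4\sqrt{\log\left(\frac{6TN}\delta\log\frac{3TN}\delta\right)}$. In round $t$: $\hat\theta_t=G_t^{-1}b_t$; $\bar\mu_{t,i}$ and $\underline\mu_{t,i}$ are $\langle\phi_t(i),\hat\theta_t\rangle\pm2\rho\|\phi_t(i)\|_{G_t^{-1}}$ clipped into $[0,1]$; $\bar V_{t,i}=\max_{\mu\in[\underline\mu_{t,i},\bar\mu_{t,i}]}\mu(1-\mu)$; $S_t$ is the oracle's output on $\bar\mu_t$; $G_{t+1}=G_t+\sum_{i\in\tau_t}\bar V_{t,i}^{-1}\phi_t(i)\phi_t(i)^\top$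 and $b_{t+1}=b_t+\sum_{i\in\tau_t}\bar V_{t,i}^{-1}\phi_t(i)X_{t,i}$ (terms with $\bar V_{t,i}=0$ are omitted). Its regret is $\mathrm{Reg}(T)=\mathbb E\left[\sum_{t=1}^T\left(\alpha\beta\, r(S^*_t;\mu_t)-r(S_t;\mu_t)\right)\right]$, where $r(S^*_t;\mu_t)=\sup_S r(S;\mu_t)$. **Theorem.** There is a universal constant $C>0$ such that for every such instance satisfying monotonicity and VM $(B_v,B_1)$-smoothness, every $\theta^*$, environment, $(\alpha,\beta)$-approximation oracle, horizon $T$ and regularizer $\gamma\ge1$, the following hold for VAC²‑UCB (in both cases the expectation defining $\mathrm{Reg}(T)$ exists): 1. if $KT\ge2\gamma$ and ($\gamma\ge4K$ or $K\le p_{\min}T$), then $$\mathrm{Reg}(T)\le C\,\frac{B_v}{\sqrt{p_{\min}}}\left(\sqrt{d\log(KT/\gamma)}+\sqrt\gamma\right)\sqrt{Td\log(KT/\gamma)};$$ 2. (non-triggering C²MAB) if $p_{\min}=1$, $K\le T$ and $\gamma\le d\log T$, then $$\mathrm{Reg}(T)\le C\,B_v\,d\sqrt T\log T .$$ -/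

import Mathlib

open scoped RealInnerProductSpace

noncomputable section

namespace C2MAB

universe u

/-- Probability of the outcome `b` under the Bernoulli law of mean `q ∈ [0,1]`
(the projection onto `[0,1]` is the identity on such `q`). -/
def bernoulliWeight (q : ℝ) (b : Bool) : ENNReal :=
  ENNReal.ofReal (if b then max 0 (min 1 q) else 1 - max 0 (min 1 q))

theorem bernoulliWeight_sum (q : ℝ) : ∑ b : Bool, bernoulliWeight q b = 1 := by
  have h0 : 0 ≤ max 0 (min 1 q) := le_max_left _ _
  have h1 : max 0 (min 1 q) ≤ 1 := max_le zero_le_one (min_le_left _ _)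
  simp only [Fintype.sum_bool, bernoulliWeight]
  simp only [if_true, Bool.false_eq_true, if_false]
  rw [← ENNReal.ofReal_add h0 (by linarith)]
  simp

/-- The law of the outcome vector: independent Bernoulli coordinates with mean vector `μ`. -/
def outcomeLaw {m : ℕ} (μ : Fin m → ℝ) : PMF (Fin m → Bool) :=
  PMF.ofFintype (fun x => ∏ i, bernoulliWeight (μ i) (x i)) (by
    rw [← Fintype.prod_sum (fun i b => bernoulliWeight (μ i) b)]
    exact Finset.prod_eq_one fun i _ => bernoulliWeight_sum (μ i))

/-- A contextual combinatorial bandit instance with probabilistically triggered arms: base arms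
`Fin m`, action space `𝒜`, feature maps, parameter space, triggering function, reward function. -/
structure Instance (m d : ℕ) (𝒜 : Type u) where
  /-- the set of possible feature maps -/
  features : Set (Fin m → EuclideanSpace ℝ (Fin d))
  /-- the parameter space -/
  params : Set (EuclideanSpace ℝ (Fin d))
  /-- `trig S x` is the law of the triggered set when `S` is played on the outcome vector `x` -/
  trig : 𝒜 → (Fin m → Bool) → PMF (Finset (Fin m))
  /-- the reward of action `S`, outcome vector `x` and triggered set `τ` -/
  reward : 𝒜 → (Fin m → Bool) → Finset (Fin m) → ℝ
  norm_feature_le : ∀ φ ∈ features, ∀ i, ‖φ i‖ ≤ 1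
  /-- every mean vector is a vector of Bernoulli means -/
  mean_mem : ∀ θ ∈ params, ∀ φ ∈ features, ∀ i, ⟪θ, φ i⟫ ∈ Set.Icc (0 : ℝ) 1
  reward_nonneg : ∀ S x τ, 0 ≤ reward S x τ
  /-- triggering does not look at the outcomes that it does not reveal: whether the triggered set
  is `A` depends on the outcomes only through the arms in `A` (and on independent randomness) -/
  trig_local : ∀ (S : 𝒜) (x x' : Fin m → Bool) (A : Finset (Fin m)),
    (∀ i ∈ A, x i = x' i) → trig S x A = trig S x' A

namespace Instance

variable {m d : ℕ} {𝒜 : Type u} (I : Instance m d 𝒜)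

/-- The mean vector of the parameter `θ` and the feature map `φ`. -/
def meanVec (θ : EuclideanSpace ℝ (Fin d)) (φ : Fin m → EuclideanSpace ℝ (Fin d)) : Fin m → ℝ :=
  fun i => ⟪θ, φ i⟫

/-- All mean vectors generated by the feature maps and the parameters. -/
def meanSet : Set (Fin m → ℝ) :=
  {μ | ∃ φ ∈ I.features, ∃ θ ∈ I.params, μ = meanVec θ φ}

/-- Expected reward `r(S; μ)` over outcomes of mean `μ` and the triggered set. -/
def expReward (S : 𝒜) (μ : Fin m → ℝ) : ℝ :=
  ∑ x : Fin m → Bool, (outcomeLaw μ x).toReal *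
    ∑ τ : Finset (Fin m), (I.trig S x τ).toReal * I.reward S x τ

/-- The optimal expected reward `r(S*; μ)`. -/
def optReward (μ : Fin m → ℝ) : ℝ := ⨆ S : 𝒜, I.expReward S μ

/-- Triggering probability of arm `i` under action `S` and mean vector `μ`. -/
def trigProb (S : 𝒜) (μ : Fin m → ℝ) (i : Fin m) : ℝ :=
  ∑ x : Fin m → Bool, (outcomeLaw μ x).toReal *
    ∑ τ : Finset (Fin m), if i ∈ τ then (I.trig S x τ).toReal else 0

open scoped Classical in
/-- The set of arms that can be triggered by the action `S`. -/
def trigSet (S : 𝒜) : Finset (Fin m) :=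
  Finset.univ.filter fun i => ∀ μ ∈ I.meanSet, 0 < I.trigProb S μ i

/-- The batch size `K`, the largest number of arms that an action can trigger. -/
def batchSize : ℕ := ⨆ S : 𝒜, (I.trigSet S).card

/-- The minimum positive triggering probability. -/
def pMin : ℝ :=
  sInf {q | ∃ (i : Fin m) (S : 𝒜), ∃ μ ∈ I.meanSet, q = I.trigProb S μ i ∧ 0 < q}

/-- Which arms an action can trigger does not depend on the mean vector. -/
def UniformTriggering : Prop :=
  ∀ (S : 𝒜) (i : Fin m), ∀ μ ∈ I.meanSet, ∀ μ' ∈ I.meanSet,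
    0 < I.trigProb S μ i → 0 < I.trigProb S μ' i

/-- Expected rewards are bounded over the action space, so that `optReward` is a supremum. -/
def BoundedReward : Prop :=
  ∀ μ : Fin m → ℝ, (∀ i, μ i ∈ Set.Icc (0 : ℝ) 1) →
    BddAbove (Set.range fun S : 𝒜 => I.expReward S μ)

/-- The monotonicity condition. -/
def Monotonicity : Prop :=
  ∀ (S : 𝒜) (μ μ' : Fin m → ℝ), (∀ i, μ i ∈ Set.Icc (0 : ℝ) 1) →
    (∀ i, μ' i ∈ Set.Icc (0 : ℝ) 1) → (∀ i, μ i ≤ μ' i) → I.expReward S μ ≤ I.expReward S μ'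

/-- The variance modulated `(Bv, B1)`-bounded smoothness condition. -/
def VMSmooth (Bv B1 : ℝ) : Prop :=
  ∀ (S : 𝒜) (μ μ' ζ η : Fin m → ℝ), (∀ i, μ i ∈ Set.Ioo (0 : ℝ) 1) →
    (∀ i, μ' i ∈ Set.Ioo (0 : ℝ) 1) → (∀ i, ζ i ∈ Set.Icc (-1 : ℝ) 1) →
    (∀ i, η i ∈ Set.Icc (-1 : ℝ) 1) → (∀ i, μ' i = μ i + ζ i + η i) →
    |I.expReward S μ' - I.expReward S μ| ≤
      Bv * √(∑ i ∈ I.trigSet S, ζ i ^ 2 / ((1 - μ i) * μ i)) + B1 * ∑ i ∈ I.trigSet S, |η i|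

/-- `oracle` is an `(α, β)`-approximation oracle: for every mean vector its (random) output is,
with probability at least `β`, an action whose reward is at least `α` times the optimal one. -/
def IsApproxOracle (α β : ℝ) (oracle : (Fin m → ℝ) → PMF 𝒜) : Prop :=
  ∀ μ : Fin m → ℝ, (∀ i, μ i ∈ Set.Icc (0 : ℝ) 1) →
    ENNReal.ofReal β ≤
      (oracle μ).toOuterMeasure {S | α * I.optReward μ ≤ I.expReward S μ}

end Instance

/-- The record of one round: context, action, outcomes, triggered set. -/
structure Round (m d : ℕ) (𝒜 : Type u) where
  ctx : Fin m → EuclideanSpace ℝ (Fin d)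
  action : 𝒜
  outcome : Fin m → Bool
  triggered : Finset (Fin m)

/-- The norm `‖x‖_M = √(xᵀ M x)`. -/
def matNorm {d : ℕ} (M : Matrix (Fin d) (Fin d) ℝ) (x : EuclideanSpace ℝ (Fin d)) : ℝ :=
  √(x.ofLp ⬝ᵥ M.mulVec x.ofLp)

/-- Clipping into `[0,1]`. -/
def clip (x : ℝ) : ℝ := max 0 (min 1 x)

/-- The confidence radius `ρ(δ)` of VAC²-UCB with `δ = 1/T`. -/
def radius (d K T : ℕ) (γ : ℝ) : ℝ :=
  let N : ℝ := (4 * (d : ℝ) ^ 2 * (K : ℝ) ^ 4 * (T : ℝ) ^ 4) ^ d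
  let δ : ℝ := 1 / T
  1 + √γ + 4 * √(Real.log (6 * T * N / δ * Real.log (3 * T * N / δ)))

section Algorithm

variable {m d : ℕ} {𝒜 : Type u}

/-- The state of the algorithm: Gram matrix `G` and regressand `b`. -/
structure State (d : ℕ) where
  gram : Matrix (Fin d) (Fin d) ℝ
  regressand : Fin d → ℝ

/-- The estimator `θ̂ = G⁻¹ b`. -/
def State.estimate (s : State d) : EuclideanSpace ℝ (Fin d) :=
  WithLp.toLp 2 (s.gram⁻¹.mulVec s.regressand)

/-- Upper confidence bound of an arm with feature vector `v`. -/
def State.ucb (s : State d) (rho : ℝ) (v : EuclideanSpace ℝ (Fin d)) : ℝ :=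
  clip (⟪v, s.estimate⟫ + 2 * rho * matNorm s.gram⁻¹ v)

/-- Lower confidence bound of an arm with feature vector `v`. -/
def State.lcb (s : State d) (rho : ℝ) (v : EuclideanSpace ℝ (Fin d)) : ℝ :=
  clip (⟪v, s.estimate⟫ - 2 * rho * matNorm s.gram⁻¹ v)

/-- The optimistic variance of an arm with feature vector `v`. -/
def State.optVar (s : State d) (rho : ℝ) (v : EuclideanSpace ℝ (Fin d)) : ℝ :=
  if s.ucb rho v ≤ 1 / 2 then (1 - s.ucb rho v) * s.ucb rho v
  else if 1 / 2 ≤ s.lcb rho v then (1 - s.lcb rho v) * s.lcb rho v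
  else 1 / 4

/-- The update after a round; only the outcomes of triggered arms are used. -/
def State.update (s : State d) (rho : ℝ) (o : Round m d 𝒜) : State d where
  gram := s.gram + ∑ i ∈ o.triggered,
    (s.optVar rho (o.ctx i))⁻¹ • Matrix.vecMulVec (o.ctx i).ofLp (o.ctx i).ofLp
  regressand := s.regressand + ∑ i ∈ o.triggered,
    ((s.optVar rho (o.ctx i))⁻¹ * (if o.outcome i then 1 else 0)) • (o.ctx i).ofLp

/-- The state of VAC²-UCB after a history (most recent round first). -/
def stateOf (γ rho : ℝ) : List (Round m d 𝒜) → State d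
  | [] => ⟨γ • 1, 0⟩
  | o :: h => (stateOf γ rho h).update rho o

/-- The law of the first `t` rounds (most recent first) when VAC²-UCB with horizon `T`,
regularizer `γ` and offline oracle `oracle` plays on the instance `I` with true parameter `θ`;
`env h` is the feature map revealed after the history `h`. -/
def runLaw (I : Instance m d 𝒜) (θ : EuclideanSpace ℝ (Fin d))
    (env : List (Round m d 𝒜) → Fin m → EuclideanSpace ℝ (Fin d))
    (oracle : (Fin m → ℝ) → PMF 𝒜) (γ : ℝ) (T : ℕ) : ℕ → PMF (List (Round m d 𝒜))
  | 0 => PMF.pure []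
  | t + 1 => (runLaw I θ env oracle γ T t).bind fun h =>
      let rho := radius d I.batchSize T γ
      let φ := env h
      let μbar : Fin m → ℝ := fun i => (stateOf γ rho h).ucb rho (φ i)
      (oracle μbar).bind fun S =>
        (outcomeLaw (Instance.meanVec θ φ)).bind fun x =>
          (I.trig S x).map fun τ => ⟨φ, S, x, τ⟩ :: h

/-- `∑ₜ (α β r(S*ₜ; μₜ) - r(Sₜ; μₜ))` along a history. -/
def historyRegret (I : Instance m d 𝒜) (θ : EuclideanSpace ℝ (Fin d)) (α β : ℝ)
    (h : List (Round m d 𝒜)) : ℝ :=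
  (h.map fun o => α * β * I.optReward (Instance.meanVec θ o.ctx)
    - I.expReward o.action (Instance.meanVec θ o.ctx)).sum

/-- Summand of the expectation that defines the regret. -/
def regretTerm (I : Instance m d 𝒜) (θ : EuclideanSpace ℝ (Fin d))
    (env : List (Round m d 𝒜) → Fin m → EuclideanSpace ℝ (Fin d))
    (oracle : (Fin m → ℝ) → PMF 𝒜) (γ : ℝ) (T : ℕ) (α β : ℝ) (h : List (Round m d 𝒜)) : ℝ :=
  (runLaw I θ env oracle γ T T h).toReal * historyRegret I θ α β h

/-- The `T`-round `(α, β)`-approximate regret of VAC²-UCB. -/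
def regret (I : Instance m d 𝒜) (θ : EuclideanSpace ℝ (Fin d))
    (env : List (Round m d 𝒜) → Fin m → EuclideanSpace ℝ (Fin d))
    (oracle : (Fin m → ℝ) → PMF 𝒜) (γ : ℝ) (T : ℕ) (α β : ℝ) : ℝ :=
  ∑' h, regretTerm I θ env oracle γ T α β h

end Algorithm

end C2MAB

end

open scoped RealInnerProductSpace

noncomputable section

namespace C2MAB

/-! ### Linear algebra: quadratic forms, dual norms, determinants. -/

section LinearAlgebra

open Matrix

variable {n : Type*}

/-! Regret is paid for by the growth of `log det G`. Write `V` for the optimistic variance of an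
arm, `w` for the norm of its feature vector with respect to `G⁻¹`, and call a state accurate if the
noise `b - (G - γI)θ` has `G⁻¹`-norm at most `β`, where `ρ = β + √γ`.

In an accurate state all true means lie in their confidence intervals, so by monotonicity the
optimum at the upper bounds dominates the true optimum. Smoothness is applied at the pivot, the
point of the confidence interval of largest variance, where the denominator is exactly `V`. This
bounds the loss of an action by `8 ρ B_v √b`, with `b` the sum of `w²/V` over the arms it can
trigger (`expReward_ucb_sub_le`). The same sum, restricted to the triggered arms, controls the
growth of the determinant, and concavity of `log(1+y)` shows that the expected growth of `log det G`
is at least `p_min log(1+b)` (`Instance.pMin_mul_log_le`). The inequality `le_log_of_le_sqrt` trades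
`√b` for `log(1+b)`, so the regret telescopes against the determinant (`regret_le`).

The weights `1/V` are not bounded a priori. However, the confidence radius is twice the actual
error, which forces `V = 1/4` or `ρ w ≤ 2V`. This bound has two uses. First, it bounds a rank-one
update by a multiple of the square root of the largest eigenvalue of `G`; hence that square root
grows at most linearly in time and the total growth of `log det G` is at most `2d log(1 + 3KT/γ)`
(`form_le_gramBound`, `potential_le`). Secondly, for a direction `l` of `G`-norm at most `ρ/2`, it
keeps the normalized increments small enough for a Bernoulli moment bound with variance `V`, which
yields an exponential supermartingale (`lexp_stepLaw_exponent_le`). The revealed outcomes of one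
round need not be independent once the triggered set is known; locality of triggering gives the
required product bound nevertheless (`lexp_trig_prod_le`).

At a first loss of accuracy some point of a fixed finite grid has a large exponent
(`exists_grid_exponent`). A union bound over grid and rounds makes this an event of probability at
most `1/T`, and it costs only the variation of the rewards. Accuracy is needed for the lower bound
on `V`, and that bound is needed to prove accuracy; the circle is broken by working with histories
whose earlier states are all accurate. If `d` is too large for the logarithms to be absorbed, the
trivial bound on the regret already suffices. -/

theorem isHermitian_sum_vecMulVec {ι : Type*} (s : Finset ι) (c : ι → ℝ) (v : ι → n → ℝ) :
    (∑ i ∈ s, c i • vecMulVec (v i) (v i)).IsHermitian := by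
  unfold IsHermitian
  rw [conjTranspose_sum]
  refine Finset.sum_congr rfl fun i _ => ?_
  rw [conjTranspose_smul, conjTranspose_vecMulVec]
  simp

variable [Fintype n]

/-- The norm `√(xᵀ G x)` of a coordinate vector. -/
def quadNorm (G : Matrix n n ℝ) (x : n → ℝ) : ℝ := √(x ⬝ᵥ G *ᵥ x)

theorem quadNorm_nonneg (G : Matrix n n ℝ) (x : n → ℝ) : 0 ≤ quadNorm G x := Real.sqrt_nonneg _

theorem form_nonneg {G : Matrix n n ℝ} (hG : G.PosSemidef) (x : n → ℝ) :
    0 ≤ x ⬝ᵥ G *ᵥ x := by simpa using hG.dotProduct_mulVec_nonneg x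

theorem sq_quadNorm {G : Matrix n n ℝ} (hG : G.PosSemidef) (x : n → ℝ) :
    quadNorm G x ^ 2 = x ⬝ᵥ G *ᵥ x := Real.sq_sqrt (form_nonneg hG x)

theorem form_comm {G : Matrix n n ℝ} (hG : G.IsHermitian) (x y : n → ℝ) :
    x ⬝ᵥ G *ᵥ y = y ⬝ᵥ G *ᵥ x := by
  rw [dotProduct_mulVec, dotProduct_comm, ← mulVec_transpose]
  congr 2

theorem quadNorm_smul (G : Matrix n n ℝ) (c : ℝ) (x : n → ℝ) :
    quadNorm G (c • x) = |c| * quadNorm G x := by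
  unfold quadNorm
  rw [mulVec_smul, dotProduct_smul, smul_dotProduct, smul_eq_mul, smul_eq_mul, ← mul_assoc,
    Real.sqrt_mul (mul_self_nonneg c), Real.sqrt_mul_self_eq_abs]

theorem quadNorm_neg (G : Matrix n n ℝ) (x : n → ℝ) : quadNorm G (-x) = quadNorm G x := by
  simpa using quadNorm_smul G (-1) x

/-- Cauchy-Schwarz for a positive semidefinite form. -/
theorem form_le_quadNorm_mul {G : Matrix n n ℝ} (hG : G.PosSemidef) (x y : n → ℝ) :
    |x ⬝ᵥ G *ᵥ y| ≤ quadNorm G x * quadNorm G y := by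
  classical
  have hq : ∀ t : ℝ, 0 ≤ (y ⬝ᵥ G *ᵥ y) * (t * t) + (2 * (x ⬝ᵥ G *ᵥ y)) * t + x ⬝ᵥ G *ᵥ x := by
    intro t
    have h := form_nonneg hG (x + t • y)
    have hc := form_comm hG.isHermitian y x
    simp only [mulVec_add, mulVec_smul, dotProduct_add, add_dotProduct, smul_dotProduct,
      dotProduct_smul, smul_eq_mul] at h
    rw [hc] at h
    linarith
  have hd := discrim_le_zero hq
  unfold discrim at hd
  unfold quadNorm
  rw [← Real.sqrt_mul (form_nonneg hG x)]
  apply Real.abs_le_sqrt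
  nlinarith

theorem quadNorm_add_le {G : Matrix n n ℝ} (hG : G.PosSemidef) (x y : n → ℝ) :
    quadNorm G (x + y) ≤ quadNorm G x + quadNorm G y := by
  apply Real.sqrt_le_iff.2
  refine ⟨add_nonneg (quadNorm_nonneg _ _) (quadNorm_nonneg _ _), ?_⟩
  have h := (abs_le.1 (form_le_quadNorm_mul hG x y)).2
  have hc := form_comm hG.isHermitian y x
  simp only [mulVec_add, dotProduct_add, add_dotProduct]
  rw [hc, add_sq, sq_quadNorm hG, sq_quadNorm hG]
  linarith

theorem quadNorm_mono {G H : Matrix n n ℝ} {x : n → ℝ} (h : x ⬝ᵥ G *ᵥ x ≤ x ⬝ᵥ H *ᵥ x) :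
    quadNorm G x ≤ quadNorm H x := Real.sqrt_le_sqrt h

theorem dotProduct_self_nonneg_real (x : n → ℝ) : 0 ≤ x ⬝ᵥ x :=
  Finset.sum_nonneg fun i _ => mul_self_nonneg (x i)

theorem trace_vecMulVec_mul (v : n → ℝ) (H : Matrix n n ℝ) :
    (vecMulVec v v * H).trace = v ⬝ᵥ H *ᵥ v := by
  rw [vecMulVec_mul, trace_vecMulVec, dotProduct_comm, ← dotProduct_mulVec]

theorem form_vecMulVec (v x : n → ℝ) : x ⬝ᵥ vecMulVec v v *ᵥ x = (v ⬝ᵥ x) ^ 2 := by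
  rw [vecMulVec_mulVec, dotProduct_smul, dotProduct_comm x v]
  simp [sq]

theorem form_sum_vecMulVec {ι : Type*} (s : Finset ι) (c : ι → ℝ) (v : ι → n → ℝ) (x : n → ℝ) :
    x ⬝ᵥ (∑ i ∈ s, c i • vecMulVec (v i) (v i)) *ᵥ x = ∑ i ∈ s, c i * (v i ⬝ᵥ x) ^ 2 := by
  rw [sum_mulVec, dotProduct_sum]
  refine Finset.sum_congr rfl fun i _ => ?_
  rw [smul_mulVec, dotProduct_smul, form_vecMulVec, smul_eq_mul]

theorem posDef_of_form_ge {G : Matrix n n ℝ} (hG : G.IsHermitian) {γ : ℝ} (hγ : 0 < γ)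
    (h : ∀ x, γ * (x ⬝ᵥ x) ≤ x ⬝ᵥ G *ᵥ x) : G.PosDef := by
  refine PosDef.of_dotProduct_mulVec_pos hG fun x hx => ?_
  have h1 : 0 < x ⬝ᵥ x :=
    (dotProduct_self_nonneg_real x).lt_of_ne fun h0 => hx (dotProduct_self_eq_zero.1 h0.symm)
  simpa using (mul_pos hγ h1).trans_le (h x)

variable [DecidableEq n]

theorem mul_inv_mulVec {G : Matrix n n ℝ} (hG : G.PosDef) (x : n → ℝ) :
    G *ᵥ (G⁻¹ *ᵥ x) = x := by
  rw [mulVec_mulVec, mul_nonsing_inv _ ((isUnit_iff_isUnit_det _).1 hG.isUnit), one_mulVec]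

theorem inv_mul_mulVec {G : Matrix n n ℝ} (hG : G.PosDef) (x : n → ℝ) :
    G⁻¹ *ᵥ (G *ᵥ x) = x := by
  rw [mulVec_mulVec, nonsing_inv_mul _ ((isUnit_iff_isUnit_det _).1 hG.isUnit), one_mulVec]

theorem quadNorm_inv_mulVec {G : Matrix n n ℝ} (hG : G.PosDef) (x : n → ℝ) :
    quadNorm G (G⁻¹ *ᵥ x) = quadNorm G⁻¹ x := by
  unfold quadNorm
  rw [mul_inv_mulVec hG, dotProduct_comm]

/-- Cauchy-Schwarz for dual norms. -/
theorem abs_dotProduct_le_quadNorm {G : Matrix n n ℝ} (hG : G.PosDef) (x y : n → ℝ) :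
    |x ⬝ᵥ y| ≤ quadNorm G⁻¹ x * quadNorm G y := by
  have h := form_le_quadNorm_mul hG.posSemidef (G⁻¹ *ᵥ x) y
  rwa [quadNorm_inv_mulVec hG, form_comm hG.isHermitian, mul_inv_mulVec hG, dotProduct_comm] at h

theorem abs_dotProduct_le (x y : n → ℝ) : |x ⬝ᵥ y| ≤ √(x ⬝ᵥ x) * √(y ⬝ᵥ y) := by
  simpa [quadNorm] using form_le_quadNorm_mul (PosSemidef.one (R := ℝ) (n := n)) x y

/-- Apply the hypothesis to `y = G⁻¹x`: then `γ|y|² ≤ x·y ≤ |x||y|`, and `x·y` is the squared dual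
norm. -/
theorem quadNorm_inv_le {G : Matrix n n ℝ} (hG : G.PosDef) {γ : ℝ} (hγ : 0 < γ)
    (h : ∀ x, γ * (x ⬝ᵥ x) ≤ x ⬝ᵥ G *ᵥ x) (x : n → ℝ) :
    √γ * quadNorm G⁻¹ x ≤ √(x ⬝ᵥ x) := by
  set y := G⁻¹ *ᵥ x with hy
  have h1 : γ * (y ⬝ᵥ y) ≤ quadNorm G⁻¹ x ^ 2 := by
    rw [← quadNorm_inv_mulVec hG, sq_quadNorm hG.posSemidef]
    exact h y
  have h2 : quadNorm G⁻¹ x ^ 2 ≤ √(x ⬝ᵥ x) * √(y ⬝ᵥ y) := by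
    rw [sq_quadNorm hG.inv.posSemidef]
    exact (le_abs_self _).trans (abs_dotProduct_le x y)
  have h3 : √γ * √(y ⬝ᵥ y) ≤ quadNorm G⁻¹ x := by
    rw [← Real.sqrt_mul hγ.le]
    exact Real.sqrt_le_iff.2 ⟨quadNorm_nonneg _ _, h1⟩
  rcases (quadNorm_nonneg G⁻¹ x).eq_or_lt with h0 | h0
  · rw [← h0, mul_zero]; exact Real.sqrt_nonneg _
  · refine le_of_mul_le_mul_right ?_ h0
    calc √γ * quadNorm G⁻¹ x * quadNorm G⁻¹ x = √γ * quadNorm G⁻¹ x ^ 2 := by ring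
      _ ≤ √γ * (√(x ⬝ᵥ x) * √(y ⬝ᵥ y)) := by gcongr
      _ = √(x ⬝ᵥ x) * (√γ * √(y ⬝ᵥ y)) := by ring
      _ ≤ √(x ⬝ᵥ x) * quadNorm G⁻¹ x := by gcongr

/-- Duality gives `|x|²` at most the product of the `G⁻¹`-norm and the `G`-norm of `x`. This turns
an upper eigenvalue bound into a lower bound on confidence widths. -/
theorem sqrt_le_quadNorm_inv {G : Matrix n n ℝ} (hG : G.PosDef) {s : ℝ} (hs : 0 ≤ s)
    (h : ∀ x, x ⬝ᵥ G *ᵥ x ≤ s ^ 2 * (x ⬝ᵥ x)) (x : n → ℝ) :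
    √(x ⬝ᵥ x) ≤ s * quadNorm G⁻¹ x := by
  have h1 := (le_abs_self _).trans (abs_dotProduct_le_quadNorm hG x x)
  have h2 : quadNorm G x ≤ s * √(x ⬝ᵥ x) := by
    refine Real.sqrt_le_iff.2 ⟨by positivity, ?_⟩
    rw [mul_pow, Real.sq_sqrt (dotProduct_self_nonneg_real x)]
    exact h x
  rcases (Real.sqrt_nonneg (x ⬝ᵥ x)).eq_or_lt with h0 | h0
  · rw [← h0]; exact mul_nonneg hs (quadNorm_nonneg _ _)
  · refine le_of_mul_le_mul_right ?_ h0
    rw [Real.mul_self_sqrt (dotProduct_self_nonneg_real x)]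
    calc x ⬝ᵥ x ≤ quadNorm G⁻¹ x * quadNorm G x := h1
      _ ≤ quadNorm G⁻¹ x * (s * √(x ⬝ᵥ x)) :=
        mul_le_mul_of_nonneg_left h2 (quadNorm_nonneg _ _)
      _ = _ := by ring

theorem det_le_pow {G : Matrix n n ℝ} (hG : G.PosSemidef) {c : ℝ}
    (h : ∀ x, x ⬝ᵥ G *ᵥ x ≤ c * (x ⬝ᵥ x)) : G.det ≤ c ^ Fintype.card n := by
  rw [hG.isHermitian.det_eq_prod_eigenvalues, ← Finset.card_univ, ← Finset.prod_const]
  refine Finset.prod_le_prod (fun i _ => hG.eigenvalues_nonneg i) fun i _ => ?_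
  set v := hG.isHermitian.eigenvectorBasis i with hv
  have h1 := h v.ofLp
  have h2 : v.ofLp ⬝ᵥ v.ofLp = 1 := by
    have h3 : ‖v‖ = 1 := hG.isHermitian.eigenvectorBasis.orthonormal.1 i
    have h4 : ⟪v, v⟫ = 1 := by rw [real_inner_self_eq_norm_sq, h3, one_pow]
    rw [← h4, EuclideanSpace.inner_eq_star_dotProduct]
    simp
  have h5 := hG.isHermitian.mulVec_eigenvectorBasis i
  rw [h2, h5, dotProduct_smul, h2] at h1
  simpa using h1

theorem one_add_sum_le_prod {ι : Type*} (s : Finset ι) (f : ι → ℝ) (hf : ∀ i ∈ s, 0 ≤ f i) :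
    1 + ∑ i ∈ s, f i ≤ ∏ i ∈ s, (1 + f i) := by
  classical
  induction s using Finset.induction_on with
  | empty => simp
  | insert a s ha ih =>
    rw [Finset.sum_insert ha, Finset.prod_insert ha]
    have h1 := ih fun i hi => hf i (Finset.mem_insert_of_mem hi)
    have h2 := hf a (Finset.mem_insert_self _ _)
    have h3 : 0 ≤ ∑ i ∈ s, f i := Finset.sum_nonneg fun i hi => hf i (Finset.mem_insert_of_mem hi)
    nlinarith [mul_le_mul_of_nonneg_left h1 (by linarith : 0 ≤ 1 + f a), mul_nonneg h2 h3]

/-- The determinant is the product of `1 + λ` over the eigenvalues, read off from the characteristic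
polynomial at `-1`; expanding the product leaves only nonnegative further terms. -/
theorem one_add_trace_le_det {P : Matrix n n ℝ} (hP : P.PosSemidef) :
    1 + P.trace ≤ (1 + P).det := by
  have h1 : (1 + P).det = ∏ i, (1 + hP.isHermitian.eigenvalues i) := by
    have h := congrArg (Polynomial.eval (-1)) hP.isHermitian.charpoly_eq
    rw [eval_charpoly, Polynomial.eval_prod] at h
    simp only [Polynomial.eval_sub, Polynomial.eval_X, Polynomial.eval_C] at h
    have h2 : (scalar n (-1 : ℝ)) - P = -(1 + P) := by
      rw [map_neg, map_one, neg_add, sub_eq_add_neg]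
    have h3 : ∀ i, ((-1 : ℝ) - ((hP.isHermitian.eigenvalues i : ℝ))) =
        -1 * (1 + hP.isHermitian.eigenvalues i) := fun i => by ring
    rw [h2, det_neg] at h
    simp only [RCLike.ofReal_real_eq_id, id] at h
    rw [Finset.prod_congr rfl fun i _ => h3 i, Finset.prod_mul_distrib, Finset.prod_const,
      Finset.card_univ] at h
    exact mul_left_cancel₀ (pow_ne_zero _ (by norm_num)) h
  rw [h1, hP.isHermitian.trace_eq_sum_eigenvalues]
  exact one_add_sum_le_prod _ _ fun i _ => hP.eigenvalues_nonneg i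

open scoped MatrixOrder in
-- With `G = BᴴB`, factor `G + A = Bᴴ(1 + P)B`, where `P` is `A` conjugated by `B⁻¹`, and compare
-- the trace of `P` with `det (1 + P)`. A whole batch of rank-one updates is thus handled at once.
theorem det_mul_one_add_trace_le {G A : Matrix n n ℝ} (hG : G.PosDef) (hA : A.PosSemidef) :
    G.det * (1 + (A * G⁻¹).trace) ≤ (G + A).det := by
  obtain ⟨B, rfl⟩ := CStarAlgebra.nonneg_iff_eq_star_mul_self.mp hG.posSemidef.nonneg
  have hdet : IsUnit B.det := by
    have h := (isUnit_iff_isUnit_det _).1 hG.isUnit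
    rw [det_mul] at h
    exact isUnit_of_mul_isUnit_right h
  have hBB : B⁻¹ * B = 1 := nonsing_inv_mul _ hdet
  have hBB' : star B * star B⁻¹ = 1 := by rw [← star_mul, hBB, star_one]
  have hP := hA.conjTranspose_mul_mul_same B⁻¹
  have h1 := one_add_trace_le_det hP
  have h2 : star B * B + A = star B * (1 + (B⁻¹)ᴴ * A * B⁻¹) * B := by
    rw [← star_eq_conjTranspose]
    calc star B * B + A = star B * B + (star B * star B⁻¹) * A * (B⁻¹ * B) := by
          rw [hBB, hBB', one_mul, mul_one]
      _ = _ := by noncomm_ring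
  have h3 : ((B⁻¹)ᴴ * A * B⁻¹).trace = (A * (star B * B)⁻¹).trace := by
    rw [mul_assoc, trace_mul_comm, Matrix.mul_inv_rev, mul_assoc]
    congr 3
    rw [star_eq_conjTranspose, conjTranspose_nonsing_inv]
  rw [h2, det_mul, det_mul, det_mul, ← h3]
  have h4 : 0 ≤ (star B).det * B.det := by rw [← det_mul]; exact hG.det_pos.le
  calc _ ≤ (star B).det * B.det * (1 + (B⁻¹)ᴴ * A * B⁻¹).det := by gcongr
    _ = _ := by ring

end LinearAlgebra

end C2MAB

namespace C2MAB

/-! ### Expectations under discrete laws, extended nonnegative and real. -/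

section Expectation

open scoped ENNReal

variable {α β : Type*}

/-- Expectation of a nonnegative extended real function under a discrete law. -/
def lexp (p : PMF α) (f : α → ℝ≥0∞) : ℝ≥0∞ := ∑' a, p a * f a

theorem lexp_bind (p : PMF α) (k : α → PMF β) (f : β → ℝ≥0∞) :
    lexp (p.bind k) f = lexp p fun a => lexp (k a) f := by
  unfold lexp
  simp only [PMF.bind_apply, ← ENNReal.tsum_mul_right, ← ENNReal.tsum_mul_left]
  rw [ENNReal.tsum_comm]
  simp only [mul_assoc]

theorem lexp_pure (a : α) (f : α → ℝ≥0∞) : lexp (PMF.pure a) f = f a := by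
  unfold lexp
  rw [tsum_eq_single a]
  · simp
  · intro b hb; simp [hb]

theorem lexp_map (p : PMF α) (g : α → β) (f : β → ℝ≥0∞) :
    lexp (p.map g) f = lexp p fun a => f (g a) := by
  rw [← PMF.bind_pure_comp, lexp_bind]
  simp only [Function.comp_apply, lexp_pure]

theorem lexp_mono (p : PMF α) {f g : α → ℝ≥0∞} (h : ∀ a ∈ p.support, f a ≤ g a) :
    lexp p f ≤ lexp p g := by
  refine ENNReal.tsum_le_tsum fun a => ?_
  by_cases ha : p a = 0
  · simp [ha]
  · exact mul_le_mul_right (h a ha) _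

theorem lexp_add (p : PMF α) (f g : α → ℝ≥0∞) :
    lexp p (fun a => f a + g a) = lexp p f + lexp p g := by
  unfold lexp
  simp only [mul_add]
  exact ENNReal.tsum_add

theorem lexp_const_mul (p : PMF α) (c : ℝ≥0∞) (f : α → ℝ≥0∞) :
    lexp p (fun a => c * f a) = c * lexp p f := by
  unfold lexp
  rw [← ENNReal.tsum_mul_left]
  exact tsum_congr fun a => mul_left_comm _ _ _

theorem lexp_finset_sum {ι : Type*} (p : PMF α) (s : Finset ι) (f : ι → α → ℝ≥0∞) :
    lexp p (fun a => ∑ i ∈ s, f i a) = ∑ i ∈ s, lexp p (f i) := by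
  unfold lexp
  simp only [Finset.mul_sum]
  exact Summable.tsum_finsetSum fun i _ => ENNReal.summable

theorem lexp_const (p : PMF α) (c : ℝ≥0∞) : lexp p (fun _ => c) = c := by
  unfold lexp
  rw [ENNReal.tsum_mul_right, p.tsum_coe, one_mul]

/-- Expectation of a real function under a discrete law. -/
def expect (p : PMF α) (f : α → ℝ) : ℝ := ∑' a, (p a).toReal * f a

/-- `f` is bounded on the support of `p`. -/
def BddOnSupport (p : PMF α) (f : α → ℝ) : Prop := ∃ B, ∀ a ∈ p.support, |f a| ≤ B

theorem summable_toReal (p : PMF α) : Summable fun a => (p a).toReal :=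
  ENNReal.summable_toReal p.tsum_coe_ne_top

theorem tsum_toReal (p : PMF α) : ∑' a, (p a).toReal = 1 := by
  rw [← ENNReal.tsum_toReal_eq p.apply_ne_top, p.tsum_coe, ENNReal.toReal_one]

theorem BddOnSupport.summable {p : PMF α} {f : α → ℝ} (hf : BddOnSupport p f) :
    Summable fun a => (p a).toReal * f a := by
  obtain ⟨B, hB⟩ := hf
  refine Summable.of_norm_bounded ((summable_toReal p).mul_right B) fun a => ?_
  rw [Real.norm_eq_abs, abs_mul, abs_of_nonneg ENNReal.toReal_nonneg]
  by_cases ha : p a = 0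
  · simp [ha]
  · exact mul_le_mul_of_nonneg_left (hB a ha) ENNReal.toReal_nonneg

theorem BddOnSupport.add {p : PMF α} {f g : α → ℝ} (hf : BddOnSupport p f)
    (hg : BddOnSupport p g) : BddOnSupport p fun a => f a + g a := by
  obtain ⟨B, hB⟩ := hf
  obtain ⟨C, hC⟩ := hg
  exact ⟨B + C, fun a ha => (abs_add_le _ _).trans (add_le_add (hB a ha) (hC a ha))⟩

theorem BddOnSupport.const_mul {p : PMF α} {f : α → ℝ} (c : ℝ) (hf : BddOnSupport p f) :
    BddOnSupport p fun a => c * f a := by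
  obtain ⟨B, hB⟩ := hf
  refine ⟨|c| * B, fun a ha => ?_⟩
  rw [abs_mul]
  exact mul_le_mul_of_nonneg_left (hB a ha) (abs_nonneg c)

theorem BddOnSupport.sub {p : PMF α} {f g : α → ℝ} (hf : BddOnSupport p f)
    (hg : BddOnSupport p g) : BddOnSupport p fun a => f a - g a := by
  simpa [sub_eq_add_neg] using hf.add (hg.const_mul (-1))

theorem BddOnSupport.of_const (p : PMF α) (c : ℝ) : BddOnSupport p fun _ => c :=
  ⟨|c|, fun _ _ => le_rfl⟩

theorem BddOnSupport.of_mem_Icc {p : PMF α} {f : α → ℝ} {a b : ℝ}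
    (h : ∀ x ∈ p.support, a ≤ f x ∧ f x ≤ b) : BddOnSupport p f :=
  ⟨max |a| |b|, fun x hx => abs_le_max_abs_abs (h x hx).1 (h x hx).2⟩

theorem BddOnSupport.of_finite [Finite α] (p : PMF α) (f : α → ℝ) :
    BddOnSupport p f := by
  obtain ⟨B, hB⟩ := (Set.finite_range fun a => |f a|).bddAbove
  exact ⟨B, fun a _ => hB ⟨a, rfl⟩⟩

theorem expect_mono {p : PMF α} {f g : α → ℝ} (hf : BddOnSupport p f) (hg : BddOnSupport p g)
    (h : ∀ a ∈ p.support, f a ≤ g a) : expect p f ≤ expect p g := by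
  refine Summable.tsum_le_tsum (fun a => ?_) hf.summable hg.summable
  by_cases ha : p a = 0
  · simp [ha]
  · exact mul_le_mul_of_nonneg_left (h a ha) ENNReal.toReal_nonneg

theorem expect_add {p : PMF α} {f g : α → ℝ} (hf : BddOnSupport p f) (hg : BddOnSupport p g) :
    expect p (fun a => f a + g a) = expect p f + expect p g := by
  unfold expect
  simp only [mul_add]
  exact hf.summable.tsum_add hg.summable

theorem expect_sub {p : PMF α} {f g : α → ℝ} (hf : BddOnSupport p f) (hg : BddOnSupport p g) :
    expect p (fun a => f a - g a) = expect p f - expect p g := by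
  unfold expect
  simp only [mul_sub]
  exact hf.summable.tsum_sub hg.summable

theorem expect_const_mul (p : PMF α) (c : ℝ) (f : α → ℝ) :
    expect p (fun a => c * f a) = c * expect p f := by
  unfold expect
  rw [← tsum_mul_left]
  exact tsum_congr fun a => mul_left_comm _ _ _

theorem expect_const (p : PMF α) (c : ℝ) : expect p (fun _ => c) = c := by
  unfold expect
  rw [tsum_mul_right, tsum_toReal, one_mul]

theorem expect_le_const {p : PMF α} {f : α → ℝ} {c : ℝ} (hf : BddOnSupport p f)
    (h : ∀ a ∈ p.support, f a ≤ c) : expect p f ≤ c :=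
  (expect_mono hf (.of_const p c) h).trans_eq (expect_const p c)

theorem expect_congr {p : PMF α} {f g : α → ℝ} (h : ∀ a ∈ p.support, f a = g a) :
    expect p f = expect p g := by
  refine tsum_congr fun a => ?_
  by_cases ha : p a = 0
  · simp [ha]
  · rw [h a ha]

theorem expect_pure (a : α) (f : α → ℝ) : expect (PMF.pure a) f = f a := by
  unfold expect
  rw [tsum_eq_single a]
  · simp
  · intro b hb; simp [hb]

theorem summable_prod_toReal (p : PMF α) (k : α → PMF β) :
    Summable fun x : β × α => (p x.2).toReal * (k x.2 x.1).toReal := by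
  have h : ∑' x : β × α, p x.2 * k x.2 x.1 ≠ ∞ := by
    rw [ENNReal.tsum_prod (f := fun b a => p a * k a b)]
    exact (p.bind k).tsum_coe_ne_top
  simpa only [ENNReal.toReal_mul] using ENNReal.summable_toReal h

/-- Boundedness on the support dominates the double series by a multiple of the joint probabilities,
so the order of summation can be exchanged. Points outside the support carry no weight, whatever `f`
is there. -/
theorem expect_bind {p : PMF α} {k : α → PMF β} {f : β → ℝ} (hf : BddOnSupport (p.bind k) f) :
    expect (p.bind k) f = expect p fun a => expect (k a) f := by
  obtain ⟨B, hB⟩ := hf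
  have hs : Summable (Function.uncurry fun (b : β) (a : α) =>
      (p a).toReal * (k a b).toReal * f b) := by
    refine Summable.of_norm_bounded ((summable_prod_toReal p k).mul_right B) fun x => ?_
    obtain ⟨b, a⟩ := x
    simp only [Function.uncurry_apply_pair]
    have h0 : 0 ≤ (p a).toReal * (k a b).toReal :=
      mul_nonneg ENNReal.toReal_nonneg ENNReal.toReal_nonneg
    rw [Real.norm_eq_abs, abs_mul, abs_of_nonneg h0]
    by_cases ha : p a = 0
    · simp [ha]
    by_cases hb : k a b = 0
    · simp [hb]
    exact mul_le_mul_of_nonneg_left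
      (hB b ((PMF.mem_support_bind_iff _ _ _).2 ⟨a, ha, hb⟩)) h0
  have h1 : ∀ b, (p.bind k b).toReal * f b = ∑' a, (p a).toReal * (k a b).toReal * f b := by
    intro b
    rw [PMF.bind_apply, ENNReal.tsum_toReal_eq
      fun a => ENNReal.mul_ne_top (p.apply_ne_top a) ((k a).apply_ne_top b), tsum_mul_right]
    simp only [ENNReal.toReal_mul]
  unfold expect
  rw [tsum_congr h1, ← hs.tsum_comm]
  refine tsum_congr fun a => ?_
  rw [← tsum_mul_left]
  simp only [mul_assoc]

theorem expect_map (p : PMF α) (g : α → β) {f : β → ℝ} (hf : BddOnSupport (p.map g) f) :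
    expect (p.map g) f = expect p fun a => f (g a) := by
  rw [← PMF.bind_pure_comp] at hf ⊢
  rw [expect_bind hf]
  simp only [Function.comp_apply, expect_pure]

theorem expect_fintype [Fintype α] (p : PMF α) (f : α → ℝ) :
    expect p f = ∑ a, (p a).toReal * f a := tsum_fintype _

theorem BddOnSupport.expect {p : PMF α} {k : α → PMF β} {f : β → ℝ}
    (hf : BddOnSupport (p.bind k) f) : BddOnSupport p fun a => expect (k a) f := by
  obtain ⟨B, hB⟩ := hf
  refine ⟨B, fun a ha => ?_⟩
  have h : ∀ b ∈ (k a).support, |f b| ≤ B := fun b hb =>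
    hB b ((PMF.mem_support_bind_iff _ _ _).2 ⟨a, ha, hb⟩)
  rw [abs_le]
  constructor
  · rw [← expect_const (k a) (-B)]
    exact expect_mono (.of_const _ _) ⟨B, h⟩ fun b hb => (abs_le.1 (h b hb)).1
  · exact expect_le_const ⟨B, h⟩ fun b hb => (abs_le.1 (h b hb)).2

theorem expect_indicator_eq (p : PMF α) (s : Set α) [DecidablePred (· ∈ s)] :
    C2MAB.expect p (fun a => if a ∈ s then 1 else 0) =
      (lexp p fun a => if a ∈ s then 1 else 0).toReal := by
  unfold C2MAB.expect lexp
  rw [ENNReal.tsum_toReal_eq]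
  · refine tsum_congr fun a => ?_
    by_cases h : a ∈ s <;> simp [h]
  · intro a
    by_cases h : a ∈ s <;> simp [h, p.apply_ne_top]

end Expectation

end C2MAB

namespace C2MAB

/-! ### Products over revealed outcomes under local triggering. -/

section Product

open scoped ENNReal

variable {ι κ : Type*} [Fintype ι] [DecidableEq ι] [Fintype κ]

/-- Coordinates on which a function does not depend integrate out of a product weight. -/
theorem sum_prod_mul_eq_sum_restrict [Inhabited κ] (A : Finset ι) (u : ι → κ → ℝ≥0∞)
    (f : (ι → κ) → ℝ≥0∞) (hf : ∀ x y : ι → κ, (∀ i ∈ A, x i = y i) → f x = f y)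
    (hu : ∀ i, i ∉ A → ∑ b, u i b = 1) :
    ∑ x : ι → κ, (∏ i, u i (x i)) * f x =
      ∑ y : {i // i ∈ A} → κ, (∏ i : {i // i ∈ A}, u i (y i)) *
        f fun i => if h : i ∈ A then y ⟨i, h⟩ else default := by
  rw [← (Equiv.piEquivPiSubtypeProd (· ∈ A) fun _ => κ).symm.sum_comp, Fintype.sum_prod_type]
  refine Finset.sum_congr rfl fun y _ => ?_
  have h1 : ∀ z : {i // i ∉ A} → κ,
      (∏ i, u i ((Equiv.piEquivPiSubtypeProd (· ∈ A) fun _ => κ).symm (y, z) i)) *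
        f ((Equiv.piEquivPiSubtypeProd (· ∈ A) fun _ => κ).symm (y, z)) =
      ((∏ i : {i // i ∈ A}, u i (y i)) * f fun i => if h : i ∈ A then y ⟨i, h⟩ else default) *
        ∏ i : {i // i ∉ A}, u i (z i) := by
    intro z
    rw [← Fintype.prod_subtype_mul_prod_subtype (· ∈ A), mul_right_comm]
    congr 1
    · congr 1
      · refine Finset.prod_congr (by ext; simp) fun i _ => ?_
        simp [Equiv.piEquivPiSubtypeProd, i.2]
      · refine hf _ _ fun i hi => ?_
        simp [Equiv.piEquivPiSubtypeProd, hi]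
    · refine Finset.prod_congr rfl fun i _ => ?_
      simp [Equiv.piEquivPiSubtypeProd, i.2]
  have h2 : ∑ z : {i // i ∉ A} → κ, ∏ i : {i // i ∉ A}, u i (z i) = 1 := by
    rw [← Fintype.prod_sum fun (i : {i // i ∉ A}) b => u i b]
    exact Finset.prod_eq_one fun i _ => hu i.1 i.2
  rw [Finset.sum_congr rfl fun z _ => h1 z, ← Finset.mul_sum, h2, mul_one]

/-- Only the marginal on `A` matters to `f`, and the two families of weights have the same one. -/
theorem sum_prod_mul_congr [Inhabited κ] (A : Finset ι) (u q : ι → κ → ℝ≥0∞)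
    (f : (ι → κ) → ℝ≥0∞) (hf : ∀ x y : ι → κ, (∀ i ∈ A, x i = y i) → f x = f y)
    (hu : ∀ i, i ∉ A → ∑ b, u i b = 1) (hq : ∀ i, i ∉ A → ∑ b, q i b = 1)
    (h : ∀ i ∈ A, u i = q i) :
    ∑ x : ι → κ, (∏ i, u i (x i)) * f x = ∑ x : ι → κ, (∏ i, q i (x i)) * f x := by
  rw [sum_prod_mul_eq_sum_restrict A u f hf hu, sum_prod_mul_eq_sum_restrict A q f hf hq]
  refine Finset.sum_congr rfl fun y _ => ?_
  congr 1
  exact Finset.prod_congr rfl fun i _ => by rw [h i i.2]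

theorem lexp_fintype {α : Type*} [Fintype α] (p : PMF α) (f : α → ℝ≥0∞) :
    lexp p f = ∑ a, p a * f a := tsum_fintype _

/-- Because triggering does not look at outcomes that it does not reveal, a product of nonnegative
functions of the revealed outcomes with means at most one has mean at most one. -/
theorem lexp_trig_prod_le {m d : ℕ} {𝒜 : Type*} (I : Instance m d 𝒜) (S : 𝒜) (μ : Fin m → ℝ)
    (g : Fin m → Bool → ℝ≥0∞) (hg : ∀ i, ∑ b, bernoulliWeight (μ i) b * g i b ≤ 1) :
    lexp (outcomeLaw μ) (fun x => lexp (I.trig S x) fun τ => ∏ i ∈ τ, g i (x i)) ≤ 1 := by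
  set w : Fin m → Bool → ℝ≥0∞ := fun i b => bernoulliWeight (μ i) b with hw
  -- The tilted weights `w * g` may have mass below one; the missing mass is put on `true`. The
  -- result is a probability weight that dominates `w * g`.
  set q : Fin m → Bool → ℝ≥0∞ := fun i b =>
    w i b * g i b + if b then 1 - ∑ b, w i b * g i b else 0 with hq
  have hq1 : ∀ i, ∑ b, q i b = 1 := by
    intro i
    simp only [hq, Finset.sum_add_distrib]
    rw [Finset.sum_ite_eq_of_mem' Finset.univ true (fun _ => 1 - ∑ b, w i b * g i b)
      (Finset.mem_univ _)]
    exact add_tsub_cancel_of_le (hg i)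
  have hw1 : ∀ i, ∑ b, w i b = 1 := fun i => bernoulliWeight_sum (μ i)
  have hA : ∀ A : Finset (Fin m),
      ∑ x : Fin m → Bool, (∏ i, w i (x i)) * (I.trig S x A * ∏ i ∈ A, g i (x i)) ≤
        ∑ x : Fin m → Bool, (∏ i, q i (x i)) * I.trig S x A := by
    intro A
    -- For fixed `A`, the probability of triggering `A` ignores the coordinates off `A`, where `w`
    -- and `q` both have mass one and can be exchanged. The resulting law no longer depends on `A`,
    -- so summing over `A` gives total mass one.
    rw [← sum_prod_mul_congr A (fun i b => if i ∈ A then q i b else w i b) q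
      (fun x => I.trig S x A) (fun x y h => I.trig_local S x y A h)
      (fun i hi => by simpa [hi] using hw1 i) (fun i _ => hq1 i)
      (fun i hi => by simp [hi])]
    refine Finset.sum_le_sum fun x _ => ?_
    rw [mul_left_comm, mul_comm]
    gcongr
    rw [← Finset.prod_filter_mul_prod_filter_not Finset.univ (· ∈ A) fun i => w i (x i),
      ← Finset.prod_filter_mul_prod_filter_not Finset.univ (· ∈ A) fun i =>
        if i ∈ A then q i (x i) else w i (x i)]
    rw [mul_right_comm]
    have hfil : Finset.univ.filter (· ∈ A) = A := by ext; simp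
    rw [hfil, ← Finset.prod_mul_distrib]
    refine mul_le_mul' (Finset.prod_le_prod' fun i hi => ?_) (Finset.prod_le_prod' fun i hi => ?_)
    · rw [if_pos hi]; exact le_self_add
    · rw [if_neg (Finset.mem_filter.1 hi).2]
  have hsum : lexp (outcomeLaw μ) (fun x => lexp (I.trig S x) fun τ => ∏ i ∈ τ, g i (x i)) =
      ∑ A : Finset (Fin m), ∑ x : Fin m → Bool,
        (∏ i, w i (x i)) * (I.trig S x A * ∏ i ∈ A, g i (x i)) := by
    simp only [lexp_fintype]
    rw [Finset.sum_comm]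
    refine Finset.sum_congr rfl fun x _ => ?_
    rw [Finset.mul_sum]
    rfl
  rw [hsum]
  calc _ ≤ ∑ A : Finset (Fin m), ∑ x : Fin m → Bool, (∏ i, q i (x i)) * I.trig S x A :=
        Finset.sum_le_sum fun A _ => hA A
    _ = ∑ x : Fin m → Bool, ∏ i, q i (x i) := by
        rw [Finset.sum_comm]
        refine Finset.sum_congr rfl fun x _ => ?_
        rw [← Finset.mul_sum, ← tsum_fintype (L := .unconditional _), (I.trig S x).tsum_coe,
          mul_one]
    _ = 1 := by
        rw [← Fintype.prod_sum fun i b => q i b]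
        exact Finset.prod_eq_one fun i _ => hq1 i

end Product

/-! ### Consequences of smoothness and triggering for an instance. -/

namespace Instance

universe u

variable {m d : ℕ} {𝒜 : Type u} (I : Instance m d 𝒜)

theorem toReal_outcomeLaw (μ : Fin m → ℝ) (x : Fin m → Bool) :
    (outcomeLaw μ x).toReal =
      ∏ i, if x i then max 0 (min 1 (μ i)) else 1 - max 0 (min 1 (μ i)) := by
  unfold outcomeLaw
  rw [PMF.ofFintype_apply, ENNReal.toReal_prod]
  refine Finset.prod_congr rfl fun i _ => ?_
  unfold bernoulliWeight
  rw [ENNReal.toReal_ofReal]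
  have h1 : max 0 (min 1 (μ i)) ≤ 1 := max_le zero_le_one (min_le_left _ _)
  split_ifs
  · exact le_max_left _ _
  · linarith

theorem continuous_expReward (S : 𝒜) : Continuous (I.expReward S) := by
  unfold expReward
  refine continuous_finsetSum _ fun x _ => Continuous.mul ?_ continuous_const
  simp only [toReal_outcomeLaw]
  refine continuous_finsetProd _ fun i _ => ?_
  split_ifs <;> fun_prop

theorem expReward_nonneg (S : 𝒜) (μ : Fin m → ℝ) : 0 ≤ I.expReward S μ :=
  Finset.sum_nonneg fun x _ => mul_nonneg ENNReal.toReal_nonneg <|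
    Finset.sum_nonneg fun τ _ => mul_nonneg ENNReal.toReal_nonneg (I.reward_nonneg S x τ)

variable {I} {Bv B1 : ℝ}

/-- The smoothness bound on the closed cube, provided that coordinates of the base point without
variance do not move. -/
theorem VMSmooth.closed (h : I.VMSmooth Bv B1) (hBv : 0 ≤ Bv) (S : 𝒜) {μ ν : Fin m → ℝ}
    (hμ : ∀ i, μ i ∈ Set.Icc (0 : ℝ) 1) (hν : ∀ i, ν i ∈ Set.Icc (0 : ℝ) 1)
    (h0 : ∀ i, (1 - μ i) * μ i = 0 → ν i = μ i) :
    |I.expReward S ν - I.expReward S μ| ≤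
      Bv * √(∑ i ∈ I.trigSet S, (ν i - μ i) ^ 2 / ((1 - μ i) * μ i)) := by
  -- Both points are contracted towards the centre of the cube, into the open cube where smoothness
  -- applies; the contraction factor tends to one at the end.
  set shrink : ℝ → (Fin m → ℝ) → Fin m → ℝ := fun s x i => (1 - s) * x i + s / 2 with hshrink
  have hlim : ∀ x, Filter.Tendsto (fun s => I.expReward S (shrink s x)) (nhdsWithin 0 (Set.Ioi 0))
      (nhds (I.expReward S x)) := by
    intro x
    have hc : Continuous fun s => I.expReward S (shrink s x) :=
      (I.continuous_expReward S).comp (by fun_prop)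
    have := hc.tendsto 0
    simp only [hshrink, sub_zero, one_mul, zero_div, add_zero] at this
    exact this.mono_left nhdsWithin_le_nhds
  have hmem : ∀ s ∈ Set.Ioo (0 : ℝ) 1, ∀ x : Fin m → ℝ, (∀ i, x i ∈ Set.Icc (0 : ℝ) 1) →
      ∀ i, shrink s x i ∈ Set.Ioo (0 : ℝ) 1 := by
    intro s hs x hx i
    have h1 := mul_nonneg (sub_nonneg.2 hs.2.le) (hx i).1
    have h2 := mul_nonneg (sub_nonneg.2 hs.2.le) (sub_nonneg.2 (hx i).2)
    constructor <;> simp only [hshrink] <;> nlinarith [hs.1, hs.2]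
  refine le_of_tendsto ((hlim ν).sub (hlim μ)).abs ?_
  have hev : Set.Ioo (0 : ℝ) 1 ∈ nhdsWithin (0 : ℝ) (Set.Ioi 0) :=
    Ioo_mem_nhdsGT zero_lt_one
  filter_upwards [hev] with s hs
  have h1 := h S (shrink s μ) (shrink s ν) (fun i => shrink s ν i - shrink s μ i) (fun _ => 0)
    (hmem s hs μ hμ) (hmem s hs ν hν)
    (fun i => by
      have a := hmem s hs μ hμ i
      have b := hmem s hs ν hν i
      constructor <;> linarith [a.1, a.2, b.1, b.2])
    (fun i => by constructor <;> norm_num) (fun i => by ring)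
  simp only [abs_zero, Finset.sum_const_zero, mul_zero, add_zero] at h1
  refine h1.trans (mul_le_mul_of_nonneg_left (Real.sqrt_le_sqrt ?_) hBv)
  refine Finset.sum_le_sum fun i _ => ?_
  have hV : 0 ≤ (1 - μ i) * μ i := mul_nonneg (sub_nonneg.2 (hμ i).2) (hμ i).1
  have hs1 : 0 < 1 - s := sub_pos.2 hs.2
  have hdiff : shrink s ν i - shrink s μ i = (1 - s) * (ν i - μ i) := by
    simp only [hshrink]; ring
  rw [hdiff]
  rcases hV.eq_or_lt with hV0 | hV0
  · rw [h0 i hV0.symm]; simp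
  -- The contracted variance is `(1-s)²` times the old one plus a nonnegative remainder, while the
  -- squared difference scales by exactly `(1-s)²`. Hence each quotient only decreases.
  · have hge : (1 - s) ^ 2 * ((1 - μ i) * μ i) ≤ (1 - shrink s μ i) * shrink s μ i := by
      simp only [hshrink]
      nlinarith [mul_pos hs.1 hs1, mul_pos hs.1 hs.1]
    calc ((1 - s) * (ν i - μ i)) ^ 2 / ((1 - shrink s μ i) * shrink s μ i)
        ≤ ((1 - s) * (ν i - μ i)) ^ 2 / ((1 - s) ^ 2 * ((1 - μ i) * μ i)) := by
          gcongr
      _ = (ν i - μ i) ^ 2 / ((1 - μ i) * μ i) := by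
          rw [mul_pow, mul_div_mul_left _ _ (pow_pos hs1 2).ne']

theorem card_trigSet_le (S : 𝒜) : (I.trigSet S).card ≤ I.batchSize := by
  refine le_ciSup (f := fun S => (I.trigSet S).card) ⟨m, ?_⟩ S
  rintro _ ⟨S, rfl⟩
  simpa using Finset.card_le_univ (I.trigSet S)

/-- At the centre the variance is `1/4`, so every normalized square is at most one. This controls
rewards in rounds where nothing is known about the means, without using `B1`. -/
theorem VMSmooth.abs_sub_half_le (h : I.VMSmooth Bv B1) (hBv : 0 ≤ Bv) (S : 𝒜) {ν : Fin m → ℝ}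
    (hν : ∀ i, ν i ∈ Set.Icc (0 : ℝ) 1) :
    |I.expReward S ν - I.expReward S fun _ => 1 / 2| ≤ Bv * √I.batchSize := by
  refine (h.closed hBv S (μ := fun _ => 1 / 2) (fun i => by constructor <;> norm_num) hν
    (fun i hi => by norm_num at hi)).trans ?_
  refine mul_le_mul_of_nonneg_left (Real.sqrt_le_sqrt ?_) hBv
  calc ∑ i ∈ I.trigSet S, (ν i - 1 / 2) ^ 2 / ((1 - 1 / 2) * (1 / 2))
      ≤ ∑ i ∈ I.trigSet S, (1 : ℝ) := by
        refine Finset.sum_le_sum fun i _ => ?_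
        rw [div_le_one (by norm_num)]
        nlinarith [(hν i).1, (hν i).2]
    _ = (I.trigSet S).card := by simp
    _ ≤ I.batchSize := by exact_mod_cast card_trigSet_le S

theorem VMSmooth.abs_sub_le (h : I.VMSmooth Bv B1) (hBv : 0 ≤ Bv) (S : 𝒜) {μ ν : Fin m → ℝ}
    (hμ : ∀ i, μ i ∈ Set.Icc (0 : ℝ) 1) (hν : ∀ i, ν i ∈ Set.Icc (0 : ℝ) 1) :
    |I.expReward S ν - I.expReward S μ| ≤ 2 * Bv * √I.batchSize := by
  have h1 := abs_le.1 (h.abs_sub_half_le hBv S hμ)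
  have h2 := abs_le.1 (h.abs_sub_half_le hBv S hν)
  rw [abs_le]
  constructor <;> linarith [h1.1, h1.2, h2.1, h2.2]

/-- The smoothness constant is nonnegative as soon as some action can trigger an arm. -/
theorem VMSmooth.nonneg (h : I.VMSmooth Bv B1) {S : 𝒜} {j : Fin m} (hj : j ∈ I.trigSet S) :
    0 ≤ Bv := by
  have h1 := h S (fun _ => 1 / 4) (fun _ => 1 / 2) (fun _ => 1 / 4) (fun _ => 0)
    (fun i => by constructor <;> norm_num) (fun i => by constructor <;> norm_num)
    (fun i => by constructor <;> norm_num) (fun i => by constructor <;> norm_num)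
    (fun i => by norm_num)
  simp only [abs_zero, Finset.sum_const_zero, mul_zero, add_zero] at h1
  have h2 := (abs_nonneg _).trans h1
  refine nonneg_of_mul_nonneg_left h2 (Real.sqrt_pos.2 (Finset.sum_pos (fun i _ => ?_) ⟨j, hj⟩))
  norm_num

theorem expReward_le_optReward (hb : I.BoundedReward) {μ : Fin m → ℝ}
    (hμ : ∀ i, μ i ∈ Set.Icc (0 : ℝ) 1) (S : 𝒜) : I.expReward S μ ≤ I.optReward μ :=
  le_ciSup (hb μ hμ) S

theorem optReward_nonneg (μ : Fin m → ℝ) : 0 ≤ I.optReward μ :=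
  Real.iSup_nonneg fun S => I.expReward_nonneg S μ

theorem optReward_le_add [Nonempty 𝒜] (hb : I.BoundedReward) {μ ν : Fin m → ℝ}
    (hν : ∀ i, ν i ∈ Set.Icc (0 : ℝ) 1) {c : ℝ}
    (h : ∀ S, I.expReward S μ ≤ I.expReward S ν + c) : I.optReward μ ≤ I.optReward ν + c :=
  ciSup_le fun S => (h S).trans (add_le_add_left (expReward_le_optReward hb hν S) c)

/-- Triggering probability as an expectation. -/
theorem trigProb_eq_expect (S : 𝒜) (μ : Fin m → ℝ) (i : Fin m) :
    I.trigProb S μ i =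
      expect (outcomeLaw μ) fun x => expect (I.trig S x) fun τ => if i ∈ τ then 1 else 0 := by
  simp only [expect_fintype, mul_ite, mul_one, mul_zero]
  rfl

theorem trigProb_le_one (S : 𝒜) (μ : Fin m → ℝ) (i : Fin m) : I.trigProb S μ i ≤ 1 := by
  rw [trigProb_eq_expect]
  refine expect_le_const (.of_finite _ _) fun x _ => expect_le_const (.of_finite _ _) fun τ _ => ?_
  split_ifs <;> norm_num

theorem trigProb_pos {S : 𝒜} {μ : Fin m → ℝ} {x : Fin m → Bool} {τ : Finset (Fin m)} {i : Fin m}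
    (hx : x ∈ (outcomeLaw μ).support) (hτ : τ ∈ (I.trig S x).support) (hi : i ∈ τ) :
    0 < I.trigProb S μ i := by
  have hx' : 0 < (outcomeLaw μ x).toReal := ENNReal.toReal_pos hx (PMF.apply_ne_top _ _)
  have hτ' : 0 < (I.trig S x τ).toReal := ENNReal.toReal_pos hτ (PMF.apply_ne_top _ _)
  have h0 : ∀ y : Fin m → Bool, 0 ≤ ∑ σ : Finset (Fin m),
      if i ∈ σ then (I.trig S y σ).toReal else 0 := fun y =>
    Finset.sum_nonneg fun σ _ => by split_ifs <;> simp
  refine Finset.sum_pos' (fun y _ => mul_nonneg ENNReal.toReal_nonneg (h0 y))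
    ⟨x, Finset.mem_univ _, mul_pos hx' ?_⟩
  refine Finset.sum_pos' (fun σ _ => by split_ifs <;> simp) ⟨τ, Finset.mem_univ _, ?_⟩
  rwa [if_pos hi]

theorem mem_trigSet {S : 𝒜} {i : Fin m} :
    i ∈ I.trigSet S ↔ ∀ μ ∈ I.meanSet, 0 < I.trigProb S μ i := by
  simp [trigSet]

theorem mem_trigSet_of_triggered (hu : I.UniformTriggering) {S : 𝒜} {μ : Fin m → ℝ}
    (hμ : μ ∈ I.meanSet) {x : Fin m → Bool} {τ : Finset (Fin m)}
    (hx : x ∈ (outcomeLaw μ).support) (hτ : τ ∈ (I.trig S x).support) : τ ⊆ I.trigSet S :=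
  fun i hi => mem_trigSet.2 fun μ' hμ' => hu S i μ hμ μ' hμ' (trigProb_pos hx hτ hi)

theorem bddBelow_trigProb :
    BddBelow {q | ∃ (i : Fin m) (S : 𝒜), ∃ μ ∈ I.meanSet, q = I.trigProb S μ i ∧ 0 < q} :=
  ⟨0, fun _ ⟨_, _, _, _, _, hq⟩ => hq.le⟩

theorem pMin_le_trigProb {S : 𝒜} {i : Fin m} (hi : i ∈ I.trigSet S) {μ : Fin m → ℝ}
    (hμ : μ ∈ I.meanSet) : I.pMin ≤ I.trigProb S μ i :=
  csInf_le bddBelow_trigProb ⟨i, S, μ, hμ, rfl, mem_trigSet.1 hi μ hμ⟩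

/-- The infimum of the empty set of reals is `0`, so positivity of `I.pMin` forces some positive
triggering probability. -/
theorem exists_mem_trigSet (hp : 0 < I.pMin) (hu : I.UniformTriggering) :
    ∃ S, ∃ i, i ∈ I.trigSet S := by
  by_contra! h
  have h0 : {q | ∃ (i : Fin m) (S : 𝒜), ∃ μ ∈ I.meanSet, q = I.trigProb S μ i ∧ 0 < q} = ∅ := by
    refine Set.eq_empty_of_forall_notMem ?_
    rintro q ⟨i, S, μ, hμ, rfl, hq⟩
    exact h S i (mem_trigSet.2 fun μ' hμ' => hu S i μ hμ μ' hμ' hq)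
  rw [pMin, h0, Real.sInf_empty] at hp
  exact hp.false

theorem one_le_batchSize (hp : 0 < I.pMin) (hu : I.UniformTriggering) : 1 ≤ I.batchSize := by
  obtain ⟨S, i, hi⟩ := exists_mem_trigSet hp hu
  exact (Finset.card_pos.2 ⟨i, hi⟩).trans_le (card_trigSet_le S)

theorem pMin_le_one (hp : 0 < I.pMin) (hu : I.UniformTriggering) (hM : I.meanSet.Nonempty) :
    I.pMin ≤ 1 := by
  obtain ⟨S, i, hi⟩ := exists_mem_trigSet hp hu
  obtain ⟨μ, hμ⟩ := hM
  exact (pMin_le_trigProb hi hμ).trans (trigProb_le_one S μ i)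

end Instance

end C2MAB

namespace C2MAB

/-! ### Exponential moments of centred Bernoulli variables. -/

section Bernoulli

theorem bernoulliWeight_of_mem {q : ℝ} (hq : q ∈ Set.Icc (0 : ℝ) 1) (b : Bool) :
    bernoulliWeight q b = ENNReal.ofReal (if b then q else 1 - q) := by
  unfold bernoulliWeight
  rw [min_eq_right hq.2, max_eq_right hq.1]

/-- The product of the moment generating functions at `x` and `-x` is at most `cosh²(x/2) ≤
exp(x²/4)`, and by Jensen the second factor is at least one. The constant `1/4` is not sharp, but it
is the largest value of the optimistic variance, and that is all that is needed. -/
theorem centered_bernoulli_mgf_le {q x : ℝ} (hq : q ∈ Set.Icc (0 : ℝ) 1) :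
    q * Real.exp (x * (1 - q)) + (1 - q) * Real.exp (x * (0 - q)) ≤ Real.exp (x ^ 2 / 4) := by
  obtain ⟨h0, h1⟩ := hq
  have h1' : 0 ≤ 1 - q := sub_nonneg.2 h1
  set A := q * Real.exp (x * (1 - q)) + (1 - q) * Real.exp (x * (0 - q)) with hA
  set A' := q * Real.exp (-(x * (1 - q))) + (1 - q) * Real.exp (-(x * (0 - q))) with hA'
  have hA0 : 0 ≤ A := by positivity
  have hA1 : 1 ≤ A' := by
    have e1 := Real.add_one_le_exp (-(x * (1 - q)))
    have e2 := Real.add_one_le_exp (-(x * (0 - q)))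
    have := add_le_add (mul_le_mul_of_nonneg_left e1 h0) (mul_le_mul_of_nonneg_left e2 h1')
    linarith
  have hprod : A * A' = 1 + 2 * (q * (1 - q)) * (Real.cosh x - 1) := by
    have e1 : Real.exp (x * (1 - q)) * Real.exp (-(x * (1 - q))) = 1 := by
      rw [← Real.exp_add, add_neg_cancel, Real.exp_zero]
    have e2 : Real.exp (x * (0 - q)) * Real.exp (-(x * (0 - q))) = 1 := by
      rw [← Real.exp_add, add_neg_cancel, Real.exp_zero]
    have e3 : Real.exp (x * (1 - q)) * Real.exp (-(x * (0 - q))) = Real.exp x := by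
      rw [← Real.exp_add]; congr 1; ring
    have e4 : Real.exp (x * (0 - q)) * Real.exp (-(x * (1 - q))) = Real.exp (-x) := by
      rw [← Real.exp_add]; congr 1; ring
    rw [Real.cosh_eq]
    calc A * A' = q ^ 2 * (Real.exp (x * (1 - q)) * Real.exp (-(x * (1 - q)))) +
          (1 - q) ^ 2 * (Real.exp (x * (0 - q)) * Real.exp (-(x * (0 - q)))) +
          q * (1 - q) * (Real.exp (x * (1 - q)) * Real.exp (-(x * (0 - q))) +
            Real.exp (x * (0 - q)) * Real.exp (-(x * (1 - q)))) := by rw [hA, hA']; ring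
      _ = _ := by rw [e1, e2, e3, e4]; ring
  have hcosh : (1 : ℝ) ≤ Real.cosh x := Real.one_le_cosh x
  have h2 : A * A' ≤ (1 + Real.cosh x) / 2 := by
    rw [hprod]
    nlinarith [sq_nonneg (q - 1 / 2)]
  have h3 : (1 + Real.cosh x) / 2 = Real.cosh (x / 2) ^ 2 := by
    have := Real.cosh_two_mul (x / 2)
    have h4 := Real.cosh_sq' (x / 2)
    rw [show 2 * (x / 2) = x by ring] at this
    linarith
  have h4 : Real.cosh (x / 2) ^ 2 ≤ Real.exp (x ^ 2 / 4) := by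
    have h5 := pow_le_pow_left₀ (Real.cosh_pos _).le (Real.cosh_le_exp_half_sq (x / 2)) 2
    rw [← Real.exp_nat_mul] at h5
    refine h5.trans_eq ?_
    congr 1; push_cast; ring
  nlinarith

/-- For `|y| ≤ 1` one has `exp y ≤ 1 + y + y²`; the linear terms cancel by centring and the
quadratic ones sum to `x²` times the variance. -/
theorem centered_bernoulli_mgf_le_of_abs_le {q x V : ℝ} (hq : q ∈ Set.Icc (0 : ℝ) 1)
    (hx : |x| ≤ 1) (hV : (1 - q) * q ≤ V) :
    q * Real.exp (x * (1 - q)) + (1 - q) * Real.exp (x * (0 - q)) ≤ Real.exp (x ^ 2 * V) := by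
  obtain ⟨h0, h1⟩ := hq
  have key : ∀ y : ℝ, |y| ≤ 1 → Real.exp y ≤ 1 + y + y ^ 2 := by
    intro y hy
    have := (abs_le.1 (Real.abs_exp_sub_one_sub_id_le hy)).2
    linarith
  have b1 : |x * (1 - q)| ≤ 1 := by
    rw [abs_mul, abs_of_nonneg (sub_nonneg.2 h1)]
    exact mul_le_one₀ hx (sub_nonneg.2 h1) (by linarith)
  have b2 : |x * (0 - q)| ≤ 1 := by
    rw [abs_mul, zero_sub, abs_neg, abs_of_nonneg h0]
    exact mul_le_one₀ hx h0 h1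
  have e1 := mul_le_mul_of_nonneg_left (key _ b1) h0
  have e2 := mul_le_mul_of_nonneg_left (key _ b2) (sub_nonneg.2 h1)
  have e3 := Real.add_one_le_exp (x ^ 2 * V)
  have e4 := mul_le_mul_of_nonneg_left hV (sq_nonneg x)
  nlinarith

/-- The two alternatives are those of `State.Covers.optVar_ge`: variance proxy `1/4` with no
restriction on `x`, or a true variance bound with small `x`. -/
theorem sum_bernoulliWeight_mul_exp_le {q x V : ℝ} (hq : q ∈ Set.Icc (0 : ℝ) 1)
    (h : V = 1 / 4 ∨ (|x| ≤ 1 ∧ (1 - q) * q ≤ V)) :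
    ∑ b : Bool, bernoulliWeight q b *
      ENNReal.ofReal (Real.exp (x * ((if b then 1 else 0) - q) - x ^ 2 * V)) ≤ 1 := by
  have hmain : q * Real.exp (x * (1 - q)) + (1 - q) * Real.exp (x * (0 - q)) ≤
      Real.exp (x ^ 2 * V) := by
    rcases h with rfl | ⟨hx, hV⟩
    · simpa [div_eq_mul_inv] using centered_bernoulli_mgf_le hq
    · exact centered_bernoulli_mgf_le_of_abs_le hq hx hV
  have h1 : 0 ≤ 1 - q := sub_nonneg.2 hq.2
  have h0 : 0 ≤ q := hq.1
  rw [Fintype.sum_bool]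
  simp only [bernoulliWeight_of_mem hq, if_true, Bool.false_eq_true, if_false]
  rw [← ENNReal.ofReal_mul h0, ← ENNReal.ofReal_mul h1, ← ENNReal.ofReal_add
    (by positivity) (by positivity), ENNReal.ofReal_le_one, Real.exp_sub, Real.exp_sub,
    ← mul_div_assoc, ← mul_div_assoc, ← add_div]
  exact div_le_one_of_le₀ hmain (Real.exp_pos _).le

end Bernoulli

/-! ### Confidence intervals, spectral growth of the Gram matrix, and the potential. -/

section Deterministic

open Matrix

universe u

variable {m d : ℕ} {𝒜 : Type u}

theorem clip_mem (x : ℝ) : clip x ∈ Set.Icc (0 : ℝ) 1 :=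
  ⟨le_max_left _ _, max_le zero_le_one (min_le_left _ _)⟩

theorem State.ucb_mem (s : State d) (rho : ℝ) (v : EuclideanSpace ℝ (Fin d)) :
    s.ucb rho v ∈ Set.Icc (0 : ℝ) 1 := clip_mem _

theorem State.lcb_mem (s : State d) (rho : ℝ) (v : EuclideanSpace ℝ (Fin d)) :
    s.lcb rho v ∈ Set.Icc (0 : ℝ) 1 := clip_mem _

/-- The point of the confidence interval of largest Bernoulli variance. -/
def State.pivot (s : State d) (rho : ℝ) (v : EuclideanSpace ℝ (Fin d)) : ℝ :=
  if s.ucb rho v ≤ 1 / 2 then s.ucb rho v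
  else if 1 / 2 ≤ s.lcb rho v then s.lcb rho v
  else 1 / 2

theorem State.optVar_eq (s : State d) (rho : ℝ) (v : EuclideanSpace ℝ (Fin d)) :
    s.optVar rho v = (1 - s.pivot rho v) * s.pivot rho v := by
  unfold State.optVar State.pivot
  split_ifs <;> norm_num

theorem State.pivot_mem (s : State d) (rho : ℝ) (v : EuclideanSpace ℝ (Fin d)) :
    s.pivot rho v ∈ Set.Icc (0 : ℝ) 1 := by
  unfold State.pivot
  split_ifs
  · exact s.ucb_mem rho v
  · exact s.lcb_mem rho v
  · constructor <;> norm_num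

theorem State.optVar_nonneg (s : State d) (rho : ℝ) (v : EuclideanSpace ℝ (Fin d)) :
    0 ≤ s.optVar rho v := by
  rw [s.optVar_eq]
  exact mul_nonneg (sub_nonneg.2 (s.pivot_mem rho v).2) (s.pivot_mem rho v).1

/-- The Gram matrix is symmetric and dominates `γ I`. -/
def State.Regular (γ : ℝ) (s : State d) : Prop :=
  s.gram.IsHermitian ∧ ∀ x, γ * (x ⬝ᵥ x) ≤ x ⬝ᵥ s.gram *ᵥ x

theorem State.Regular.posDef {γ : ℝ} {s : State d} (hs : s.Regular γ) (hγ : 0 < γ) :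
    s.gram.PosDef := posDef_of_form_ge hs.1 hγ hs.2

theorem State.form_update (s : State d) (rho : ℝ) (o : Round m d 𝒜) (x : Fin d → ℝ) :
    x ⬝ᵥ (s.update rho o).gram *ᵥ x = x ⬝ᵥ s.gram *ᵥ x +
      ∑ i ∈ o.triggered, (s.optVar rho (o.ctx i))⁻¹ * ((o.ctx i).ofLp ⬝ᵥ x) ^ 2 := by
  simp only [State.update]
  rw [add_mulVec, dotProduct_add, form_sum_vecMulVec]

theorem State.form_le_update (s : State d) (rho : ℝ) (o : Round m d 𝒜) (x : Fin d → ℝ) :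
    x ⬝ᵥ s.gram *ᵥ x ≤ x ⬝ᵥ (s.update rho o).gram *ᵥ x := by
  rw [s.form_update]
  exact le_add_of_nonneg_right (Finset.sum_nonneg fun i _ =>
    mul_nonneg (inv_nonneg.2 (s.optVar_nonneg rho _)) (sq_nonneg _))

theorem stateOf_regular (γ rho : ℝ) (h : List (Round m d 𝒜)) : (stateOf γ rho h).Regular γ := by
  induction h with
  | nil =>
    refine ⟨?_, fun x => ?_⟩
    · simp [stateOf, IsHermitian]
    · simp [stateOf, smul_mulVec, dotProduct_smul]
  | cons o h ih =>
    refine ⟨?_, fun x => (ih.2 x).trans ((stateOf γ rho h).form_le_update rho o x)⟩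
    exact ih.1.add (isHermitian_sum_vecMulVec _ _ _)

/-- The noise part `b - (G - γ I) θ` of the regressand. -/
def State.noise (γ : ℝ) (θ : EuclideanSpace ℝ (Fin d)) (s : State d) : Fin d → ℝ :=
  s.regressand - (s.gram *ᵥ θ.ofLp - γ • θ.ofLp)

/-- The normalized noise is at most `β`. -/
def State.Accurate (γ β : ℝ) (θ : EuclideanSpace ℝ (Fin d)) (s : State d) : Prop :=
  quadNorm s.gram⁻¹ (s.noise γ θ) ≤ β

theorem inner_eq_dotProduct (x y : EuclideanSpace ℝ (Fin d)) : ⟪x, y⟫ = x.ofLp ⬝ᵥ y.ofLp := by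
  rw [EuclideanSpace.inner_eq_star_dotProduct, dotProduct_comm]
  simp

theorem sqrt_dotProduct_self (x : EuclideanSpace ℝ (Fin d)) : √(x.ofLp ⬝ᵥ x.ofLp) = ‖x‖ := by
  rw [← inner_eq_dotProduct, real_inner_self_eq_norm_sq, Real.sqrt_sq (norm_nonneg x)]

theorem matNorm_eq_quadNorm (M : Matrix (Fin d) (Fin d) ℝ) (x : EuclideanSpace ℝ (Fin d)) :
    matNorm M x = quadNorm M x.ofLp := rfl

theorem matNorm_nonneg (M : Matrix (Fin d) (Fin d) ℝ) (x : EuclideanSpace ℝ (Fin d)) :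
    0 ≤ matNorm M x := Real.sqrt_nonneg _

variable {γ β rho : ℝ} {θ : EuclideanSpace ℝ (Fin d)} {s : State d}

theorem State.sqrt_mul_matNorm_le (hs : s.Regular γ) (hγ : 0 < γ) (v : EuclideanSpace ℝ (Fin d)) :
    √γ * matNorm s.gram⁻¹ v ≤ ‖v‖ := by
  rw [← sqrt_dotProduct_self, matNorm_eq_quadNorm]
  exact quadNorm_inv_le (hs.posDef hγ) hγ hs.2 _

/-- The estimation error is `G⁻¹` applied to the noise minus `γθ`. The noise contributes `β`; the
regularization bias contributes `√γ`, since `G` dominates `γI` and `‖θ‖ ≤ 1`. -/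
theorem State.Accurate.abs_estimate_sub_le (hs : s.Regular γ) (hγ : 0 < γ) (hθ : ‖θ‖ ≤ 1)
    (h : s.Accurate γ β θ) (v : EuclideanSpace ℝ (Fin d)) :
    |⟪v, s.estimate⟫ - ⟪θ, v⟫| ≤ (β + √γ) * matNorm s.gram⁻¹ v := by
  have hG := hs.posDef hγ
  have h1 : s.estimate.ofLp - θ.ofLp = s.gram⁻¹ *ᵥ (s.noise γ θ + -(γ • θ.ofLp)) := by
    have h2 : s.noise γ θ + -(γ • θ.ofLp) = s.regressand - s.gram *ᵥ θ.ofLp := by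
      unfold State.noise; abel
    rw [h2, mulVec_sub, inv_mul_mulVec hG]
    rfl
  rw [real_inner_comm v θ, ← inner_sub_right, inner_eq_dotProduct, WithLp.ofLp_sub, h1]
  refine (form_le_quadNorm_mul hG.inv.posSemidef _ _).trans ?_
  rw [mul_comm, matNorm_eq_quadNorm]
  refine mul_le_mul_of_nonneg_right ?_ (quadNorm_nonneg _ _)
  refine (quadNorm_add_le hG.inv.posSemidef _ _).trans (add_le_add h ?_)
  rw [quadNorm_neg, quadNorm_smul, abs_of_pos hγ]
  have h3 := s.sqrt_mul_matNorm_le hs hγ θ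
  rw [matNorm_eq_quadNorm] at h3
  calc γ * quadNorm s.gram⁻¹ θ.ofLp = √γ * (√γ * quadNorm s.gram⁻¹ θ.ofLp) := by
        rw [← mul_assoc, Real.mul_self_sqrt hγ.le]
    _ ≤ √γ * 1 := mul_le_mul_of_nonneg_left (h3.trans hθ) (Real.sqrt_nonneg γ)
    _ = √γ := mul_one _

theorem clip_mono {x y : ℝ} (h : x ≤ y) : clip x ≤ clip y :=
  max_le_max le_rfl (min_le_min le_rfl h)

theorem clip_sub_clip_le {x y : ℝ} (h : x ≤ y) : clip y - clip x ≤ y - x := by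
  simp only [clip, max_def, min_def]
  split_ifs <;> linarith

/-- What an accurate state knows about an arm of mean `⟪θ, v⟫`. -/
structure State.Covers (s : State d) (rho : ℝ) (θ v : EuclideanSpace ℝ (Fin d)) : Prop where
  lcb_le : s.lcb rho v ≤ ⟪θ, v⟫
  le_ucb : ⟪θ, v⟫ ≤ s.ucb rho v
  width : s.ucb rho v - s.lcb rho v ≤ 4 * rho * matNorm s.gram⁻¹ v
  var_le : (1 - ⟪θ, v⟫) * ⟪θ, v⟫ ≤ s.optVar rho v
  optVar_ge : s.optVar rho v = 1 / 4 ∨ rho * matNorm s.gram⁻¹ v ≤ 2 * s.optVar rho v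
  lcb_le_pivot : s.lcb rho v ≤ s.pivot rho v
  pivot_le_ucb : s.pivot rho v ≤ s.ucb rho v

/-- The error is at most `ρ w` whereas the interval has half-width `2ρ w` before clipping. The spare
`ρ w` keeps the upper bound at distance `ρ w` from `0`, or the lower bound at distance `ρ w` from
`1`, on whichever side decides the variance. As `x(1-x)` is at least half the distance from `x` to
the nearer endpoint, this yields `optVar_ge`. -/
theorem State.Accurate.covers (hs : s.Regular γ) (hγ : 0 < γ) (hβ : 0 ≤ β)
    (hrho : rho = β + √γ) (hθ : ‖θ‖ ≤ 1) (h : s.Accurate γ β θ)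
    {v : EuclideanSpace ℝ (Fin d)} (hv : ⟪θ, v⟫ ∈ Set.Icc (0 : ℝ) 1) : s.Covers rho θ v := by
  have h1 := abs_le.1 (h.abs_estimate_sub_le hs hγ hθ v)
  rw [← hrho] at h1
  have hw := mul_nonneg (by rw [hrho]; positivity : 0 ≤ rho) (matNorm_nonneg s.gram⁻¹ v)
  set q := ⟪θ, v⟫ with hq
  set e := rho * matNorm s.gram⁻¹ v with he
  have hu : min 1 (q + e) ≤ s.ucb rho v := by
    have : clip (q + e) ≤ s.ucb rho v := clip_mono (by rw [mul_assoc, ← he]; linarith [h1.1])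
    exact (le_max_right _ _).trans this
  have hl : s.lcb rho v ≤ max 0 (q - e) := by
    have : s.lcb rho v ≤ clip (q - e) := clip_mono (by rw [mul_assoc, ← he]; linarith [h1.2])
    exact this.trans (max_le_max le_rfl (min_le_right _ _))
  have hlq : s.lcb rho v ≤ q := hl.trans (max_le hv.1 (by linarith))
  have hqu : q ≤ s.ucb rho v := (le_min hv.2 (by linarith)).trans hu
  have hu1 := s.ucb_mem rho v
  have hl1 := s.lcb_mem rho v
  refine ⟨hlq, hqu, ?_, ?_, ?_, ?_, ?_⟩
  · refine (clip_sub_clip_le ?_).trans ?_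
    · rw [mul_assoc, ← he]; linarith
    · rw [mul_assoc, mul_assoc, ← he]; linarith
  · unfold State.optVar
    split_ifs with c1 c2
    · nlinarith
    · nlinarith
    · nlinarith [sq_nonneg (q - 1 / 2)]
  · unfold State.optVar
    split_ifs with c1 c2
    · right
      have : e ≤ s.ucb rho v := by
        rcases min_le_iff.1 hu with h3 | h3
        · linarith
        · linarith [hv.1]
      nlinarith [hu1.1]
    · right
      have : s.lcb rho v ≤ 1 - e := by
        rcases le_max_iff.1 hl with h3 | h3
        · linarith
        · linarith [hv.2]
      nlinarith [hl1.2]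
    · left; rfl
  · unfold State.pivot
    split_ifs with c1 c2 <;> linarith
  · unfold State.pivot
    split_ifs with c1 c2 <;> linarith

/-- If `V` is small, then `‖v‖² ≤ ‖v‖ ≤ c w` and `√γ w ≤ 2V`, so `‖v‖²/V` is at most `2c/√γ`. The
bound is linear in the square root `c` of the largest eigenvalue, which is what prevents exponential
growth. -/
theorem State.Covers.sq_norm_div_le (hs : s.Regular γ) (hγ : 0 < γ) {v : EuclideanSpace ℝ (Fin d)}
    (h : s.Covers rho θ v) (hrho : √γ ≤ rho) (hv : ‖v‖ ≤ 1) {c : ℝ} (hc : √γ ≤ c)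
    (hG : ∀ x, x ⬝ᵥ s.gram *ᵥ x ≤ c ^ 2 * (x ⬝ᵥ x)) :
    (s.optVar rho v)⁻¹ * ‖v‖ ^ 2 ≤ 6 * (c / √γ) := by
  have hγ' : 0 < √γ := Real.sqrt_pos.2 hγ
  have hc0 : 0 ≤ c := hγ'.le.trans hc
  have h1 : 1 ≤ c / √γ := (one_le_div hγ').2 hc
  rcases h.optVar_ge with h2 | h2
  · rw [h2]
    nlinarith [norm_nonneg v]
  · rcases (s.optVar_nonneg rho v).eq_or_lt with h0 | h0
    · rw [← h0, _root_.inv_zero, zero_mul]; positivity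
    · rw [inv_mul_le_iff₀ h0]
      have h3 : ‖v‖ ≤ c * matNorm s.gram⁻¹ v := by
        rw [← sqrt_dotProduct_self, matNorm_eq_quadNorm]
        exact sqrt_le_quadNorm_inv (hs.posDef hγ) hc0 hG _
      have h4 : √γ * matNorm s.gram⁻¹ v ≤ 2 * s.optVar rho v :=
        (mul_le_mul_of_nonneg_right hrho (matNorm_nonneg _ _)).trans h2
      have h5 : ‖v‖ ^ 2 ≤ ‖v‖ := by nlinarith [norm_nonneg v]
      have h6 : ‖v‖ ^ 2 * √γ ≤ c * (2 * s.optVar rho v) := by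
        calc ‖v‖ ^ 2 * √γ ≤ c * matNorm s.gram⁻¹ v * √γ := by gcongr; exact h5.trans h3
          _ = c * (√γ * matNorm s.gram⁻¹ v) := by ring
          _ ≤ _ := by gcongr
      have h7 : ‖v‖ ^ 2 ≤ c * (2 * s.optVar rho v) / √γ := (le_div_iff₀ hγ').2 h6
      refine h7.trans ?_
      rw [show c * (2 * s.optVar rho v) / √γ = 2 * (s.optVar rho v * (c / √γ)) by ring]
      nlinarith [mul_nonneg h0.le (zero_le_one.trans h1)]

/-- Here `w ≤ 1/√γ`, and either `V = 1/4` or `√γ w ≤ 2V`. Consequently `γ ≥ 4K` makes the summed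
bonus of an action at most one. -/
theorem State.Covers.sq_matNorm_div_le (hs : s.Regular γ) (hγ : 0 < γ)
    {v : EuclideanSpace ℝ (Fin d)} (h : s.Covers rho θ v) (hrho : √γ ≤ rho) (hv : ‖v‖ ≤ 1) :
    (s.optVar rho v)⁻¹ * matNorm s.gram⁻¹ v ^ 2 ≤ 4 / γ := by
  set w := matNorm s.gram⁻¹ v with hw
  have hw0 : 0 ≤ w := matNorm_nonneg _ _
  have h1 : √γ * w ≤ 1 := (s.sqrt_mul_matNorm_le hs hγ v).trans hv
  have hγs : √γ ^ 2 = γ := Real.sq_sqrt hγ.le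
  have h3 : γ * w ^ 2 ≤ √γ * w := by
    calc γ * w ^ 2 = (√γ * w) ^ 2 := by rw [mul_pow, hγs]
      _ ≤ √γ * w := by nlinarith [mul_nonneg (Real.sqrt_nonneg γ) hw0]
  rw [le_div_iff₀ hγ]
  rcases h.optVar_ge with h2 | h2
  · rw [h2]; nlinarith
  · rcases (s.optVar_nonneg rho v).eq_or_lt with h0 | h0
    · rw [← h0, _root_.inv_zero]; norm_num
    · rw [mul_assoc, inv_mul_le_iff₀ h0]
      nlinarith [mul_le_mul_of_nonneg_right hrho hw0]

/-- The states of the history and of all its earlier parts are accurate. -/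
def Good (γ rho β : ℝ) (θ : EuclideanSpace ℝ (Fin d)) : List (Round m d 𝒜) → Prop
  | [] => True
  | o :: h => (stateOf γ rho (o :: h)).Accurate γ β θ ∧ Good γ rho β θ h

theorem Good.tail {h : List (Round m d 𝒜)} (hg : Good γ rho β θ h) :
    Good γ rho β θ h.tail := by
  cases h with
  | nil => trivial
  | cons o h => exact hg.2

theorem Good.accurate (hβ : 0 ≤ β) {h : List (Round m d 𝒜)} (hg : Good γ rho β θ h) :
    (stateOf γ rho h).Accurate γ β θ := by
  cases h with
  | nil =>
    simp only [State.Accurate, State.noise, stateOf, quadNorm, smul_mulVec, one_mulVec, sub_self,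
      zero_dotProduct, Real.sqrt_zero]
    exact hβ
  | cons o h => exact hg.1

/-- Histories that the protocol can produce. -/
def Valid (I : Instance m d 𝒜) (env : List (Round m d 𝒜) → Fin m → EuclideanSpace ℝ (Fin d)) :
    List (Round m d 𝒜) → Prop
  | [] => True
  | o :: h => o.ctx = env h ∧ o.triggered ⊆ I.trigSet o.action ∧ Valid I env h

variable {I : Instance m d 𝒜} {env : List (Round m d 𝒜) → Fin m → EuclideanSpace ℝ (Fin d)}

theorem Good.covers (hγ : 0 < γ) (hβ : 0 ≤ β) (hrho : rho = β + √γ) (hθ : ‖θ‖ ≤ 1)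
    (hθI : θ ∈ I.params) (henv : ∀ h, env h ∈ I.features) {h : List (Round m d 𝒜)}
    (hg : Good γ rho β θ h) (i : Fin m) : (stateOf γ rho h).Covers rho θ (env h i) :=
  (hg.accurate hβ).covers (stateOf_regular γ rho h) hγ hβ hrho hθ
    (I.mean_mem θ hθI _ (henv h) i)

/-- Bound on the square root of the largest eigenvalue of the Gram matrix after `t` rounds. -/
def gramBound (K : ℕ) (γ : ℝ) (t : ℕ) : ℝ := √γ * (1 + 3 * K * t / γ)

theorem sqrt_le_gramBound (K : ℕ) (hγ : 0 < γ) (t : ℕ) : √γ ≤ gramBound K γ t := by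
  unfold gramBound
  exact le_mul_of_one_le_right (Real.sqrt_nonneg γ) (le_add_of_nonneg_right (by positivity))

/-- The bound grows by `δ = 3K/√γ` per round, and `(c + δ)² ≥ c² + 2cδ`, whose cross term is the
required increment. -/
theorem gramBound_succ_sq (K : ℕ) (hγ : 0 < γ) (t : ℕ) :
    gramBound K γ t ^ 2 + K * (6 * (gramBound K γ t / √γ)) ≤ gramBound K γ (t + 1) ^ 2 := by
  have hγ' : 0 < √γ := Real.sqrt_pos.2 hγ
  have h1 : gramBound K γ (t + 1) = gramBound K γ t + 3 * K / √γ := by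
    unfold gramBound
    have h2 : 3 * (K : ℝ) / √γ = √γ * (3 * K / γ) := by
      rw [div_eq_iff hγ'.ne', mul_right_comm, Real.mul_self_sqrt hγ.le, mul_div_cancel₀ _ hγ.ne']
    rw [h2]
    push_cast
    ring
  rw [h1]
  have : 0 ≤ (3 * K / √γ) ^ 2 := sq_nonneg _
  have h2 : K * (6 * (gramBound K γ t / √γ)) = 2 * gramBound K γ t * (3 * K / √γ) := by ring
  rw [h2]
  nlinarith

/-- At most `K` arms are triggered per round, and each adds at most the amount in
`State.Covers.sq_norm_div_le`. Accuracy is needed only for `h.tail`, because the weights of the last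
update are fixed before its outcomes are seen. -/
theorem form_le_gramBound (hγ : 0 < γ) (hβ : 0 ≤ β) (hrho : rho = β + √γ) (hθ : ‖θ‖ ≤ 1)
    (hθI : θ ∈ I.params) (henv : ∀ h, env h ∈ I.features) {h : List (Round m d 𝒜)}
    (hv : Valid I env h) (hg : Good γ rho β θ h.tail) (x : Fin d → ℝ) :
    x ⬝ᵥ (stateOf γ rho h).gram *ᵥ x ≤ gramBound I.batchSize γ h.length ^ 2 * (x ⬝ᵥ x) := by
  induction h generalizing x with
  | nil =>
    simp [stateOf, gramBound, smul_mulVec, dotProduct_smul, Real.sq_sqrt hγ.le]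
  | cons o h ih =>
    obtain ⟨hctx, htrig, hv'⟩ := hv
    have hg' : Good γ rho β θ h := hg
    have ih' := ih hv' hg'.tail
    have hx0 := dotProduct_self_nonneg_real x
    set c := gramBound I.batchSize γ h.length with hc
    have hterm : ∀ i ∈ o.triggered, ((stateOf γ rho h).optVar rho (o.ctx i))⁻¹ *
        ((o.ctx i).ofLp ⬝ᵥ x) ^ 2 ≤ 6 * (c / √γ) * (x ⬝ᵥ x) := by
      intro i _
      rw [hctx]
      have h1 := (hg'.covers hγ hβ hrho hθ hθI henv i).sq_norm_div_le
        (stateOf_regular γ rho h) hγ (by rw [hrho]; linarith)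
        (I.norm_feature_le _ (henv h) i) (sqrt_le_gramBound _ hγ _) ih'
      have h2 : ((env h i).ofLp ⬝ᵥ x) ^ 2 ≤ ‖env h i‖ ^ 2 * (x ⬝ᵥ x) := by
        rw [← sq_abs, ← sqrt_dotProduct_self]
        refine (pow_le_pow_left₀ (abs_nonneg _) (abs_dotProduct_le _ _) 2).trans_eq ?_
        rw [mul_pow, Real.sq_sqrt hx0]
      calc _ ≤ ((stateOf γ rho h).optVar rho (env h i))⁻¹ * (‖env h i‖ ^ 2 * (x ⬝ᵥ x)) :=
            mul_le_mul_of_nonneg_left h2 (inv_nonneg.2 (State.optVar_nonneg _ _ _))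
        _ ≤ _ := by rw [← mul_assoc]; exact mul_le_mul_of_nonneg_right h1 hx0
    have hcard : (o.triggered.card : ℝ) ≤ I.batchSize := by
      exact_mod_cast (Finset.card_le_card htrig).trans (Instance.card_trigSet_le _)
    have hc0 : 0 ≤ c / √γ :=
      div_nonneg ((Real.sqrt_nonneg γ).trans (sqrt_le_gramBound _ hγ _)) (Real.sqrt_nonneg γ)
    calc x ⬝ᵥ (stateOf γ rho (o :: h)).gram *ᵥ x
        = x ⬝ᵥ (stateOf γ rho h).gram *ᵥ x + ∑ i ∈ o.triggered,
            ((stateOf γ rho h).optVar rho (o.ctx i))⁻¹ * ((o.ctx i).ofLp ⬝ᵥ x) ^ 2 :=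
          State.form_update _ _ _ _
      _ ≤ c ^ 2 * (x ⬝ᵥ x) + o.triggered.card * (6 * (c / √γ) * (x ⬝ᵥ x)) := by
          refine add_le_add (ih' x) ?_
          simpa using Finset.sum_le_card_nsmul _ _ _ hterm
      _ ≤ c ^ 2 * (x ⬝ᵥ x) + I.batchSize * (6 * (c / √γ) * (x ⬝ᵥ x)) := by gcongr
      _ = (c ^ 2 + I.batchSize * (6 * (c / √γ))) * (x ⬝ᵥ x) := by ring
      _ ≤ _ := mul_le_mul_of_nonneg_right (gramBound_succ_sq _ hγ _) hx0

theorem State.det_mul_le_det_update (hs : s.Regular γ) (hγ : 0 < γ) (o : Round m d 𝒜) :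
    s.gram.det * (1 + ∑ i ∈ o.triggered,
      (s.optVar rho (o.ctx i))⁻¹ * matNorm s.gram⁻¹ (o.ctx i) ^ 2) ≤
      (s.update rho o).gram.det := by
  have hG := hs.posDef hγ
  have hA : (∑ i ∈ o.triggered, (s.optVar rho (o.ctx i))⁻¹ •
      vecMulVec (o.ctx i).ofLp (o.ctx i).ofLp).PosSemidef := by
    refine PosSemidef.of_dotProduct_mulVec_nonneg (isHermitian_sum_vecMulVec _ _ _) fun x => ?_
    rw [star_trivial, form_sum_vecMulVec]
    exact Finset.sum_nonneg fun i _ =>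
      mul_nonneg (inv_nonneg.2 (s.optVar_nonneg rho _)) (sq_nonneg _)
  have h := det_mul_one_add_trace_le hG hA
  rw [Finset.sum_mul, trace_sum] at h
  refine le_of_eq_of_le ?_ h
  congr 2
  refine Finset.sum_congr rfl fun i _ => ?_
  rw [smul_mul, trace_smul, trace_vecMulVec_mul, smul_eq_mul, matNorm_eq_quadNorm,
    sq_quadNorm hG.inv.posSemidef]

open scoped Classical in
/-- Logarithm of the growth of the determinant, stopped when accuracy is lost. -/
def potential (γ rho β : ℝ) (θ : EuclideanSpace ℝ (Fin d)) : List (Round m d 𝒜) → ℝ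
  | [] => 0
  | o :: h => if Good γ rho β θ h then
      Real.log (stateOf γ rho (o :: h)).gram.det - d * Real.log γ
    else potential γ rho β θ h

theorem Good.potential_eq {h : List (Round m d 𝒜)} (hg : Good γ rho β θ h) :
    potential γ rho β θ h = Real.log (stateOf γ rho h).gram.det - d * Real.log γ := by
  cases h with
  | nil => simp [potential, stateOf, Real.log_pow]
  | cons o h => rw [potential, if_pos hg.2]

theorem potential_add_log_le (hγ : 0 < γ) {h : List (Round m d 𝒜)} (hg : Good γ rho β θ h)
    (o : Round m d 𝒜) :
    potential γ rho β θ h + Real.log (1 + ∑ i ∈ o.triggered,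
      ((stateOf γ rho h).optVar rho (o.ctx i))⁻¹ *
        matNorm (stateOf γ rho h).gram⁻¹ (o.ctx i) ^ 2) ≤
      potential γ rho β θ (o :: h) := by
  have hs := stateOf_regular γ rho h
  have hdet := (hs.posDef hγ).det_pos
  have h0 : 0 ≤ ∑ i ∈ o.triggered, ((stateOf γ rho h).optVar rho (o.ctx i))⁻¹ *
        matNorm (stateOf γ rho h).gram⁻¹ (o.ctx i) ^ 2 :=
    Finset.sum_nonneg fun i _ => mul_nonneg (inv_nonneg.2 (State.optVar_nonneg _ _ _)) (sq_nonneg _)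
  rw [potential, if_pos hg, hg.potential_eq]
  have h1 := Real.log_le_log (mul_pos hdet (add_pos_of_pos_of_nonneg one_pos h0))
    (State.det_mul_le_det_update hs hγ o)
  rw [Real.log_mul hdet.ne' (add_pos_of_pos_of_nonneg one_pos h0).ne'] at h1
  have h2 : (stateOf γ rho (o :: h)).gram = ((stateOf γ rho h).update rho o).gram := rfl
  rw [h2, sub_add_eq_add_sub]
  exact sub_le_sub_right h1 _

theorem potential_mono (hγ : 0 < γ) (h : List (Round m d 𝒜)) (o : Round m d 𝒜) :
    potential γ rho β θ h ≤ potential γ rho β θ (o :: h) := by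
  by_cases hg : Good γ rho β θ h
  · refine le_trans ?_ (potential_add_log_le hγ hg o)
    refine le_add_of_nonneg_right (Real.log_nonneg (le_add_of_nonneg_right ?_))
    exact Finset.sum_nonneg fun i _ =>
      mul_nonneg (inv_nonneg.2 (State.optVar_nonneg _ _ _)) (sq_nonneg _)
  · rw [potential, if_neg hg]

theorem potential_nonneg (hγ : 0 < γ) (h : List (Round m d 𝒜)) : 0 ≤ potential γ rho β θ h := by
  induction h with
  | nil => exact le_rfl
  | cons o h ih => exact ih.trans (potential_mono hγ h o)

/-- All eigenvalues of the Gram matrix are at most `gramBound²`; taking the determinant cancels `d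
log γ` and leaves `2d` times the logarithm. Once accuracy is lost the potential is frozen and the
bound only grows. -/
theorem potential_le (hγ : 0 < γ) (hβ : 0 ≤ β) (hrho : rho = β + √γ) (hθ : ‖θ‖ ≤ 1)
    (hθI : θ ∈ I.params) (henv : ∀ h, env h ∈ I.features) {h : List (Round m d 𝒜)}
    (hv : Valid I env h) :
    potential γ rho β θ h ≤ 2 * d * Real.log (1 + 3 * I.batchSize * h.length / γ) := by
  induction h with
  | nil => simp [potential]
  | cons o h ih =>
    by_cases hg : Good γ rho β θ h
    · rw [potential, if_pos hg]
      have hs := stateOf_regular γ rho (o :: h)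
      have hG := hs.posDef hγ
      have h1 := det_le_pow hG.posSemidef
        (form_le_gramBound hγ hβ hrho hθ hθI henv hv hg)
      have h2 := Real.log_le_log hG.det_pos h1
      have hpos : (0 : ℝ) < 1 + 3 * I.batchSize * (o :: h).length / γ := by positivity
      rw [Fintype.card_fin, Real.log_pow, Real.log_pow, gramBound,
        Real.log_mul (Real.sqrt_pos.2 hγ).ne' hpos.ne', Real.log_sqrt hγ.le] at h2
      generalize Real.log (1 + 3 * I.batchSize * (o :: h).length / γ) = L at h2 ⊢
      push_cast at h2
      clear hpos
      linarith
    · rw [potential, if_neg hg]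
      refine (ih hv.2.2).trans ?_
      have : (h.length : ℝ) ≤ (o :: h).length := by simp
      gcongr

end Deterministic

end C2MAB

namespace C2MAB

/-! ### Numerical estimates for the confidence radius. -/

section RadiusNumerics

/-- The logarithmic term of the confidence radius. -/
def logTerm (d K T : ℕ) : ℝ :=
  Real.log (6 * T * (4 * (d : ℝ) ^ 2 * (K : ℝ) ^ 4 * (T : ℝ) ^ 4) ^ d / (1 / T) *
    Real.log (3 * T * (4 * (d : ℝ) ^ 2 * (K : ℝ) ^ 4 * (T : ℝ) ^ 4) ^ d / (1 / T)))

/-- The bound on the normalized noise. -/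
def noiseRadius (d K T : ℕ) : ℝ := 1 + 4 * √(logTerm d K T)

theorem radius_eq (d K T : ℕ) (γ : ℝ) : radius d K T γ = noiseRadius d K T + √γ := by
  unfold radius noiseRadius logTerm
  ring

theorem one_le_noiseRadius (d K T : ℕ) : 1 ≤ noiseRadius d K T :=
  le_add_of_nonneg_right (by positivity)

/-- Each of `T²`, `d`, `KTd` and `1` divides `d²K⁴T⁴`. -/
theorem coverBase_bounds {d K T : ℕ} (hd : 1 ≤ d) (hK : 1 ≤ K) (hT : 1 ≤ T) :
    4 * (T : ℝ) ^ 2 ≤ 4 * (d : ℝ) ^ 2 * (K : ℝ) ^ 4 * (T : ℝ) ^ 4 ∧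
    4 * (d : ℝ) ≤ 4 * (d : ℝ) ^ 2 * (K : ℝ) ^ 4 * (T : ℝ) ^ 4 ∧
    4 * ((K : ℝ) * T * d) ≤ 4 * (d : ℝ) ^ 2 * (K : ℝ) ^ 4 * (T : ℝ) ^ 4 ∧
    4 ≤ 4 * (d : ℝ) ^ 2 * (K : ℝ) ^ 4 * (T : ℝ) ^ 4 := by
  have key : ∀ x : ℕ, x ∣ d ^ 2 * K ^ 4 * T ^ 4 →
      4 * (x : ℝ) ≤ 4 * (d : ℝ) ^ 2 * (K : ℝ) ^ 4 * (T : ℝ) ^ 4 := by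
    intro x hx
    have h1 : x ≤ d ^ 2 * K ^ 4 * T ^ 4 := Nat.le_of_dvd (by positivity) hx
    have h2 : (x : ℝ) ≤ (d : ℝ) ^ 2 * (K : ℝ) ^ 4 * (T : ℝ) ^ 4 := by exact_mod_cast h1
    linarith
  refine ⟨?_, ?_, ?_, ?_⟩
  · exact_mod_cast key (T ^ 2) (Dvd.intro_left (d ^ 2 * K ^ 4 * T ^ 2) (by ring))
  · exact key d (Dvd.intro_left (d * K ^ 4 * T ^ 4) (by ring))
  · exact_mod_cast key (K * T * d) (Dvd.intro_left (d * K ^ 3 * T ^ 3) (by ring))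
  · simpa using key 1 (one_dvd _)

/-- With `U = 6T²N`, the inner logarithm lies between `1` and `U`, so the argument lies between `U`
and `U²`. The lower bound serves the union bound, the upper one the final rate. -/
theorem logTerm_bounds {d K T : ℕ} (hd : 1 ≤ d) (hK : 1 ≤ K) (hT : 1 ≤ T) :
    0 ≤ logTerm d K T ∧
    (6 * (T : ℝ) ^ 2 * (4 * (d : ℝ) ^ 2 * (K : ℝ) ^ 4 * (T : ℝ) ^ 4) ^ d) ^ 4 ≤
      Real.exp (4 * logTerm d K T) ∧
    logTerm d K T ≤ 6 * (d * Real.log (4 * (d : ℝ) ^ 2 * (K : ℝ) ^ 4 * (T : ℝ) ^ 4)) := by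
  obtain ⟨h1, -, -, h4⟩ := coverBase_bounds hd hK hT
  have hT' : (1 : ℝ) ≤ T := by exact_mod_cast hT
  have hd' : (1 : ℝ) ≤ d := by exact_mod_cast hd
  unfold logTerm
  set a : ℝ := 4 * (d : ℝ) ^ 2 * (K : ℝ) ^ 4 * (T : ℝ) ^ 4 with ha
  have hN1 : 1 ≤ a ^ d := one_le_pow₀ (by linarith)
  have haN : a ≤ a ^ d := le_self_pow₀ (by linarith) (by omega)
  have e6 : 6 * T * a ^ d / (1 / T) = 6 * (T : ℝ) ^ 2 * a ^ d := by
    rw [div_div_eq_mul_div, div_one]; ring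
  have e3 : 3 * T * a ^ d / (1 / T) = 3 * (T : ℝ) ^ 2 * a ^ d := by
    rw [div_div_eq_mul_div, div_one]; ring
  rw [e6, e3]
  have hT2 : (1 : ℝ) ≤ (T : ℝ) ^ 2 := one_le_pow₀ hT'
  have hTN : a ^ d ≤ (T : ℝ) ^ 2 * a ^ d := le_mul_of_one_le_left (by linarith) hT2
  set U := 6 * (T : ℝ) ^ 2 * a ^ d with hU
  have hU1 : 1 ≤ U := by rw [hU]; nlinarith
  have hlog1 : 1 ≤ Real.log (3 * (T : ℝ) ^ 2 * a ^ d) := by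
    rw [Real.le_log_iff_exp_le (by nlinarith)]
    have := Real.exp_one_lt_d9
    nlinarith
  have hlogU : Real.log (3 * (T : ℝ) ^ 2 * a ^ d) ≤ U := by
    refine (Real.log_le_self (by nlinarith)).trans ?_
    rw [hU]; nlinarith
  have hUl : U ≤ U * Real.log (3 * (T : ℝ) ^ 2 * a ^ d) := le_mul_of_one_le_right (by linarith) hlog1
  refine ⟨Real.log_nonneg (hU1.trans hUl), ?_, ?_⟩
  · rw [show (4 : ℝ) * Real.log (U * Real.log (3 * (T : ℝ) ^ 2 * a ^ d)) =
      ((4 : ℕ) : ℝ) * Real.log (U * Real.log (3 * (T : ℝ) ^ 2 * a ^ d)) by norm_num,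
      Real.exp_nat_mul, Real.exp_log (by linarith)]
    exact pow_le_pow_left₀ (by linarith) hUl 4
  · have hUa : U ≤ a ^ (d + 2) := by
      rw [pow_add, mul_comm (a ^ d), hU]
      refine mul_le_mul_of_nonneg_right ?_ (by linarith)
      nlinarith
    have hla : 0 ≤ Real.log a := Real.log_nonneg (by linarith)
    have h5 : Real.log U ≤ (d + 2) * Real.log a := by
      have := Real.log_le_log (by linarith) hUa
      rw [Real.log_pow] at this
      push_cast at this
      exact this
    calc Real.log (U * Real.log (3 * (T : ℝ) ^ 2 * a ^ d)) ≤ Real.log (U * U) := by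
          apply Real.log_le_log (by nlinarith)
          gcongr
      _ = 2 * Real.log U := by rw [Real.log_mul (by linarith) (by linarith)]; ring
      _ ≤ _ := by nlinarith

/-- Size of the grid that is used to control the noise. -/
def gridSize (d K T : ℕ) : ℕ := ⌈4 * noiseRadius d K T * (K * T * d)⌉₊

/-- With `a` the base of `N = a^d`, the grid has at most `a⁴` points per coordinate, hence at most
`N⁴` in all, and `exp(4 logTerm)` is at least `(6T²N)⁴`. -/
theorem grid_union_bound {d K T : ℕ} (hd : 1 ≤ d) (hK : 1 ≤ K) (hT : 1 ≤ T) :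
    ((2 * gridSize d K T + 1 : ℕ) : ℝ) ^ d * T * Real.exp (-(4 * logTerm d K T - 1 / 4)) ≤ 1 / T := by
  obtain ⟨h1, h2, h3, h4⟩ := coverBase_bounds hd hK hT
  obtain ⟨l1, l2, l3⟩ := logTerm_bounds hd hK hT
  have hT' : (1 : ℝ) ≤ T := by exact_mod_cast hT
  have hd' : (1 : ℝ) ≤ d := by exact_mod_cast hd
  have hK' : (1 : ℝ) ≤ K := by exact_mod_cast hK
  set a : ℝ := 4 * (d : ℝ) ^ 2 * (K : ℝ) ^ 4 * (T : ℝ) ^ 4 with ha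
  have hla : Real.log a ≤ a := Real.log_le_self (by linarith)
  have hla0 : 0 ≤ Real.log a := Real.log_nonneg (by linarith)
  have hsq : √(logTerm d K T) ≤ 5 / 4 * a := by
    refine Real.sqrt_le_iff.2 ⟨by linarith, l3.trans ?_⟩
    have : d * Real.log a ≤ a / 4 * a := by gcongr; linarith
    nlinarith
  have hβ : noiseRadius d K T ≤ 21 / 4 * a := by
    unfold noiseRadius; linarith
  have hM : ((2 * gridSize d K T + 1 : ℕ) : ℝ) ≤ a ^ 4 := by
    have h5 : 4 * noiseRadius d K T * (K * T * d) ≤ 21 / 4 * a ^ 2 := by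
      calc 4 * noiseRadius d K T * (K * T * d) = noiseRadius d K T * (4 * (K * T * d)) := by ring
        _ ≤ 21 / 4 * a * a := by gcongr
        _ = _ := by ring
    have h6 : (gridSize d K T : ℝ) < 4 * noiseRadius d K T * (K * T * d) + 1 := by
      refine Nat.ceil_lt_add_one ?_
      have := one_le_noiseRadius d K T
      positivity
    have h7 : (16 : ℝ) ≤ a ^ 2 := by nlinarith
    push_cast
    nlinarith
  have hN : ((2 * gridSize d K T + 1 : ℕ) : ℝ) ^ d ≤ (a ^ d) ^ 4 := by
    rw [← pow_mul, mul_comm d 4, pow_mul]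
    exact pow_le_pow_left₀ (by positivity) hM d
  have hexp : Real.exp (-(4 * logTerm d K T - 1 / 4)) ≤ 2 / (6 * (T : ℝ) ^ 2 * a ^ d) ^ 4 := by
    rw [show -(4 * logTerm d K T - 1 / 4) = 1 / 4 - 4 * logTerm d K T by ring, Real.exp_sub]
    have h8 : Real.exp (1 / 4) ≤ 2 := by
      have : Real.exp (1 / 4) ^ 4 ≤ 2 ^ 4 := by
        rw [← Real.exp_nat_mul]
        have := Real.exp_one_lt_d9
        norm_num
        linarith
      exact le_of_pow_le_pow_left₀ (by norm_num) (by norm_num) this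
    have hpos : 0 < (6 * (T : ℝ) ^ 2 * a ^ d) ^ 4 := by positivity
    gcongr
  have hapos : 0 < (a ^ d) ^ 4 := by positivity
  calc ((2 * gridSize d K T + 1 : ℕ) : ℝ) ^ d * T * Real.exp (-(4 * logTerm d K T - 1 / 4))
      ≤ (a ^ d) ^ 4 * T * (2 / (6 * (T : ℝ) ^ 2 * a ^ d) ^ 4) := by gcongr
    _ = 2 / 1296 * (1 / (T : ℝ) ^ 6) * (1 / T) := by
        field_simp
        ring
    _ ≤ 1 * (1 / T) := by
        gcongr
        have : 1 / (T : ℝ) ^ 6 ≤ 1 := by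
          rw [div_le_one (by positivity)]; exact one_le_pow₀ hT'
        linarith
    _ = 1 / T := one_mul _

end RadiusNumerics

end C2MAB

namespace C2MAB

open Matrix

/-! ### Discretized directions. -/

section Grid

/-- Vectors whose coordinates are integer multiples of `η`, of modulus at most `M η`. -/
def grid (d M : ℕ) (η : ℝ) : Finset (Fin d → ℝ) :=
  Fintype.piFinset fun _ => (Finset.Icc (-(M : ℤ)) M).image fun k : ℤ => k * η

theorem card_grid_le (d M : ℕ) (η : ℝ) : (grid d M η).card ≤ (2 * M + 1) ^ d := by
  unfold grid
  rw [Fintype.card_piFinset, Finset.prod_const, Finset.card_univ, Fintype.card_fin]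
  refine Nat.pow_le_pow_left (Finset.card_image_le.trans ?_) d
  rw [Int.card_Icc]
  omega

theorem exists_mem_grid {d M : ℕ} {η : ℝ} (hη : 0 < η) (y : Fin d → ℝ)
    (hy : ∀ j, |y j| ≤ M * η) : ∃ l ∈ grid d M η, ∀ j, |l j - y j| ≤ η / 2 := by
  refine ⟨fun j => round (y j / η) * η, ?_, fun j => ?_⟩
  · unfold grid
    refine Fintype.mem_piFinset.2 fun j => Finset.mem_image.2 ⟨round (y j / η), ?_, rfl⟩
    have h1 : |y j / η| ≤ M := by
      rw [abs_div, abs_of_pos hη, div_le_iff₀ hη]; exact hy j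
    have h2 := abs_sub_round (y j / η)
    have h3 := abs_le.1 h1
    have h4 := abs_le.1 h2
    rw [Finset.mem_Icc]
    constructor
    · have : (-(M : ℤ) : ℝ) < (round (y j / η) : ℝ) + 1 := by push_cast; linarith [h3.1, h4.1, h4.2]
      have : (-(M : ℤ)) < round (y j / η) + 1 := by exact_mod_cast this
      omega
    · have : (round (y j / η) : ℝ) < (M : ℤ) + 1 := by push_cast; linarith [h3.2, h4.1, h4.2]
      have : round (y j / η) < (M : ℤ) + 1 := by exact_mod_cast this
      omega
  · have h2 := abs_sub_round (y j / η)
    have h3 : round (y j / η) * η - y j = -(y j / η - round (y j / η)) * η := by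
      field_simp
      ring
    rw [h3, abs_mul, abs_neg, abs_of_pos hη]
    nlinarith

end Grid

/-! ### The exponential supermartingale in a fixed direction. -/

section Concentration

universe u

variable {m d : ℕ} {𝒜 : Type u} {γ β rho : ℝ} {θ : EuclideanSpace ℝ (Fin d)}

/-- Exponent of the exponential supermartingale in direction `l`. -/
def State.exponent (γ : ℝ) (θ : EuclideanSpace ℝ (Fin d)) (l : Fin d → ℝ) (s : State d) : ℝ :=
  l ⬝ᵥ s.noise γ θ - (l ⬝ᵥ s.gram *ᵥ l - γ * (l ⬝ᵥ l))

/-- With `x = V⁻¹ (v·l)`, the increment of the Gram form is `x² V`, so every triggered arm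
contributes the exponent treated by `sum_bernoulliWeight_mul_exp_le`. -/
theorem State.exponent_update (s : State d) (l : Fin d → ℝ) (o : Round m d 𝒜) :
    (s.update rho o).exponent γ θ l = s.exponent γ θ l + ∑ i ∈ o.triggered,
      ((s.optVar rho (o.ctx i))⁻¹ * ((o.ctx i).ofLp ⬝ᵥ l) *
          ((if o.outcome i then 1 else 0) - ⟪θ, o.ctx i⟫) -
        ((s.optVar rho (o.ctx i))⁻¹ * ((o.ctx i).ofLp ⬝ᵥ l)) ^ 2 * s.optVar rho (o.ctx i)) := by
  have h1 : l ⬝ᵥ (s.update rho o).noise γ θ = l ⬝ᵥ s.noise γ θ + ∑ i ∈ o.triggered,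
      (s.optVar rho (o.ctx i))⁻¹ * ((o.ctx i).ofLp ⬝ᵥ l) *
          ((if o.outcome i then 1 else 0) - ⟪θ, o.ctx i⟫) := by
    have h2 : (s.update rho o).noise γ θ = s.noise γ θ + ∑ i ∈ o.triggered,
        ((s.optVar rho (o.ctx i))⁻¹ * ((if o.outcome i then 1 else 0) - ⟪θ, o.ctx i⟫)) •
          (o.ctx i).ofLp := by
      have h3 : ∀ i, ((s.optVar rho (o.ctx i))⁻¹ •
          vecMulVec (o.ctx i).ofLp (o.ctx i).ofLp) *ᵥ θ.ofLp =
          ((s.optVar rho (o.ctx i))⁻¹ * ⟪θ, o.ctx i⟫) • (o.ctx i).ofLp := by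
        intro i
        rw [smul_mulVec, vecMulVec_mulVec, inner_eq_dotProduct, dotProduct_comm, mul_smul]
        simp
      simp only [State.noise, State.update, add_mulVec, sum_mulVec, h3, mul_sub, sub_smul,
        Finset.sum_sub_distrib]
      abel
    rw [h2, dotProduct_add, dotProduct_sum]
    congr 1
    refine Finset.sum_congr rfl fun i _ => ?_
    rw [dotProduct_smul, smul_eq_mul, dotProduct_comm l]
    ring
  unfold State.exponent
  rw [h1, s.form_update, Finset.sum_sub_distrib]
  have h4 : ∑ i ∈ o.triggered, (s.optVar rho (o.ctx i))⁻¹ * ((o.ctx i).ofLp ⬝ᵥ l) ^ 2 =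
      ∑ i ∈ o.triggered, ((s.optVar rho (o.ctx i))⁻¹ * ((o.ctx i).ofLp ⬝ᵥ l)) ^ 2 *
        s.optVar rho (o.ctx i) := by
    refine Finset.sum_congr rfl fun i _ => ?_
    -- For `V = 0` both sides vanish because `0⁻¹ = 0`; this is how omitted updates are encoded.
    by_cases h0 : s.optVar rho (o.ctx i) = 0
    · simp [h0]
    · field_simp
  rw [h4]
  ring

/-- If the noise is large, some grid point of moderate norm has a large exponent. -/
theorem exists_grid_exponent {s : State d} (hs : s.Regular γ) (hγ : 0 < γ) (hβ : 1 ≤ β)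
    (hacc : ¬ s.Accurate γ β θ) {c η : ℝ} {M : ℕ} (hc : 0 ≤ c) (hη : 0 < η)
    (hG : ∀ x, x ⬝ᵥ s.gram *ᵥ x ≤ c ^ 2 * (x ⬝ᵥ x)) (hcη : c * √d * η ≤ 1 / 2)
    (hM : β / 2 ≤ √γ * (M * η)) :
    ∃ l ∈ grid d M η, quadNorm s.gram l ≤ β / 2 ∧ β ^ 2 / 4 - β / 2 ≤ s.exponent γ θ l := by
  have hGd := hs.posDef hγ
  have hγ' : 0 < √γ := Real.sqrt_pos.2 hγ
  set B := quadNorm s.gram⁻¹ (s.noise γ θ) with hB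
  have hβB : β < B := not_le.1 hacc
  have hB0 : 0 < B := by linarith
  -- The optimal direction `G⁻¹` times the noise is rescaled to `G`-norm `r`. The missing `1/4`
  -- leaves room for rounding to the grid, so that the rounded direction still has norm at most
  -- `β/2`.
  set r := β / 2 - 1 / 4 with hr
  have hr0 : 0 ≤ r := by linarith
  set y : Fin d → ℝ := (r / B) • (s.gram⁻¹ *ᵥ s.noise γ θ) with hy
  have hyn : quadNorm s.gram y = r := by
    rw [hy, quadNorm_smul, quadNorm_inv_mulVec hGd, ← hB, abs_of_nonneg (by positivity),
      div_mul_cancel₀ _ hB0.ne']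
  have hyS : y ⬝ᵥ s.noise γ θ = r * B := by
    rw [hy, smul_dotProduct, dotProduct_comm, ← sq_quadNorm hGd.inv.posSemidef, ← hB, smul_eq_mul]
    field_simp
  have hyy : √γ * √(y ⬝ᵥ y) ≤ r := by
    rw [← hyn, ← Real.sqrt_mul hγ.le]
    exact Real.sqrt_le_sqrt (hs.2 y)
  have hyj : ∀ j, |y j| ≤ M * η := by
    intro j
    have h1 : |y j| ≤ √(y ⬝ᵥ y) := by
      refine Real.abs_le_sqrt ?_
      rw [sq]
      exact Finset.single_le_sum (f := fun i => y i * y i) (fun i _ => mul_self_nonneg _)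
        (Finset.mem_univ j)
    refine h1.trans (le_of_mul_le_mul_left ?_ hγ')
    linarith
  obtain ⟨l, hl, hlj⟩ := exists_mem_grid hη y hyj
  set e := l - y with he
  have hle : l = y + e := by rw [he]; abel
  have hen : quadNorm s.gram e ≤ 1 / 4 := by
    have h1 : e ⬝ᵥ e ≤ d * (η / 2) ^ 2 := by
      have : ∀ j ∈ Finset.univ, e j * e j ≤ (η / 2) ^ 2 := by
        intro j _
        rw [← sq, ← sq_abs]
        exact pow_le_pow_left₀ (abs_nonneg _) (hlj j) 2
      simpa [dotProduct] using Finset.sum_le_card_nsmul _ _ _ this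
    have h2 : quadNorm s.gram e ≤ c * (√d * (η / 2)) := by
      refine Real.sqrt_le_iff.2 ⟨by positivity, (hG e).trans ?_⟩
      rw [mul_pow, mul_pow, Real.sq_sqrt (Nat.cast_nonneg d)]
      gcongr
    linarith
  have hln : quadNorm s.gram l ≤ β / 2 := by
    rw [hle]
    refine (quadNorm_add_le hGd.posSemidef _ _).trans ?_
    rw [hyn]
    linarith
  refine ⟨l, hl, hln, ?_⟩
  have heS : -(B * (1 / 4)) ≤ e ⬝ᵥ s.noise γ θ := by
    have h1 := (abs_le.1 (abs_dotProduct_le_quadNorm hGd (s.noise γ θ) e)).1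
    rw [dotProduct_comm] at h1
    have h2 : B * quadNorm s.gram e ≤ B * (1 / 4) := by gcongr
    linarith
  have hlS : (r - 1 / 4) * B ≤ l ⬝ᵥ s.noise γ θ := by
    rw [hle, add_dotProduct, hyS]
    linarith
  have hl2 : l ⬝ᵥ s.gram *ᵥ l ≤ (β / 2) ^ 2 := by
    rw [← sq_quadNorm hGd.posSemidef]
    exact pow_le_pow_left₀ (quadNorm_nonneg _ _) hln 2
  have hll := mul_nonneg hγ.le (dotProduct_self_nonneg_real l)
  unfold State.exponent
  -- The linear part is at least `(β/2 - 1/2)β`, and the quadratic part costs at most `(β/2)²`.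
  have h5 : (r - 1 / 4) * β ≤ (r - 1 / 4) * B :=
    mul_le_mul_of_nonneg_left hβB.le (by linarith)
  nlinarith

open scoped ENNReal

/-- The law of the next round after the history `h`. -/
def stepLaw (I : Instance m d 𝒜) (θ : EuclideanSpace ℝ (Fin d))
    (env : List (Round m d 𝒜) → Fin m → EuclideanSpace ℝ (Fin d))
    (solver : (Fin m → ℝ) → PMF 𝒜) (γ rho : ℝ) (h : List (Round m d 𝒜)) : PMF (Round m d 𝒜) :=
  (solver fun i => (stateOf γ rho h).ucb rho (env h i)).bind fun S =>
    (outcomeLaw (Instance.meanVec θ (env h))).bind fun x =>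
      (I.trig S x).map fun τ => ⟨env h, S, x, τ⟩

theorem runLaw_succ (I : Instance m d 𝒜) (θ : EuclideanSpace ℝ (Fin d))
    (env : List (Round m d 𝒜) → Fin m → EuclideanSpace ℝ (Fin d))
    (solver : (Fin m → ℝ) → PMF 𝒜) (γ : ℝ) (T t : ℕ) : runLaw I θ env solver γ T (t + 1) =
    (runLaw I θ env solver γ T t).bind fun h =>
      (stepLaw I θ env solver γ (radius d I.batchSize T γ) h).map fun o => o :: h := by
  simp only [runLaw, stepLaw, PMF.map_bind, PMF.map_comp]
  rfl

variable {I : Instance m d 𝒜} {env : List (Round m d 𝒜) → Fin m → EuclideanSpace ℝ (Fin d)}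
  {solver : (Fin m → ℝ) → PMF 𝒜}

theorem mem_support_stepLaw {h : List (Round m d 𝒜)} {o : Round m d 𝒜}
    (ho : o ∈ (stepLaw I θ env solver γ rho h).support) :
    o.ctx = env h ∧ o.outcome ∈ (outcomeLaw (Instance.meanVec θ (env h))).support ∧
      o.triggered ∈ (I.trig o.action o.outcome).support := by
  simp only [stepLaw, PMF.mem_support_bind_iff, PMF.mem_support_map_iff] at ho
  obtain ⟨S, _, x, hx, τ, hτ, rfl⟩ := ho
  exact ⟨rfl, hx, hτ⟩

theorem valid_of_mem_support (hθI : θ ∈ I.params) (henv : ∀ h, env h ∈ I.features)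
    (hu : I.UniformTriggering) {T t : ℕ} {h : List (Round m d 𝒜)}
    (hh : h ∈ (runLaw I θ env solver γ T t).support) : Valid I env h ∧ h.length = t := by
  induction t generalizing h with
  | zero =>
    simp only [runLaw, PMF.support_pure, Set.mem_singleton_iff] at hh
    subst hh
    exact ⟨trivial, rfl⟩
  | succ t ih =>
    rw [runLaw_succ, PMF.mem_support_bind_iff] at hh
    obtain ⟨h', hh', hh⟩ := hh
    obtain ⟨o, ho, rfl⟩ := (PMF.mem_support_map_iff _ _ _).1 hh
    obtain ⟨h1, h2, h3⟩ := mem_support_stepLaw ho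
    obtain ⟨h4, h5⟩ := ih hh'
    exact ⟨⟨h1, Instance.mem_trigSet_of_triggered hu ⟨env h', henv h', θ, hθI, rfl⟩ h2 h3, h4⟩,
      by simp [h5]⟩

/-- The direction `l` is short for the Gram matrix and all states have been accurate. -/
def Active (γ rho β : ℝ) (θ : EuclideanSpace ℝ (Fin d)) (l : Fin d → ℝ)
    (h : List (Round m d 𝒜)) : Prop :=
  Good γ rho β θ h ∧ quadNorm (stateOf γ rho h).gram l ≤ rho / 2

theorem quadNorm_gram_tail_le (l : Fin d → ℝ) (h : List (Round m d 𝒜)) :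
    quadNorm (stateOf γ rho h.tail).gram l ≤ quadNorm (stateOf γ rho h).gram l := by
  cases h with
  | nil => exact le_rfl
  | cons o h => exact quadNorm_mono (State.form_le_update _ _ _ _)

theorem Active.tail {l : Fin d → ℝ} {h : List (Round m d 𝒜)} (ha : Active γ rho β θ l h) :
    Active γ rho β θ l h.tail :=
  ⟨ha.1.tail, (quadNorm_gram_tail_le l h).trans ha.2⟩

/-- When `V` is not `1/4`, activity gives `|v·l| ≤ w ρ/2 ≤ V`, so the normalized increment is at
most one in modulus and the Bernoulli bound applies to each arm; `lexp_trig_prod_le` combines the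
arms of the round. -/
theorem lexp_stepLaw_exponent_le (hγ : 0 < γ) (hβ : 0 ≤ β) (hrho : rho = β + √γ) (hθ : ‖θ‖ ≤ 1)
    (hθI : θ ∈ I.params) (henv : ∀ h, env h ∈ I.features) {l : Fin d → ℝ}
    {h : List (Round m d 𝒜)} (ha : Active γ rho β θ l h) :
    lexp (stepLaw I θ env solver γ rho h)
      (fun o => ENNReal.ofReal (Real.exp ((stateOf γ rho (o :: h)).exponent γ θ l))) ≤
      ENNReal.ofReal (Real.exp ((stateOf γ rho h).exponent γ θ l)) := by
  set s := stateOf γ rho h with hs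
  have hreg : s.Regular γ := stateOf_regular γ rho h
  set x : Fin m → ℝ := fun i => (s.optVar rho (env h i))⁻¹ * ((env h i).ofLp ⬝ᵥ l) with hx
  set g : Fin m → Bool → ℝ≥0∞ := fun i b => ENNReal.ofReal (Real.exp
    (x i * ((if b then 1 else 0) - Instance.meanVec θ (env h) i) -
      x i ^ 2 * s.optVar rho (env h i))) with hg
  have hg1 : ∀ i, ∑ b, bernoulliWeight (Instance.meanVec θ (env h) i) b * g i b ≤ 1 := by
    intro i
    have hcov := ha.1.covers hγ hβ hrho hθ hθI henv i
    refine sum_bernoulliWeight_mul_exp_le (I.mean_mem θ hθI _ (henv h) i) ?_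
    rcases hcov.optVar_ge with h1 | h1
    · exact Or.inl h1
    · refine Or.inr ⟨?_, hcov.var_le⟩
      have h2 : |(env h i).ofLp ⬝ᵥ l| ≤ s.optVar rho (env h i) := by
        calc |(env h i).ofLp ⬝ᵥ l| ≤ quadNorm s.gram⁻¹ (env h i).ofLp * quadNorm s.gram l :=
              abs_dotProduct_le_quadNorm (hreg.posDef hγ) _ _
          _ ≤ quadNorm s.gram⁻¹ (env h i).ofLp * (rho / 2) :=
              mul_le_mul_of_nonneg_left ha.2 (quadNorm_nonneg _ _)
          _ ≤ s.optVar rho (env h i) := by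
              rw [matNorm_eq_quadNorm] at h1
              linarith
      simp only [hx]
      rw [abs_mul, abs_inv, abs_of_nonneg (s.optVar_nonneg rho _)]
      exact inv_mul_le_one_of_le₀ h2 (s.optVar_nonneg rho _)
  have hstep : ∀ S (y : Fin m → Bool) (τ : Finset (Fin m)), ENNReal.ofReal (Real.exp
      ((stateOf γ rho ((⟨env h, S, y, τ⟩ : Round m d 𝒜) :: h)).exponent γ θ l)) =
      ENNReal.ofReal (Real.exp (s.exponent γ θ l)) * ∏ i ∈ τ, g i (y i) := by
    intro S y τ
    have h1 : stateOf γ rho ((⟨env h, S, y, τ⟩ : Round m d 𝒜) :: h) =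
      s.update rho ⟨env h, S, y, τ⟩ := rfl
    rw [h1, State.exponent_update, Real.exp_add, ENNReal.ofReal_mul (Real.exp_pos _).le,
      Real.exp_sum, ENNReal.ofReal_prod_of_nonneg fun i _ => (Real.exp_pos _).le]
    rfl
  simp only [stepLaw, lexp_bind, lexp_map, hstep, lexp_const_mul]
  have hle : ∀ S, lexp (outcomeLaw (Instance.meanVec θ (env h)))
      (fun y => lexp (I.trig S y) fun τ => ∏ i ∈ τ, g i (y i)) ≤ 1 := fun S =>
    lexp_trig_prod_le I S _ g hg1
  calc _ ≤ ENNReal.ofReal (Real.exp (s.exponent γ θ l)) * lexp _ fun _ => 1 := by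
        gcongr
        exact lexp_mono _ fun S _ => hle S
    _ = _ := by rw [lexp_const, mul_one]

open scoped Classical in
-- Activity is required of `h.tail`, so the step on which accuracy is lost is still included.
-- Activity is inherited by shorter histories since the Gram matrix only grows, so the process is a
-- stopped supermartingale started at one.
theorem lexp_runLaw_exponent_le (hγ : 0 < γ) (hθ : ‖θ‖ ≤ 1)
    (hθI : θ ∈ I.params) (henv : ∀ h, env h ∈ I.features) {T : ℕ} (hβ : 0 ≤ β)
    (hrho : radius d I.batchSize T γ = β + √γ) (l : Fin d → ℝ) (t : ℕ) :
    lexp (runLaw I θ env solver γ T t) (fun h =>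
      if Active γ (radius d I.batchSize T γ) β θ l h.tail then ENNReal.ofReal (Real.exp
        ((stateOf γ (radius d I.batchSize T γ) h).exponent γ θ l)) else 0) ≤ 1 := by
  set rho := radius d I.batchSize T γ with hr
  induction t with
  | zero =>
    rw [runLaw, lexp_pure]
    split_ifs
    · simp [State.exponent, State.noise, stateOf, smul_mulVec, dotProduct_smul]
    · exact zero_le_one
  | succ t ih =>
    rw [runLaw_succ, lexp_bind]
    refine le_trans (lexp_mono _ fun h _ => ?_) ih
    rw [lexp_map]
    by_cases ha : Active γ rho β θ l h
    · rw [if_pos ha.tail]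
      refine le_trans (lexp_mono _ fun o _ => ?_)
        (lexp_stepLaw_exponent_le hγ hβ hrho hθ hθI henv ha)
      exact (if_pos (c := Active γ rho β θ l (o :: h).tail) ha).le
    · refine le_trans (lexp_mono _ fun o _ =>
        (if_neg (c := Active γ rho β θ l (o :: h).tail) ha).le) ?_
      rw [lexp_const]
      exact zero_le

end Concentration

end C2MAB

namespace C2MAB

open Matrix

/-! ### Probability that accuracy is ever lost. -/

section LossOfAccuracy

open scoped ENNReal

universe u

variable {m d : ℕ} {𝒜 : Type u}

/-- Standing assumptions on instance, parameter, environment and regularizer. -/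
structure Admissible (I : Instance m d 𝒜) (θ : EuclideanSpace ℝ (Fin d))
    (env : List (Round m d 𝒜) → Fin m → EuclideanSpace ℝ (Fin d)) (γ : ℝ) : Prop where
  dim_pos : 1 ≤ d
  mem_params : θ ∈ I.params
  norm_le : ‖θ‖ ≤ 1
  env_mem : ∀ h, env h ∈ I.features
  uniform : I.UniformTriggering
  pMin_pos : 0 < I.pMin
  one_le : 1 ≤ γ

variable {I : Instance m d 𝒜} {θ : EuclideanSpace ℝ (Fin d)}
  {env : List (Round m d 𝒜) → Fin m → EuclideanSpace ℝ (Fin d)}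
  {solver : (Fin m → ℝ) → PMF 𝒜} {γ : ℝ}

theorem Admissible.pos (hA : Admissible I θ env γ) : 0 < γ := zero_lt_one.trans_le hA.one_le

theorem Admissible.one_le_batchSize (hA : Admissible I θ env γ) : 1 ≤ I.batchSize :=
  Instance.one_le_batchSize hA.pMin_pos hA.uniform

theorem Admissible.meanVec_mem_meanSet (hA : Admissible I θ env γ) (h : List (Round m d 𝒜)) :
    Instance.meanVec θ (env h) ∈ I.meanSet := ⟨env h, hA.env_mem h, θ, hA.mem_params, rfl⟩

theorem Admissible.meanVec_mem_Icc (hA : Admissible I θ env γ) (h : List (Round m d 𝒜))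
    (i : Fin m) : Instance.meanVec θ (env h) i ∈ Set.Icc (0 : ℝ) 1 :=
  I.mean_mem θ hA.mem_params _ (hA.env_mem h) i

theorem Admissible.pMin_le_one (hA : Admissible I θ env γ) : I.pMin ≤ 1 :=
  Instance.pMin_le_one hA.pMin_pos hA.uniform ⟨_, hA.meanVec_mem_meanSet []⟩

/-- The root of the largest eigenvalue is at most `4√γ KT`, so spacing `1/(8KTd√γ)` rounds with
`G`-error at most `1/4`; `gridSize` is the number of steps that reaches length `β/(2√γ)`. The grid
does not depend on the history, which makes the union bound possible. -/
theorem Admissible.exists_grid_active (hA : Admissible I θ env γ) {T t : ℕ} (hT : 1 ≤ T)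
    (ht : t ≤ T) {h : List (Round m d 𝒜)}
    (hh : h ∈ (runLaw I θ env solver γ T t).support)
    (hg : Good γ (radius d I.batchSize T γ) (noiseRadius d I.batchSize T) θ h.tail)
    (hacc : ¬ (stateOf γ (radius d I.batchSize T γ) h).Accurate γ
      (noiseRadius d I.batchSize T) θ) :
    ∃ l ∈ grid d (gridSize d I.batchSize T) (1 / (8 * (I.batchSize * T * d) * √γ)),
      Active γ (radius d I.batchSize T γ) (noiseRadius d I.batchSize T) θ l h.tail ∧
      4 * logTerm d I.batchSize T - 1 / 4 ≤
        (stateOf γ (radius d I.batchSize T γ) h).exponent γ θ l := by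
  obtain ⟨hv, hlen⟩ := valid_of_mem_support hA.mem_params hA.env_mem hA.uniform hh
  have hK : (1 : ℝ) ≤ I.batchSize := by exact_mod_cast hA.one_le_batchSize
  have hT' : (1 : ℝ) ≤ T := by exact_mod_cast hT
  have hd' : (1 : ℝ) ≤ d := by exact_mod_cast hA.dim_pos
  have ht' : (t : ℝ) ≤ T := by exact_mod_cast ht
  have hγ := hA.pos
  have hγ1 := hA.one_le
  have hγ' : 0 < √γ := Real.sqrt_pos.2 hγ
  have hβ1 := one_le_noiseRadius d I.batchSize T
  have hrho := radius_eq d I.batchSize T γ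
  have hG := form_le_gramBound hγ (zero_le_one.trans hβ1) hrho hA.norm_le hA.mem_params
    hA.env_mem hv hg
  rw [hlen] at hG
  have hc0 : 0 ≤ gramBound I.batchSize γ t := hγ'.le.trans (sqrt_le_gramBound _ hγ _)
  have hη : 0 < 1 / (8 * (I.batchSize * T * d) * √γ) := by positivity
  have hKT : (1 : ℝ) ≤ I.batchSize * T := one_le_mul_of_one_le_of_one_le hK hT'
  have hc : gramBound I.batchSize γ t ≤ √γ * (4 * (I.batchSize * T)) := by
    unfold gramBound
    have : 3 * I.batchSize * t / γ ≤ 3 * (I.batchSize * T) := by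
      refine div_le_of_le_mul₀ hγ.le (by positivity) ?_
      have : (I.batchSize : ℝ) * t ≤ I.batchSize * T := by gcongr
      nlinarith
    gcongr
    linarith
  have hcη : gramBound I.batchSize γ t * √d * (1 / (8 * (I.batchSize * T * d) * √γ)) ≤ 1 / 2 := by
    rw [mul_one_div, div_le_iff₀ (by positivity)]
    have hsd : √d ≤ d := Real.sqrt_le_iff.2 ⟨by linarith, by nlinarith⟩
    calc gramBound I.batchSize γ t * √d ≤ √γ * (4 * (I.batchSize * T)) * d := by gcongr
      _ = _ := by ring
  have hM : noiseRadius d I.batchSize T / 2 ≤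
      √γ * (gridSize d I.batchSize T * (1 / (8 * (I.batchSize * T * d) * √γ))) := by
    have h1 : 4 * noiseRadius d I.batchSize T * (I.batchSize * T * d) ≤ gridSize d I.batchSize T :=
      Nat.le_ceil _
    have h2 : √γ * (gridSize d I.batchSize T * (1 / (8 * (I.batchSize * T * d) * √γ))) =
        gridSize d I.batchSize T / (8 * (I.batchSize * T * d)) := by
      field_simp
    rw [h2, le_div_iff₀ (by positivity)]
    linarith
  obtain ⟨l, hl, hl1, hl2⟩ := exists_grid_exponent (stateOf_regular γ _ h) hγ hβ1 hacc hc0 hη hG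
    hcη hM
  refine ⟨l, hl, ⟨hg, (quadNorm_gram_tail_le l h).trans (hl1.trans ?_)⟩, le_trans ?_ hl2⟩
  · rw [hrho]; linarith
  -- With `β = 1 + 4√L`, the exponent `β²/4 - β/2` equals `4L - 1/4`.
  · have h0 := (logTerm_bounds hA.dim_pos hA.one_le_batchSize hT).1
    unfold noiseRadius
    nlinarith [Real.sq_sqrt h0]

open scoped Classical in
-- Markov's inequality for the exponential supermartingale at each grid point, summed over the grid.
theorem Admissible.lexp_loss_le (hA : Admissible I θ env γ) {T t : ℕ} (hT : 1 ≤ T) (ht : t ≤ T) :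
    lexp (runLaw I θ env solver γ T t) (fun h =>
      if Good γ (radius d I.batchSize T γ) (noiseRadius d I.batchSize T) θ h.tail ∧
        ¬ (stateOf γ (radius d I.batchSize T γ) h).Accurate γ (noiseRadius d I.batchSize T) θ
      then 1 else 0) ≤
      ENNReal.ofReal (((2 * gridSize d I.batchSize T + 1 : ℕ) : ℝ) ^ d *
        Real.exp (-(4 * logTerm d I.batchSize T - 1 / 4))) := by
  set rho := radius d I.batchSize T γ with hr
  set β := noiseRadius d I.batchSize T with hβ
  set L := 4 * logTerm d I.batchSize T - 1 / 4 with hL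
  set Λ := grid d (gridSize d I.batchSize T) (1 / (8 * (I.batchSize * T * d) * √γ)) with hΛ
  have hβ0 : 0 ≤ β := zero_le_one.trans (one_le_noiseRadius d I.batchSize T)
  calc _ ≤ lexp (runLaw I θ env solver γ T t) (fun h => ∑ l ∈ Λ, ENNReal.ofReal (Real.exp (-L)) *
        if Active γ rho β θ l h.tail then
          ENNReal.ofReal (Real.exp ((stateOf γ rho h).exponent γ θ l)) else 0) := by
        refine lexp_mono _ fun h hh => ?_
        split_ifs with hb
        · obtain ⟨l, hl, ha, he⟩ := hA.exists_grid_active hT ht hh hb.1 hb.2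
          refine le_trans ?_ (Finset.single_le_sum (fun _ _ => zero_le) hl)
          rw [if_pos ha, ← ENNReal.ofReal_mul (Real.exp_pos _).le, ← Real.exp_add,
            ENNReal.one_le_ofReal, Real.one_le_exp_iff]
          linarith
        · exact zero_le
    _ ≤ ∑ l ∈ Λ, ENNReal.ofReal (Real.exp (-L)) := by
        rw [lexp_finset_sum]
        refine Finset.sum_le_sum fun l _ => ?_
        rw [lexp_const_mul]
        exact mul_le_of_le_one_right' (lexp_runLaw_exponent_le hA.pos hA.norm_le hA.mem_params
          hA.env_mem hβ0 (radius_eq d I.batchSize T γ) l t)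
    _ ≤ _ := by
        rw [Finset.sum_const, nsmul_eq_mul, ENNReal.ofReal_mul (by positivity)]
        gcongr
        rw [← Nat.cast_pow, ENNReal.ofReal_natCast]
        exact_mod_cast card_grid_le d _ _

open scoped Classical in
-- Failure at time `t + 1` is either failure at time `t` or a first loss, and the latter is bounded
-- by `Admissible.lexp_loss_le`.
theorem Admissible.lexp_not_good_le (hA : Admissible I θ env γ) {T t : ℕ} (hT : 1 ≤ T)
    (ht : t ≤ T) :
    lexp (runLaw I θ env solver γ T t) (fun h =>
      if h ∈ {h | ¬ Good γ (radius d I.batchSize T γ) (noiseRadius d I.batchSize T) θ h}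
      then 1 else 0) ≤
      ENNReal.ofReal (t * (((2 * gridSize d I.batchSize T + 1 : ℕ) : ℝ) ^ d *
        Real.exp (-(4 * logTerm d I.batchSize T - 1 / 4)))) := by
  set rho := radius d I.batchSize T γ with hr
  set β := noiseRadius d I.batchSize T with hβ
  set P := ((2 * gridSize d I.batchSize T + 1 : ℕ) : ℝ) ^ d *
        Real.exp (-(4 * logTerm d I.batchSize T - 1 / 4)) with hP
  have hP0 : 0 ≤ P := by positivity
  induction t with
  | zero => simp [runLaw, lexp_pure, Good]
  | succ t ih =>
    have h1 : lexp (runLaw I θ env solver γ T (t + 1)) (fun h =>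
        if h.tail ∈ {h | ¬ Good γ rho β θ h} then 1 else 0) ≤ ENNReal.ofReal (t * P) := by
      rw [runLaw_succ, lexp_bind]
      refine le_of_eq_of_le ?_ (ih (by omega))
      congr 1
      funext h
      rw [lexp_map]
      exact lexp_const (stepLaw I θ env solver γ rho h) (if h ∈ {h | ¬ Good γ rho β θ h} then 1 else 0)
    have h2 := hA.lexp_loss_le (solver := solver) hT ht
    simp only [← hr, ← hβ] at h2
    rw [Nat.cast_succ, add_mul, one_mul, ENNReal.ofReal_add (by positivity) hP0]
    refine le_trans ?_ (add_le_add h1 h2)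
    rw [← lexp_add]
    refine lexp_mono _ fun h _ => ?_
    by_cases hg : Good γ rho β θ h
    · simp [hg]
    · by_cases hg' : Good γ rho β θ h.tail
      · have : ¬ (stateOf γ rho h).Accurate γ β θ := by
          cases h with
          | nil => exact absurd trivial hg
          | cons o h => exact fun hacc => hg ⟨hacc, hg'⟩
        simp [hg, hg', this]
      · simp [hg, hg']

open scoped Classical in
theorem Admissible.expect_not_good_le (hA : Admissible I θ env γ) {T : ℕ} (hT : 1 ≤ T) :
    expect (runLaw I θ env solver γ T T) (fun h =>
      if h ∈ {h | ¬ Good γ (radius d I.batchSize T γ) (noiseRadius d I.batchSize T) θ h}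
      then 1 else 0) ≤ 1 / T := by
  rw [expect_indicator_eq]
  refine ENNReal.toReal_le_of_le_ofReal (by positivity) ?_
  refine (hA.lexp_not_good_le hT le_rfl).trans (ENNReal.ofReal_le_ofReal ?_)
  refine le_trans (le_of_eq ?_) (grid_union_bound hA.dim_pos hA.one_le_batchSize hT)
  ring

end LossOfAccuracy

end C2MAB

namespace C2MAB

/-! ### Oracle rewards and expected logarithmic growth. -/

section MoreExpectation

variable {α β : Type*}

theorem BddOnSupport.of_bind {p : PMF α} {k : α → PMF β} {f : β → ℝ}
    (hf : BddOnSupport (p.bind k) f) {a : α} (ha : a ∈ p.support) : BddOnSupport (k a) f := by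
  obtain ⟨B, hB⟩ := hf
  exact ⟨B, fun b hb => hB b ((PMF.mem_support_bind_iff _ _ _).2 ⟨a, ha, hb⟩)⟩

open scoped Classical in
theorem le_expect_indicator {p : PMF α} {s : Set α} {b : ℝ}
    (h : ENNReal.ofReal b ≤ p.toOuterMeasure s) :
    b ≤ expect p fun a => if a ∈ s then 1 else 0 := by
  have h1 : p.toOuterMeasure s = lexp p fun a => if a ∈ s then 1 else 0 := by
    rw [PMF.toOuterMeasure_apply]
    refine tsum_congr fun a => ?_
    by_cases ha : a ∈ s <;> simp [ha]
  rw [expect_indicator_eq, ← h1]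
  refine (ENNReal.ofReal_le_iff_le_toReal ?_).1 h
  refine ne_top_of_le_ne_top ENNReal.one_ne_top ?_
  rw [h1]
  refine (lexp_mono p fun a _ => ?_).trans_eq (lexp_const p 1)
  split_ifs <;> simp

end MoreExpectation

namespace Instance

universe u

variable {m d : ℕ} {𝒜 : Type u} {I : Instance m d 𝒜} {Bv B1 : ℝ}

/-- The expected reward of an approximation oracle. -/
theorem IsApproxOracle.le_expect {α β : ℝ} {solver : (Fin m → ℝ) → PMF 𝒜}
    (h : I.IsApproxOracle α β solver) (hα : 0 ≤ α) (hb : I.BoundedReward) {μ : Fin m → ℝ}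
    (hμ : ∀ i, μ i ∈ Set.Icc (0 : ℝ) 1) :
    α * β * I.optReward μ ≤ expect (solver μ) fun S => I.expReward S μ := by
  classical
  have h1 := le_expect_indicator (h μ hμ)
  have h0 : 0 ≤ α * I.optReward μ := mul_nonneg hα (optReward_nonneg μ)
  calc α * β * I.optReward μ = α * I.optReward μ * β := by ring
    _ ≤ α * I.optReward μ * expect (solver μ) fun S =>
        if S ∈ {S | α * I.optReward μ ≤ I.expReward S μ} then 1 else 0 :=
      mul_le_mul_of_nonneg_left h1 h0
    _ = expect (solver μ) fun S => α * I.optReward μ *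
        if S ∈ {S | α * I.optReward μ ≤ I.expReward S μ} then 1 else 0 :=
      (expect_const_mul _ _ _).symm
    _ ≤ _ := by
      refine expect_mono (.const_mul _ (.of_mem_Icc (a := 0) (b := 1) fun S _ => ?_))
        (.of_mem_Icc (a := 0) (b := I.optReward μ) fun S _ =>
          ⟨I.expReward_nonneg S μ, expReward_le_optReward hb hμ S⟩) fun S _ => ?_
      · split_ifs <;> norm_num
      · split_ifs with hS
        · rw [mul_one]; exact hS
        · rw [mul_zero]; exact I.expReward_nonneg S μ

/-- A uniform bound for all rewards. -/
theorem VMSmooth.optReward_le [Nonempty 𝒜] (h : I.VMSmooth Bv B1) (hBv : 0 ≤ Bv)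
    (hb : I.BoundedReward) {μ : Fin m → ℝ} (hμ : ∀ i, μ i ∈ Set.Icc (0 : ℝ) 1) :
    I.optReward μ ≤ I.optReward (fun _ => 1 / 2) + Bv * √I.batchSize := by
  refine optReward_le_add hb (fun i => by constructor <;> norm_num) fun S => ?_
  have := (abs_le.1 (h.abs_sub_half_le hBv S hμ)).2
  linarith

/-- Expected logarithmic growth is at least the smallest triggering probability times the growth
when all arms that can be triggered are. -/
theorem pMin_mul_log_le (hu : I.UniformTriggering) {S : 𝒜} {μ : Fin m → ℝ} (hμ : μ ∈ I.meanSet)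
    {a : Fin m → ℝ} (ha : ∀ i, 0 ≤ a i) :
    I.pMin * Real.log (1 + ∑ i ∈ I.trigSet S, a i) ≤
      expect (outcomeLaw μ) fun x => expect (I.trig S x) fun τ =>
        Real.log (1 + ∑ i ∈ τ, a i) := by
  set b := ∑ i ∈ I.trigSet S, a i with hb
  have hb0 : 0 ≤ b := Finset.sum_nonneg fun i _ => ha i
  rcases hb0.eq_or_lt with h0 | h0
  · rw [← h0, add_zero, Real.log_one, mul_zero, ← expect_const (outcomeLaw μ) 0]
    refine expect_mono (.of_finite _ _) (.of_finite _ _) fun x _ => ?_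
    rw [← expect_const (I.trig S x) 0]
    refine expect_mono (.of_finite _ _) (.of_finite _ _) fun τ _ => ?_
    exact Real.log_nonneg (le_add_of_nonneg_right (Finset.sum_nonneg fun i _ => ha i))
  set L := Real.log (1 + b) with hL
  have hL0 : 0 ≤ L := Real.log_nonneg (by linarith)
  -- On `[0, b]` the concave function `log(1+y)` lies above its chord, of slope `L/b`. The expected
  -- triggered sum is at least `p_min b`, so the chord turns this into `p_min L`.
  have hconc : ∀ y, 0 ≤ y → y ≤ b → L / b * y ≤ Real.log (1 + y) := by
    intro y hy hyb
    have hc := strictConcaveOn_log_Ioi.concaveOn.2 (x := 1 + b) (y := 1)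
      (by rw [Set.mem_Ioi]; linarith) (by simp) (div_nonneg hy hb0)
      (sub_nonneg.2 ((div_le_one h0).2 hyb)) (by ring)
    simp only [smul_eq_mul, Real.log_one, mul_zero, add_zero, mul_one] at hc
    have e1 : y / b * (1 + b) + (1 - y / b) = 1 + y := by field_simp; ring
    rw [e1] at hc
    calc L / b * y = y / b * L := by ring
      _ ≤ _ := hc
  have hsum : I.pMin * b ≤ ∑ i ∈ I.trigSet S, a i * I.trigProb S μ i := by
    rw [hb, Finset.mul_sum]
    refine Finset.sum_le_sum fun i hi => ?_
    rw [mul_comm]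
    exact mul_le_mul_of_nonneg_left (pMin_le_trigProb hi hμ) (ha i)
  have hexp : ∑ i ∈ I.trigSet S, a i * I.trigProb S μ i =
      expect (outcomeLaw μ) fun x => expect (I.trig S x) fun τ =>
        ∑ i ∈ I.trigSet S, a i * if i ∈ τ then 1 else 0 := by
    simp only [trigProb_eq_expect, expect_fintype, Finset.mul_sum]
    rw [Finset.sum_comm]
    refine Finset.sum_congr rfl fun x _ => ?_
    rw [Finset.sum_comm]
    refine Finset.sum_congr rfl fun τ _ => Finset.sum_congr rfl fun i _ => ?_
    ring
  calc I.pMin * L = L / b * (I.pMin * b) := by field_simp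
    _ ≤ L / b * expect (outcomeLaw μ) fun x => expect (I.trig S x) fun τ =>
        ∑ i ∈ I.trigSet S, a i * if i ∈ τ then 1 else 0 := by
      rw [← hexp]
      exact mul_le_mul_of_nonneg_left hsum (by positivity)
    _ = expect (outcomeLaw μ) fun x => expect (I.trig S x) fun τ =>
        L / b * ∑ i ∈ I.trigSet S, a i * if i ∈ τ then 1 else 0 := by
      simp only [expect_const_mul]
    _ ≤ _ := by
      refine expect_mono (.of_finite _ _) (.of_finite _ _) fun x hx => ?_
      refine expect_mono (.of_finite _ _) (.of_finite _ _) fun τ hτ => ?_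
      have hsub := mem_trigSet_of_triggered hu hμ hx hτ
      have e1 : ∑ i ∈ I.trigSet S, a i * (if i ∈ τ then 1 else 0) = ∑ i ∈ τ, a i := by
        simp only [mul_ite, mul_one, mul_zero]
        rw [← Finset.sum_filter]
        congr 1
        ext i
        simp only [Finset.mem_filter]
        exact ⟨fun h => h.2, fun h => ⟨hsub h, h⟩⟩
      rw [e1]
      exact hconc _ (Finset.sum_nonneg fun i _ => ha i)
        (Finset.sum_le_sum_of_subset_of_nonneg hsub fun i _ _ => ha i)

end Instance

/-! ### Confidence widths, logarithmic growth and the regret of one round. -/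

section OneStep

universe u

variable {m d : ℕ} {𝒜 : Type u} {I : Instance m d 𝒜} {θ : EuclideanSpace ℝ (Fin d)}
  {env : List (Round m d 𝒜) → Fin m → EuclideanSpace ℝ (Fin d)}
  {solver : (Fin m → ℝ) → PMF 𝒜} {γ rho β Bv B1 : ℝ}

/-- The squared normalized width of an arm. -/
def State.bonus (s : State d) (rho : ℝ) (v : EuclideanSpace ℝ (Fin d)) : ℝ :=
  (s.optVar rho v)⁻¹ * matNorm s.gram⁻¹ v ^ 2

theorem State.bonus_nonneg (s : State d) (rho : ℝ) (v : EuclideanSpace ℝ (Fin d)) :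
    0 ≤ s.bonus rho v := mul_nonneg (inv_nonneg.2 (s.optVar_nonneg rho v)) (sq_nonneg _)

/-- If the largest variance on the confidence interval is zero, the interval collapses to an
endpoint of `[0,1]`. This supplies the degenerate-coordinate hypothesis of
`Instance.VMSmooth.closed`. -/
theorem State.Covers.eq_pivot {s : State d} {v : EuclideanSpace ℝ (Fin d)}
    (h0 : (1 - s.pivot rho v) * s.pivot rho v = 0) {x : ℝ}
    (hx : s.lcb rho v ≤ x) (hx' : x ≤ s.ucb rho v) : x = s.pivot rho v := by
  have hu := s.ucb_mem rho v
  have hl := s.lcb_mem rho v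
  unfold State.pivot at h0 ⊢
  split_ifs at h0 ⊢ with h1 h2
  · rcases mul_eq_zero.1 h0 with h | h <;> linarith [hl.1]
  · rcases mul_eq_zero.1 h0 with h | h <;> linarith [hu.2]
  · norm_num at h0

/-- Rewards at points of the confidence box differ by at most the summed bonus. -/
theorem expReward_ucb_sub_le (hsm : I.VMSmooth Bv B1) (hBv : 0 ≤ Bv) {s : State d}
    {v : Fin m → EuclideanSpace ℝ (Fin d)} (hrho : 0 ≤ rho) (hc : ∀ i, s.Covers rho θ (v i))
    (hμ : ∀ i, ⟪θ, v i⟫ ∈ Set.Icc (0 : ℝ) 1) (S : 𝒜) :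
    I.expReward S (fun i => s.ucb rho (v i)) - I.expReward S (Instance.meanVec θ v) ≤
      8 * rho * Bv * √(∑ i ∈ I.trigSet S, s.bonus rho (v i)) := by
  -- Smoothness at the true mean would involve its own, possibly much smaller, variance. Instead the
  -- upper bound and the true mean are both compared with the pivot, whose variance is `V`; each
  -- comparison costs a factor `4ρ`.
  have key : ∀ ν : Fin m → ℝ, (∀ i, ν i ∈ Set.Icc (0 : ℝ) 1) → (∀ i, s.lcb rho (v i) ≤ ν i) →
      (∀ i, ν i ≤ s.ucb rho (v i)) →
      |I.expReward S ν - I.expReward S fun i => s.pivot rho (v i)| ≤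
        4 * rho * Bv * √(∑ i ∈ I.trigSet S, s.bonus rho (v i)) := by
    intro ν hν hl hu
    refine (hsm.closed hBv S (fun i => s.pivot_mem rho (v i)) hν
      fun i h0 => State.Covers.eq_pivot h0 (hl i) (hu i)).trans ?_
    have h1 : √(∑ i ∈ I.trigSet S, (ν i - s.pivot rho (v i)) ^ 2 /
        ((1 - s.pivot rho (v i)) * s.pivot rho (v i))) ≤
        4 * rho * √(∑ i ∈ I.trigSet S, s.bonus rho (v i)) := by
      have h2 : 4 * rho * √(∑ i ∈ I.trigSet S, s.bonus rho (v i)) =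
          √((4 * rho) ^ 2 * ∑ i ∈ I.trigSet S, s.bonus rho (v i)) := by
        rw [Real.sqrt_mul (sq_nonneg _), Real.sqrt_sq (by positivity)]
      rw [h2, Finset.mul_sum]
      refine Real.sqrt_le_sqrt (Finset.sum_le_sum fun i _ => ?_)
      rw [← s.optVar_eq, div_eq_mul_inv, State.bonus]
      have h3 : |ν i - s.pivot rho (v i)| ≤ 4 * rho * matNorm s.gram⁻¹ (v i) := by
        have a := hc i
        rw [abs_le]
        constructor <;> linarith [a.width, a.lcb_le_pivot, a.pivot_le_ucb, hl i, hu i]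
      have h4 : (ν i - s.pivot rho (v i)) ^ 2 ≤ (4 * rho * matNorm s.gram⁻¹ (v i)) ^ 2 := by
        rw [← sq_abs]
        exact pow_le_pow_left₀ (abs_nonneg _) h3 2
      calc _ ≤ (4 * rho * matNorm s.gram⁻¹ (v i)) ^ 2 * (s.optVar rho (v i))⁻¹ :=
            mul_le_mul_of_nonneg_right h4 (inv_nonneg.2 (s.optVar_nonneg rho _))
        _ = _ := by ring
    calc _ ≤ Bv * (4 * rho * √(∑ i ∈ I.trigSet S, s.bonus rho (v i))) :=
          mul_le_mul_of_nonneg_left h1 hBv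
      _ = _ := by ring
  have k1 := (abs_le.1 (key (fun i => s.ucb rho (v i)) (fun i => s.ucb_mem rho (v i))
    (fun i => (hc i).lcb_le.trans (hc i).le_ucb) fun i => le_rfl)).2
  have k2 := (abs_le.1 (key (Instance.meanVec θ v) hμ (fun i => (hc i).lcb_le)
    fun i => (hc i).le_ucb)).1
  linarith

/-- From `log(1+b) ≥ b/(1+b)`: for `b ≤ 1` the logarithm is at least `b/2`, and `√b` is split by the
arithmetic-geometric mean inequality with a free parameter `ξ`. For `b > 1` it is at least `1/2`,
and the a priori bound `U` is charged to it through `J`. -/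
theorem le_log_of_le_sqrt {R W J b ξ U : ℝ} (hW : 0 ≤ W) (hb : 0 ≤ b) (hξ : 0 < ξ) (hJ : 0 ≤ J)
    (h1 : R ≤ W * √b) (h2 : R ≤ U) (h3 : b ≤ 1 ∨ 2 * U ≤ J) :
    R ≤ (W / ξ + J) * Real.log (1 + b) + W / 2 * ξ := by
  have hlog0 : 0 ≤ Real.log (1 + b) := Real.log_nonneg (by linarith)
  have hlog : b / (1 + b) ≤ Real.log (1 + b) := by
    have := Real.one_sub_inv_le_log_of_pos (by linarith : 0 < 1 + b)
    refine le_trans (le_of_eq ?_) this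
    field_simp
    ring
  have hWξ : 0 ≤ W / ξ := by positivity
  by_cases hb1 : b ≤ 1
  · have h4 : b / 2 ≤ Real.log (1 + b) := by
      refine le_trans ?_ hlog
      gcongr
      linarith
    have h5 : √b ≤ b / (2 * ξ) + ξ / 2 := by
      have h6 : √b * (2 * ξ) ≤ b + ξ ^ 2 := by
        nlinarith [sq_nonneg (√b - ξ), Real.sq_sqrt hb]
      have h7 : √b ≤ (b + ξ ^ 2) / (2 * ξ) := (le_div_iff₀ (by positivity)).2 h6
      refine h7.trans_eq ?_
      field_simp
    calc R ≤ W * √b := h1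
      _ ≤ W * (b / (2 * ξ) + ξ / 2) := by gcongr
      _ = W / ξ * (b / 2) + W / 2 * ξ := by field_simp
      _ ≤ W / ξ * Real.log (1 + b) + W / 2 * ξ := by gcongr
      _ ≤ _ := by nlinarith [mul_nonneg hJ hlog0]
  · have hJ' : 2 * U ≤ J := h3.resolve_left hb1
    push Not at hb1
    have h4 : 1 / 2 ≤ Real.log (1 + b) := by
      refine le_trans ?_ hlog
      rw [div_le_div_iff₀ (by norm_num) (by linarith)]
      linarith
    have h5 : U ≤ J * Real.log (1 + b) := by nlinarith
    have h6 : 0 ≤ W / ξ * Real.log (1 + b) := mul_nonneg hWξ hlog0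
    have h7 : 0 ≤ W / 2 * ξ := by positivity
    linarith

theorem expect_stepLaw {h : List (Round m d 𝒜)} {f : Round m d 𝒜 → ℝ}
    (hf : BddOnSupport (stepLaw I θ env solver γ rho h) f) :
    expect (stepLaw I θ env solver γ rho h) f =
      expect (solver fun i => (stateOf γ rho h).ucb rho (env h i)) fun S =>
        expect (outcomeLaw (Instance.meanVec θ (env h))) fun x =>
          expect (I.trig S x) fun τ => f ⟨env h, S, x, τ⟩ := by
  unfold stepLaw at hf ⊢
  rw [expect_bind hf]
  refine expect_congr fun S hS => ?_
  have hf' := hf.of_bind hS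
  rw [expect_bind hf']
  exact expect_congr fun x hx => expect_map _ _ (hf'.of_bind hx)

theorem BddOnSupport.expect_stepLaw {h : List (Round m d 𝒜)} {f : Round m d 𝒜 → ℝ}
    (hf : BddOnSupport (stepLaw I θ env solver γ rho h) f) :
    BddOnSupport (solver fun i => (stateOf γ rho h).ucb rho (env h i)) fun S =>
        C2MAB.expect (outcomeLaw (Instance.meanVec θ (env h))) fun x =>
          C2MAB.expect (I.trig S x) fun τ => f ⟨env h, S, x, τ⟩ := by
  unfold stepLaw at hf
  obtain ⟨B, hB⟩ := hf.expect
  refine ⟨B, fun S hS => ?_⟩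
  have h1 := hB S hS
  have hf' := hf.of_bind hS
  beta_reduce at h1 ⊢
  rw [expect_bind hf'] at h1
  rwa [expect_congr fun x hx => expect_map _ _ (hf'.of_bind hx)] at h1

end OneStep

end C2MAB

namespace C2MAB

/-! ### Summation over rounds. -/

section Regret

universe u

variable {m d : ℕ} {𝒜 : Type u} {I : Instance m d 𝒜} {θ : EuclideanSpace ℝ (Fin d)}
  {env : List (Round m d 𝒜) → Fin m → EuclideanSpace ℝ (Fin d)}
  {solver : (Fin m → ℝ) → PMF 𝒜} {γ α β Bv B1 : ℝ} {T : ℕ}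

/-- A functional of histories that does not increase in mean stays below its initial value. -/
theorem expect_runLaw_le {F : List (Round m d 𝒜) → ℝ}
    (hF : ∀ t, BddOnSupport (runLaw I θ env solver γ T t) F)
    (hstep : ∀ t, ∀ h ∈ (runLaw I θ env solver γ T t).support,
      expect (stepLaw I θ env solver γ (radius d I.batchSize T γ) h) (fun o => F (o :: h)) ≤ F h)
    (t : ℕ) : expect (runLaw I θ env solver γ T t) F ≤ F [] := by
  induction t with
  | zero => rw [runLaw, expect_pure]
  | succ t ih =>
    have hF' := hF (t + 1)
    rw [runLaw_succ] at hF' ⊢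
    rw [expect_bind hF']
    refine (expect_mono hF'.expect (hF t) fun h hh => ?_).trans ih
    rw [expect_map _ _ (hF'.of_bind hh)]
    exact hstep t h hh

/-- Instantaneous regret of a round. -/
def roundRegret (I : Instance m d 𝒜) (θ : EuclideanSpace ℝ (Fin d)) (α β : ℝ)
    (o : Round m d 𝒜) : ℝ :=
  α * β * I.optReward (Instance.meanVec θ o.ctx) - I.expReward o.action (Instance.meanVec θ o.ctx)

theorem historyRegret_cons (o : Round m d 𝒜) (h : List (Round m d 𝒜)) :
    historyRegret I θ α β (o :: h) = roundRegret I θ α β o + historyRegret I θ α β h := by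
  simp [historyRegret, roundRegret]

/-- Assumptions on rewards and oracle. -/
structure RewardAssumptions (I : Instance m d 𝒜) (solver : (Fin m → ℝ) → PMF 𝒜)
    (α β Bv B1 : ℝ) : Prop where
  bounded : I.BoundedReward
  mono : I.Monotonicity
  smooth : I.VMSmooth Bv B1
  alpha_mem : α ∈ Set.Icc (0 : ℝ) 1
  beta_mem : β ∈ Set.Icc (0 : ℝ) 1
  isApproxOracle : I.IsApproxOracle α β solver
  smooth_nonneg : 0 ≤ Bv

theorem RewardAssumptions.nonempty (_hR : RewardAssumptions I solver α β Bv B1) : Nonempty 𝒜 :=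
  (solver fun _ => 0).support_nonempty.to_type

theorem RewardAssumptions.mul_mem (hR : RewardAssumptions I solver α β Bv B1) :
    0 ≤ α * β ∧ α * β ≤ 1 :=
  ⟨mul_nonneg hR.alpha_mem.1 hR.beta_mem.1,
    mul_le_one₀ hR.alpha_mem.2 hR.beta_mem.1 hR.beta_mem.2⟩

theorem abs_roundRegret_le (hA : Admissible I θ env γ) (hR : RewardAssumptions I solver α β Bv B1)
    {o : Round m d 𝒜} {h : List (Round m d 𝒜)} (ho : o.ctx = env h) :
    |roundRegret I θ α β o| ≤ I.optReward (fun _ => 1 / 2) + Bv * √I.batchSize := by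
  have := hR.nonempty
  have hμ := hA.meanVec_mem_Icc h
  have h1 := hR.smooth.optReward_le hR.smooth_nonneg hR.bounded hμ
  have h2 := I.expReward_nonneg o.action (Instance.meanVec θ (env h))
  have h3 := Instance.expReward_le_optReward hR.bounded hμ o.action
  have h4 := Instance.optReward_nonneg (I := I) (Instance.meanVec θ (env h))
  have h5 := mul_nonneg hR.mul_mem.1 h4
  have h6 := mul_le_mul_of_nonneg_right hR.mul_mem.2 h4
  unfold roundRegret
  rw [ho, abs_le]
  constructor <;> linarith

theorem abs_historyRegret_le (hA : Admissible I θ env γ)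
    (hR : RewardAssumptions I solver α β Bv B1) {h : List (Round m d 𝒜)} (hv : Valid I env h) :
    |historyRegret I θ α β h| ≤
      h.length * (I.optReward (fun _ => 1 / 2) + Bv * √I.batchSize) := by
  induction h with
  | nil => simp [historyRegret]
  | cons o h ih =>
    rw [historyRegret_cons]
    refine (abs_add_le _ _).trans ?_
    have := abs_roundRegret_le hA hR hv.1
    have := ih hv.2.2
    push_cast [List.length_cons]
    linarith

theorem bdd_historyRegret (hA : Admissible I θ env γ)
    (hR : RewardAssumptions I solver α β Bv B1) (t : ℕ) :
    BddOnSupport (runLaw I θ env solver γ T t) (historyRegret I θ α β) := by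
  refine ⟨t * (I.optReward (fun _ => 1 / 2) + Bv * √I.batchSize), fun h hh => ?_⟩
  obtain ⟨hv, rfl⟩ := valid_of_mem_support hA.mem_params hA.env_mem hA.uniform hh
  exact abs_historyRegret_le hA hR hv

theorem bdd_roundRegret (hA : Admissible I θ env γ)
    (hR : RewardAssumptions I solver α β Bv B1) (rho : ℝ) (h : List (Round m d 𝒜)) :
    BddOnSupport (stepLaw I θ env solver γ rho h) (roundRegret I θ α β) :=
  ⟨_, fun _ ho => abs_roundRegret_le hA hR (mem_support_stepLaw ho).1⟩

theorem bdd_expReward (hR : RewardAssumptions I solver α β Bv B1) (p : PMF 𝒜) {μ : Fin m → ℝ}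
    (hμ : ∀ i, μ i ∈ Set.Icc (0 : ℝ) 1) : BddOnSupport p fun S => I.expReward S μ :=
  .of_mem_Icc (a := 0) (b := I.optReward μ) fun S _ =>
    ⟨I.expReward_nonneg S μ, Instance.expReward_le_optReward hR.bounded hμ S⟩

theorem expect_roundRegret (hA : Admissible I θ env γ)
    (hR : RewardAssumptions I solver α β Bv B1) (rho : ℝ) (h : List (Round m d 𝒜)) :
    expect (stepLaw I θ env solver γ rho h) (roundRegret I θ α β) =
      α * β * I.optReward (Instance.meanVec θ (env h)) -
        expect (solver fun i => (stateOf γ rho h).ucb rho (env h i)) fun S =>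
          I.expReward S (Instance.meanVec θ (env h)) := by
  rw [expect_stepLaw (bdd_roundRegret hA hR rho h)]
  simp only [roundRegret, expect_const]
  rw [expect_sub (.of_const _ _) (bdd_expReward hR _ (hA.meanVec_mem_Icc h)), expect_const]

/-- Without any accuracy, one round costs at most the variation of the rewards. -/
theorem expect_roundRegret_le (hA : Admissible I θ env γ)
    (hR : RewardAssumptions I solver α β Bv B1) (rho : ℝ) (h : List (Round m d 𝒜)) :
    expect (stepLaw I θ env solver γ rho h) (roundRegret I θ α β) ≤ 4 * Bv * √I.batchSize := by
  have := hR.nonempty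
  rw [expect_roundRegret hA hR]
  set μ := Instance.meanVec θ (env h) with hμdef
  set ν : Fin m → ℝ := fun i => (stateOf γ rho h).ucb rho (env h i) with hν
  have hμ := hA.meanVec_mem_Icc h
  have hνm : ∀ i, ν i ∈ Set.Icc (0 : ℝ) 1 := fun i => State.ucb_mem _ _ _
  have h1 := hR.isApproxOracle.le_expect hR.alpha_mem.1 hR.bounded hνm
  set D := 2 * Bv * √I.batchSize with hD
  have hD0 : 0 ≤ D := by have := hR.smooth_nonneg; positivity
  have h2 : I.optReward μ ≤ I.optReward ν + D :=
    Instance.optReward_le_add hR.bounded hνm fun S => by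
      have := (abs_le.1 (hR.smooth.abs_sub_le hR.smooth_nonneg S hνm hμ)).2
      linarith
  have h3 : expect (solver ν) (fun S => I.expReward S ν) ≤
      expect (solver ν) (fun S => I.expReward S μ) + D := by
    rw [← expect_const (solver ν) D, ← expect_add (bdd_expReward hR _ hμ) (.of_const _ _)]
    refine expect_mono (bdd_expReward hR _ hνm) ((bdd_expReward hR _ hμ).add (.of_const _ _))
      fun S _ => ?_
    have := (abs_le.1 (hR.smooth.abs_sub_le hR.smooth_nonneg S hμ hνm)).2
    linarith
  have h4 := mul_le_mul_of_nonneg_left h2 hR.mul_mem.1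
  have h5 := mul_le_mul_of_nonneg_right hR.mul_mem.2 hD0
  linarith

/-- The variation bound of one round is summed without any concentration; this settles the regimes
in which `d` is large compared with the horizon. -/
theorem regret_le_trivial (hA : Admissible I θ env γ)
    (hR : RewardAssumptions I solver α β Bv B1) :
    regret I θ env solver γ T α β ≤ 4 * Bv * √I.batchSize * T := by
  set D := 4 * Bv * √I.batchSize with hD
  have hlen : ∀ t, BddOnSupport (runLaw I θ env solver γ T t)
      fun h => D * (h.length : ℝ) := fun t =>
    .const_mul _ ⟨t, fun h hh => by
      beta_reduce
      rw [(valid_of_mem_support hA.mem_params hA.env_mem hA.uniform hh).2, Nat.abs_cast]⟩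
  have h1 := expect_runLaw_le (F := fun h => historyRegret I θ α β h - D * (h.length : ℝ))
    (fun t => (bdd_historyRegret (T := T) hA hR t).sub (hlen t)) (fun t h _ => by
      have hb := bdd_roundRegret hA hR (radius d I.batchSize T γ) h
      have h2 : ∀ o : Round m d 𝒜, historyRegret I θ α β (o :: h) - D * ((o :: h).length : ℝ) =
          roundRegret I θ α β o + (historyRegret I θ α β h - D * (h.length : ℝ) - D) := by
        intro o
        rw [historyRegret_cons]
        push_cast [List.length_cons]
        ring
      simp only [h2]
      rw [expect_add hb (.of_const _ _), expect_const]
      have := expect_roundRegret_le hA hR (radius d I.batchSize T γ) h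
      linarith) T
  rw [expect_sub (bdd_historyRegret hA hR T) (hlen T)] at h1
  have h3 : expect (runLaw I θ env solver γ T T) (fun h => D * (h.length : ℝ)) = D * T := by
    rw [← expect_const (runLaw I θ env solver γ T T) (D * T)]
    exact expect_congr fun h hh => by
      rw [(valid_of_mem_support hA.mem_params hA.env_mem hA.uniform hh).2]
  rw [h3] at h1
  simp only [historyRegret, List.map_nil, List.sum_nil, List.length_nil, Nat.cast_zero,
    mul_zero, sub_zero] at h1
  have h4 : regret I θ env solver γ T α β =
      expect (runLaw I θ env solver γ T T) (historyRegret I θ α β) := rfl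
  rw [h4]
  linarith

open scoped Classical in
/-- Number of proper prefixes of a history at which accuracy is lost. -/
def lossCount (γ rho η : ℝ) (θ : EuclideanSpace ℝ (Fin d)) : List (Round m d 𝒜) → ℝ
  | [] => 0
  | _ :: h => lossCount γ rho η θ h + if Good γ rho η θ h then 0 else 1

theorem lossCount_mem (γ rho η : ℝ) (θ : EuclideanSpace ℝ (Fin d)) (h : List (Round m d 𝒜)) :
    0 ≤ lossCount γ rho η θ h ∧ lossCount γ rho η θ h ≤ h.length := by
  induction h with
  | nil => simp [lossCount]
  | cons o h ih =>
    rw [lossCount]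
    push_cast [List.length_cons]
    split_ifs <;> constructor <;> linarith [ih.1, ih.2]

theorem Good.lossCount_eq {γ rho η : ℝ} {h : List (Round m d 𝒜)} (hg : Good γ rho η θ h) :
    lossCount γ rho η θ h = 0 := by
  induction h with
  | nil => rfl
  | cons o h ih => rw [lossCount, if_pos hg.2, ih hg.2, add_zero]

theorem bdd_potential (hA : Admissible I θ env γ) (t : ℕ) :
    BddOnSupport (runLaw I θ env solver γ T t)
      (potential γ (radius d I.batchSize T γ) (noiseRadius d I.batchSize T) θ) := by
  refine .of_mem_Icc (b := 2 * d * Real.log (1 + 3 * I.batchSize * t / γ)) fun h hh =>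
    ⟨potential_nonneg hA.pos h, ?_⟩
  obtain ⟨hv, hlen⟩ := valid_of_mem_support hA.mem_params hA.env_mem hA.uniform hh
  have := potential_le hA.pos (zero_le_one.trans (one_le_noiseRadius d I.batchSize T))
    (radius_eq d I.batchSize T γ) hA.norm_le hA.mem_params hA.env_mem hv
  rwa [hlen] at this

theorem valid_cons (hA : Admissible I θ env γ) {rho : ℝ} {h : List (Round m d 𝒜)}
    (hv : Valid I env h) {o : Round m d 𝒜}
    (ho : o ∈ (stepLaw I θ env solver γ rho h).support) : Valid I env (o :: h) := by
  obtain ⟨h1, h2, h3⟩ := mem_support_stepLaw ho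
  exact ⟨h1, Instance.mem_trigSet_of_triggered hA.uniform (hA.meanVec_mem_meanSet h) h2 h3, hv⟩

theorem bdd_potential_cons (hA : Admissible I θ env γ) {h : List (Round m d 𝒜)}
    (hv : Valid I env h) :
    BddOnSupport (stepLaw I θ env solver γ (radius d I.batchSize T γ) h) fun o =>
      potential γ (radius d I.batchSize T γ) (noiseRadius d I.batchSize T) θ (o :: h) :=
  .of_mem_Icc (b := 2 * d * Real.log (1 + 3 * I.batchSize * (h.length + 1 : ℕ) / γ)) fun _ ho =>
    ⟨potential_nonneg hA.pos _, potential_le hA.pos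
      (zero_le_one.trans (one_le_noiseRadius d I.batchSize T)) (radius_eq d I.batchSize T γ)
      hA.norm_le hA.mem_params hA.env_mem (valid_cons hA hv ho)⟩

/-- In an accurate state, the regret of a round is paid for by the growth of the potential. -/
theorem expect_roundRegret_le_of_good (hA : Admissible I θ env γ)
    (hR : RewardAssumptions I solver α β Bv B1) {h : List (Round m d 𝒜)} (hv : Valid I env h)
    (hg : Good γ (radius d I.batchSize T γ) (noiseRadius d I.batchSize T) θ h) {ξ J : ℝ}
    (hξ : 0 < ξ) (hJ : 0 ≤ J)
    (hcase : 4 * (I.batchSize : ℝ) ≤ γ ∨ 8 * Bv * √I.batchSize ≤ J) :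
    expect (stepLaw I θ env solver γ (radius d I.batchSize T γ) h) (roundRegret I θ α β) ≤
      (8 * radius d I.batchSize T γ * Bv / ξ + J) / I.pMin *
        (expect (stepLaw I θ env solver γ (radius d I.batchSize T γ) h) (fun o =>
          potential γ (radius d I.batchSize T γ) (noiseRadius d I.batchSize T) θ (o :: h)) -
          potential γ (radius d I.batchSize T γ) (noiseRadius d I.batchSize T) θ h) +
      4 * radius d I.batchSize T γ * Bv * ξ := by
  have := hR.nonempty
  have hrho := radius_eq d I.batchSize T γ
  have hη1 := one_le_noiseRadius d I.batchSize T
  rw [expect_roundRegret hA hR]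
  set rho := radius d I.batchSize T γ with hr
  set η := noiseRadius d I.batchSize T with hη
  set s := stateOf γ rho h with hs
  set μ := Instance.meanVec θ (env h) with hμdef
  set ν : Fin m → ℝ := fun i => s.ucb rho (env h i) with hν
  have hμ := hA.meanVec_mem_Icc h
  have hνm : ∀ i, ν i ∈ Set.Icc (0 : ℝ) 1 := fun i => State.ucb_mem _ _ _
  have hrho0 : 0 ≤ rho := by rw [hrho]; positivity
  have hrhoγ : √γ ≤ rho := by rw [hrho]; linarith
  have hBv := hR.smooth_nonneg
  have hcov : ∀ i, s.Covers rho θ (env h i) := fun i =>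
    hg.covers hA.pos (zero_le_one.trans hη1) hrho hA.norm_le hA.mem_params hA.env_mem i
  set b : 𝒜 → ℝ := fun S => ∑ i ∈ I.trigSet S, s.bonus rho (env h i) with hb
  have hb0 : ∀ S, 0 ≤ b S := fun S => Finset.sum_nonneg fun i _ => s.bonus_nonneg rho _
  -- Optimism: the upper confidence bounds dominate the true means in every coordinate.
  have hopt : I.optReward μ ≤ I.optReward ν := by
    have := Instance.optReward_le_add (μ := μ) hR.bounded hνm (c := 0) fun S => by
      rw [add_zero]
      exact hR.mono S μ ν hμ hνm fun i => (hcov i).le_ucb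
    simpa using this
  have h1 := hR.isApproxOracle.le_expect hR.alpha_mem.1 hR.bounded hνm
  set A := 8 * rho * Bv / ξ + J with hAdef
  have hA0 : 0 ≤ A := by positivity
  have hp := hA.pMin_pos
  have hR1 : ∀ S, I.expReward S ν - I.expReward S μ ≤
      A * Real.log (1 + b S) + 8 * rho * Bv / 2 * ξ := by
    intro S
    refine le_log_of_le_sqrt (U := 4 * Bv * √I.batchSize) (by positivity) (hb0 S) hξ hJ
      (expReward_ucb_sub_le hR.smooth hBv hrho0 hcov hμ S) ?_ ?_
    · have h2 := (abs_le.1 (hR.smooth.abs_sub_le hBv S hμ hνm)).2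
      have h3 : 0 ≤ Bv * √I.batchSize := by positivity
      linarith
    · rcases hcase with hc | hc
      · left
        have h4 : ∀ i ∈ I.trigSet S, s.bonus rho (env h i) ≤ 4 / γ := fun i _ =>
          (hcov i).sq_matNorm_div_le (stateOf_regular γ rho h) hA.pos hrhoγ
            (I.norm_feature_le _ (hA.env_mem h) i)
        have h5 := Finset.sum_le_card_nsmul _ _ _ h4
        rw [nsmul_eq_mul] at h5
        have h6 : ((I.trigSet S).card : ℝ) ≤ I.batchSize := by
          exact_mod_cast Instance.card_trigSet_le S
        have hγ := hA.pos
        refine h5.trans ?_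
        rw [← mul_div_assoc, div_le_one hγ]
        linarith
      · right; linarith
  have hlogb : BddOnSupport (solver ν) fun S => Real.log (1 + b S) := by
    refine .of_mem_Icc (a := 0) (b := Real.log (1 + ∑ i, s.bonus rho (env h i))) fun S _ =>
      ⟨Real.log_nonneg (by linarith [hb0 S]), ?_⟩
    refine Real.log_le_log (by linarith [hb0 S]) (add_le_add le_rfl ?_)
    exact Finset.sum_le_sum_of_subset_of_nonneg (Finset.subset_univ _)
      fun i _ _ => s.bonus_nonneg rho _
  have h2 : expect (solver ν) (fun S => I.expReward S ν) ≤
      expect (solver ν) (fun S => I.expReward S μ) +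
        (A * expect (solver ν) (fun S => Real.log (1 + b S)) + 8 * rho * Bv / 2 * ξ) := by
    rw [← expect_const_mul, ← expect_const (solver ν) (8 * rho * Bv / 2 * ξ),
      ← expect_add (hlogb.const_mul A) (.of_const _ _),
      ← expect_add (bdd_expReward hR _ hμ) ((hlogb.const_mul A).add (.of_const _ _))]
    refine expect_mono (bdd_expReward hR _ hνm)
      ((bdd_expReward hR _ hμ).add ((hlogb.const_mul A).add (.of_const _ _))) fun S _ => ?_
    have := hR1 S
    linarith
  have hpotb := bdd_potential_cons (solver := solver) (T := T) hA hv
  -- The bonuses are fixed before the outcomes are drawn, so the triggering average can be taken for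
  -- each action and then averaged over the oracle.
  have hpot : potential γ rho η θ h + I.pMin * expect (solver ν) (fun S => Real.log (1 + b S)) ≤
      expect (stepLaw I θ env solver γ rho h) (fun o => potential γ rho η θ (o :: h)) := by
    rw [expect_stepLaw hpotb, ← expect_const_mul,
      ← expect_const (solver ν) (potential γ rho η θ h),
      ← expect_add (.of_const _ _) (hlogb.const_mul _)]
    refine expect_mono ((BddOnSupport.of_const _ _).add (hlogb.const_mul _))
      hpotb.expect_stepLaw fun S _ => ?_
    refine (add_le_add le_rfl (Instance.pMin_mul_log_le hA.uniform (hA.meanVec_mem_meanSet h)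
      fun i => s.bonus_nonneg rho (env h i))).trans ?_
    rw [← expect_const (outcomeLaw (Instance.meanVec θ (env h))) (potential γ rho η θ h),
      ← expect_add (.of_const _ _) (.of_finite _ _)]
    refine expect_mono (.of_finite _ _) (.of_finite _ _) fun x _ => ?_
    rw [← expect_const (I.trig S x) (potential γ rho η θ h),
      ← expect_add (.of_const _ _) (.of_finite _ _)]
    refine expect_mono (.of_finite _ _) (.of_finite _ _) fun τ _ => ?_
    exact potential_add_log_le hA.pos hg ⟨env h, S, x, τ⟩
  have h3 : A * expect (solver ν) (fun S => Real.log (1 + b S)) ≤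
      A / I.pMin * (expect (stepLaw I θ env solver γ rho h)
        (fun o => potential γ rho η θ (o :: h)) - potential γ rho η θ h) := by
    rw [div_mul_eq_mul_div, le_div_iff₀ hp]
    calc A * expect (solver ν) (fun S => Real.log (1 + b S)) * I.pMin
        = A * (I.pMin * expect (solver ν) (fun S => Real.log (1 + b S))) := by ring
      _ ≤ _ := mul_le_mul_of_nonneg_left (by linarith) hA0
  have h4 := mul_le_mul_of_nonneg_left hopt hR.mul_mem.1
  linarith

/-- Regret minus `A` times the potential, minus `B` per round, minus `D` per round played after a
loss of accuracy, does not increase in mean: accurate rounds are paid for by the potential and by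
`B`, all others by `D`. -/
theorem regret_le (hA : Admissible I θ env γ) (hR : RewardAssumptions I solver α β Bv B1)
    (hT : 1 ≤ T) {ξ J : ℝ} (hξ : 0 < ξ) (hJ : 0 ≤ J)
    (hcase : 4 * (I.batchSize : ℝ) ≤ γ ∨ 8 * Bv * √I.batchSize ≤ J) :
    regret I θ env solver γ T α β ≤
      (8 * radius d I.batchSize T γ * Bv / ξ + J) / I.pMin *
        (2 * d * Real.log (1 + 3 * I.batchSize * T / γ)) +
      4 * radius d I.batchSize T γ * Bv * ξ * T + 4 * Bv * √I.batchSize := by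
  classical
  have hrho := radius_eq d I.batchSize T γ
  have hη1 := one_le_noiseRadius d I.batchSize T
  have hp := hA.pMin_pos
  have hBv := hR.smooth_nonneg
  have hstep := fun (h : List (Round m d 𝒜)) (hv : Valid I env h) hg =>
    expect_roundRegret_le_of_good (T := T) hA hR hv hg hξ hJ hcase
  have hbp := fun t => bdd_potential (I := I) (θ := θ) (env := env) (solver := solver) (T := T) hA t
  have hbp' := fun (h : List (Round m d 𝒜)) (hv : Valid I env h) =>
    bdd_potential_cons (solver := solver) (T := T) hA hv
  have hng := hA.expect_not_good_le (solver := solver) hT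
  have hpotle : ∀ h ∈ (runLaw I θ env solver γ T T).support,
      potential γ (radius d I.batchSize T γ) (noiseRadius d I.batchSize T) θ h ≤
        2 * d * Real.log (1 + 3 * I.batchSize * T / γ) := by
    intro h hh
    obtain ⟨hv, hlen⟩ := valid_of_mem_support hA.mem_params hA.env_mem hA.uniform hh
    have := potential_le hA.pos (zero_le_one.trans hη1) hrho hA.norm_le hA.mem_params
      hA.env_mem hv
    rwa [hlen] at this
  have hrho0 : 0 ≤ radius d I.batchSize T γ := by rw [hrho]; positivity
  set rho := radius d I.batchSize T γ with hr
  set η := noiseRadius d I.batchSize T with hη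
  set A := (8 * rho * Bv / ξ + J) / I.pMin with hAdef
  have hA0 : 0 ≤ A := by positivity
  set B := 4 * rho * Bv * ξ with hB
  have hB0 : 0 ≤ B := by positivity
  set D := 4 * Bv * √I.batchSize with hD
  have hD0 : 0 ≤ D := by positivity
  have hlen : ∀ t, BddOnSupport (runLaw I θ env solver γ T t)
      fun h => B * (h.length : ℝ) := fun t =>
    .const_mul _ ⟨t, fun h hh => by
      beta_reduce
      rw [(valid_of_mem_support hA.mem_params hA.env_mem hA.uniform hh).2, Nat.abs_cast]⟩
  have hloss : ∀ t, BddOnSupport (runLaw I θ env solver γ T t)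
      fun h => D * lossCount γ rho η θ h := fun t =>
    .const_mul _ (.of_mem_Icc (a := 0) (b := t) fun h hh => by
      have h1 := lossCount_mem γ rho η θ h
      rwa [(valid_of_mem_support hA.mem_params hA.env_mem hA.uniform hh).2] at h1)
  have hpotb : ∀ t, BddOnSupport (runLaw I θ env solver γ T t)
      fun h => A * potential γ rho η θ h := fun t => (hbp t).const_mul A
  have hhist := fun t => bdd_historyRegret (T := T) hA hR t
  have hdrift := expect_runLaw_le (I := I) (θ := θ) (env := env) (solver := solver) (γ := γ)
    (T := T) (F := fun h => historyRegret I θ α β h - A * potential γ rho η θ h -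
      B * (h.length : ℝ) - D * lossCount γ rho η θ h)
    (fun t => (((hhist t).sub (hpotb t)).sub (hlen t)).sub (hloss t)) (fun t h hh => by
      have hv := (valid_of_mem_support hA.mem_params hA.env_mem hA.uniform hh).1
      have hb := bdd_roundRegret hA hR rho h
      have h2 : ∀ o : Round m d 𝒜, historyRegret I θ α β (o :: h) -
          A * potential γ rho η θ (o :: h) - B * ((o :: h).length : ℝ) -
          D * lossCount γ rho η θ (o :: h) =
          (roundRegret I θ α β o - A * potential γ rho η θ (o :: h)) +
          (historyRegret I θ α β h - B * (h.length : ℝ) - B -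
            D * (lossCount γ rho η θ h + if Good γ rho η θ h then 0 else 1)) := by
        intro o
        rw [historyRegret_cons, lossCount]
        push_cast [List.length_cons]
        ring
      simp only [h2]
      rw [← hr, expect_add (hb.sub ((hbp' h hv).const_mul A)) (.of_const _ _), expect_const,
        expect_sub hb ((hbp' h hv).const_mul A), expect_const_mul]
      by_cases hg : Good γ rho η θ h
      · rw [if_pos hg, add_zero]
        have := hstep h hv hg
        linarith
      · have h3 : expect (stepLaw I θ env solver γ rho h)
            (fun o => potential γ rho η θ (o :: h)) = potential γ rho η θ h := by
          rw [← expect_const (stepLaw I θ env solver γ rho h) (potential γ rho η θ h)]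
          exact expect_congr fun o _ => by rw [potential, if_neg hg]
        rw [if_neg hg, h3]
        have := expect_roundRegret_le hA hR rho h
        linarith) T
  rw [expect_sub (((hhist T).sub (hpotb T)).sub (hlen T)) (hloss T),
    expect_sub ((hhist T).sub (hpotb T)) (hlen T), expect_sub (hhist T) (hpotb T)] at hdrift
  have h0 : historyRegret I θ α β [] - A * potential γ rho η θ ([] : List (Round m d 𝒜)) -
      B * (([] : List (Round m d 𝒜)).length : ℝ) -
      D * lossCount γ rho η θ ([] : List (Round m d 𝒜)) = 0 := by
    simp [historyRegret, potential, lossCount]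
  rw [h0] at hdrift
  have e1 : expect (runLaw I θ env solver γ T T) (fun h => A * potential γ rho η θ h) ≤
      A * (2 * d * Real.log (1 + 3 * I.batchSize * T / γ)) :=
    expect_le_const (hpotb T) fun h hh => mul_le_mul_of_nonneg_left (hpotle h hh) hA0
  have e2 : expect (runLaw I θ env solver γ T T) (fun h => B * (h.length : ℝ)) ≤ B * T :=
    expect_le_const (hlen T) fun h hh => by
      rw [(valid_of_mem_support hA.mem_params hA.env_mem hA.uniform hh).2]
  have hT' : (0 : ℝ) < T := by exact_mod_cast hT
  -- There are no lossy rounds if the final history is good and at most `T` otherwise; the factor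
  -- `T` is cancelled by the failure probability `1/T`.
  have e3 : expect (runLaw I θ env solver γ T T) (fun h => D * lossCount γ rho η θ h) ≤ D := by
    have hind : BddOnSupport (runLaw I θ env solver γ T T)
        (fun h => if h ∈ {h | ¬ Good γ rho η θ h} then (1 : ℝ) else 0) :=
      .of_mem_Icc (a := 0) (b := 1) fun h _ => by split_ifs <;> norm_num
    calc _ ≤ expect (runLaw I θ env solver γ T T) (fun h =>
          (D * T) * if h ∈ {h | ¬ Good γ rho η θ h} then (1 : ℝ) else 0) := by
          refine expect_mono (hloss T) (hind.const_mul _) fun h hh => ?_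
          by_cases hg : Good γ rho η θ h
          · rw [hg.lossCount_eq, mul_zero]
            exact mul_nonneg (by positivity) (by split_ifs <;> norm_num)
          · rw [if_pos (show h ∈ {h | ¬ Good γ rho η θ h} from hg), mul_one]
            have h1 := (lossCount_mem γ rho η θ h).2
            rw [(valid_of_mem_support hA.mem_params hA.env_mem hA.uniform hh).2] at h1
            exact mul_le_mul_of_nonneg_left h1 hD0
      _ ≤ D * T * (1 / T) := by
          rw [expect_const_mul]
          exact mul_le_mul_of_nonneg_left hng (by positivity)
      _ = D := by field_simp
  have h4 : regret I θ env solver γ T α β =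
      expect (runLaw I θ env solver γ T T) (fun h => historyRegret I θ α β h) := rfl
  rw [h4]
  linarith

end Regret

end C2MAB

namespace C2MAB

/-! ### Comparison of logarithms. -/

section Numerics

theorem log_one_add_three_mul_le {z : ℝ} (hz : 2 ≤ z) :
    Real.log (1 + 3 * z) ≤ 3 * Real.log z := by
  have h : 1 + 3 * z ≤ z ^ 3 := by nlinarith [mul_self_nonneg (z - 2), mul_self_nonneg z]
  calc _ ≤ Real.log (z ^ 3) := Real.log_le_log (by linarith) h
    _ = _ := by rw [Real.log_pow]; norm_num

theorem half_le_log {z : ℝ} (hz : 2 ≤ z) : 1 / 2 ≤ Real.log z := by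
  have := Real.log_two_gt_d9
  have := Real.log_le_log (by norm_num) hz
  linarith

/-- The radius contains `log(KT)` but the rate only `log(KT/γ)`. If `γ⁴ ≤ n³` the two logarithms
differ by a factor at most `4`; otherwise `γ ≥ n^(3/4)`, which exceeds `x log n` up to the constant,
since `x ≤ √n` and `log n ≤ 4 n^(1/4)`. -/
theorem mul_log_le_of_sq_le {x n γ : ℝ} (hx : 0 ≤ x) (hγ : 1 ≤ γ) (hn : 2 * γ ≤ n)
    (hxn : x ^ 2 ≤ n) : x * Real.log n ≤ 4 * (x * Real.log (n / γ) + γ) := by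
  have hγ0 : 0 < γ := by linarith
  have hn0 : 0 < n := by linarith
  rcases le_total (γ ^ 4) (n ^ 3) with h | h
  · have h1 := Real.log_le_log (by positivity) h
    rw [Real.log_pow, Real.log_pow] at h1
    push_cast at h1
    rw [Real.log_div hn0.ne' hγ0.ne']
    have : x * Real.log n ≤ x * (4 * (Real.log n - Real.log γ)) :=
      mul_le_mul_of_nonneg_left (by linarith) hx
    linarith
  · set w := √√n with hw
    have hw0 : 0 < w := by positivity
    have hw4 : w ^ 4 = n := by
      rw [show w ^ 4 = (w ^ 2) ^ 2 by ring, hw, Real.sq_sqrt (Real.sqrt_nonneg _),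
        Real.sq_sqrt hn0.le]
    have h1 : Real.log n ≤ 4 * w := by
      rw [← hw4, Real.log_pow]
      have := Real.log_le_sub_one_of_pos hw0
      push_cast
      linarith
    have h2 : x ≤ w ^ 2 := by
      refine le_of_sq_le_sq ?_ (by positivity)
      rw [show (w ^ 2) ^ 2 = w ^ 4 by ring, hw4]
      exact hxn
    have h3 : w ^ 3 ≤ γ := by
      refine (pow_le_pow_iff_left₀ (by positivity) hγ0.le (n := 4) (by norm_num)).1 ?_
      rwa [show (w ^ 3) ^ 4 = (w ^ 4) ^ 3 by ring, hw4]
    have h4 : 0 ≤ Real.log (n / γ) := Real.log_nonneg (by rw [le_div_iff₀ hγ0]; linarith)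
    calc x * Real.log n ≤ w ^ 2 * (4 * w) := mul_le_mul h2 h1
          (Real.log_nonneg (by linarith)) (by positivity)
      _ = 4 * w ^ 3 := by ring
      _ ≤ _ := by nlinarith [mul_nonneg hx h4]

/-- Under these hypotheses the base of `N` is at most `(KT)⁷`, and `168 = 6 · 7 · 4`. -/
theorem logTerm_le_of_sq_le {d K T : ℕ} {γ : ℝ} (hd : 1 ≤ d) (hK : 1 ≤ K) (hT : 1 ≤ T)
    (hγ : 1 ≤ γ) (hn : 2 * γ ≤ K * T) (hdn : (d : ℝ) ^ 2 ≤ K * T) :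
    logTerm d K T ≤ 168 * (d * Real.log (K * T / γ) + γ) := by
  have hd' : (1 : ℝ) ≤ d := by exact_mod_cast hd
  have h1 := (logTerm_bounds hd hK hT).2.2
  set n : ℝ := K * T with hndef
  have hn2 : 2 ≤ n := by linarith
  have ha : 4 * (d : ℝ) ^ 2 * (K : ℝ) ^ 4 * (T : ℝ) ^ 4 ≤ n ^ 7 := by
    have e : 4 * (d : ℝ) ^ 2 * (K : ℝ) ^ 4 * (T : ℝ) ^ 4 = 4 * (d : ℝ) ^ 2 * n ^ 4 := by
      rw [hndef]; ring
    rw [e]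
    calc 4 * (d : ℝ) ^ 2 * n ^ 4 ≤ n ^ 2 * n * n ^ 4 := by
          gcongr
          nlinarith
      _ = n ^ 7 := by ring
  have h2 : Real.log (4 * (d : ℝ) ^ 2 * (K : ℝ) ^ 4 * (T : ℝ) ^ 4) ≤ 7 * Real.log n := by
    have hK' : (0 : ℝ) < K := by exact_mod_cast hK
    have hT' : (0 : ℝ) < T := by exact_mod_cast hT
    refine (Real.log_le_log (by positivity) ha).trans ?_
    rw [Real.log_pow]
    norm_num
  have h3 := mul_log_le_of_sq_le (zero_le_one.trans hd') hγ hn hdn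
  have h4 := mul_le_mul_of_nonneg_left h2 (zero_le_one.trans hd')
  linarith

theorem logTerm_le_of_le {d K T : ℕ} (hd : 1 ≤ d) (hK : 1 ≤ K) (hT : 2 ≤ T)
    (hKT : K ≤ T) (hdT : d ≤ T) : logTerm d K T ≤ 72 * (d * Real.log T) := by
  have h1 := (logTerm_bounds hd hK (one_le_two.trans hT)).2.2
  have hd' : (1 : ℝ) ≤ d := by exact_mod_cast hd
  have hK0 : (0 : ℝ) < K := by exact_mod_cast hK
  have hK' : (K : ℝ) ≤ T := by exact_mod_cast hKT
  have hdT' : (d : ℝ) ≤ T := by exact_mod_cast hdT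
  have hT' : (2 : ℝ) ≤ T := by exact_mod_cast hT
  have ha : 4 * (d : ℝ) ^ 2 * (K : ℝ) ^ 4 * (T : ℝ) ^ 4 ≤ (T : ℝ) ^ 12 := by
    calc 4 * (d : ℝ) ^ 2 * (K : ℝ) ^ 4 * (T : ℝ) ^ 4
        ≤ (T : ℝ) ^ 2 * (T : ℝ) ^ 2 * (T : ℝ) ^ 4 * (T : ℝ) ^ 4 := by
          gcongr
          nlinarith
      _ = (T : ℝ) ^ 12 := by ring
  have h2 : Real.log (4 * (d : ℝ) ^ 2 * (K : ℝ) ^ 4 * (T : ℝ) ^ 4) ≤ 12 * Real.log T := by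
    refine (Real.log_le_log (by positivity) ha).trans ?_
    rw [Real.log_pow]
    norm_num
  have h4 := mul_le_mul_of_nonneg_left h2 (zero_le_one.trans hd')
  linarith

theorem radius_le_of_logTerm_le {d K T : ℕ} {γ c u : ℝ} (hγ : 1 ≤ γ) (hc : 0 ≤ c) (hu : 0 ≤ u)
    (h : logTerm d K T ≤ (c * (u + √γ)) ^ 2) :
    radius d K T γ ≤ (4 * c + 2) * (u + √γ) := by
  have h1 : √(logTerm d K T) ≤ c * (u + √γ) := (Real.sqrt_le_left (by positivity)).2 h
  have h2 : 1 ≤ √γ := Real.one_le_sqrt.2 hγ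
  rw [radius_eq]
  unfold noiseRadius
  nlinarith

end Numerics

/-! ### Choice of the free parameters and the final bounds. -/

section Conclusion

universe u

variable {m d : ℕ} {𝒜 : Type u} {I : Instance m d 𝒜} {θ : EuclideanSpace ℝ (Fin d)}
  {env : List (Round m d 𝒜) → Fin m → EuclideanSpace ℝ (Fin d)}
  {solver : (Fin m → ℝ) → PMF 𝒜} {γ α β Bv B1 : ℝ} {T : ℕ}

/-- Take `ξ = √(P/(p_min T))`, which gives the potential term and the per-round term the same order;
their constants `8` and `4` add up to `12`. -/
theorem regret_le_of_log_le (hA : Admissible I θ env γ) (hR : RewardAssumptions I solver α β Bv B1)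
    (hT : 1 ≤ T) {J P : ℝ} (hJ : 0 ≤ J) (hP : 0 < P)
    (hcase : 4 * (I.batchSize : ℝ) ≤ γ ∨ 8 * Bv * √I.batchSize ≤ J)
    (hlog : 2 * d * Real.log (1 + 3 * I.batchSize * T / γ) ≤ P) :
    regret I θ env solver γ T α β ≤
      12 * radius d I.batchSize T γ * Bv * √(T * P / I.pMin) + J * P / I.pMin +
        4 * Bv * √I.batchSize := by
  have hp := hA.pMin_pos
  have hBv := hR.smooth_nonneg
  have hT' : (0 : ℝ) < T := by exact_mod_cast hT
  have hrho : 0 ≤ radius d I.batchSize T γ := by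
    have := one_le_noiseRadius d I.batchSize T
    rw [radius_eq]; positivity
  set s := √(T * P / I.pMin) with hs
  have hs0 : 0 < s := by positivity
  have hs2 : s ^ 2 = T * P / I.pMin := Real.sq_sqrt (by positivity)
  refine (regret_le hA hR hT (ξ := s / T) (by positivity) hJ hcase).trans ?_
  have h1 : (8 * radius d I.batchSize T γ * Bv / (s / T) + J) / I.pMin *
      (2 * d * Real.log (1 + 3 * I.batchSize * T / γ)) ≤
      (8 * radius d I.batchSize T γ * Bv / (s / T) + J) / I.pMin * P :=
    mul_le_mul_of_nonneg_left hlog (by positivity)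
  have h2 : (8 * radius d I.batchSize T γ * Bv / (s / T) + J) / I.pMin * P =
      8 * radius d I.batchSize T γ * Bv * s + J * P / I.pMin := by
    have : P = s ^ 2 * I.pMin / T := by rw [hs2]; field_simp
    rw [add_div, add_mul, mul_div_right_comm J]
    congr 1
    rw [this]; field_simp
  have h3 : 4 * radius d I.batchSize T γ * Bv * (s / T) * T =
      4 * radius d I.batchSize T γ * Bv * s := by field_simp
  linarith

theorem regret_le_of_triggering (hA : Admissible I θ env γ)
    (hR : RewardAssumptions I solver α β Bv B1) (hn : 2 * γ ≤ I.batchSize * T)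
    (hcase : 4 * (I.batchSize : ℝ) ≤ γ ∨ (I.batchSize : ℝ) ≤ I.pMin * T) :
    regret I θ env solver γ T α β ≤
      2000 * (Bv / √I.pMin * (√(d * Real.log (I.batchSize * T / γ)) + √γ) *
        √(T * d * Real.log (I.batchSize * T / γ))) := by
  have hp := hA.pMin_pos
  have hp1 := hA.pMin_le_one
  have hBv := hR.smooth_nonneg
  have hγ := hA.one_le
  have hγ0 := hA.pos
  have hT : 1 ≤ T := by
    rcases Nat.eq_zero_or_pos T with h | h
    · rw [h] at hn; push_cast at hn; linarith
    · exact h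
  have hT' : (1 : ℝ) ≤ T := by exact_mod_cast hT
  have hd' : (1 : ℝ) ≤ d := by exact_mod_cast hA.dim_pos
  have hz : 2 ≤ I.batchSize * T / γ := by rwa [le_div_iff₀ hγ0]
  set L := Real.log (I.batchSize * T / γ) with hL
  have hL2 : 1 / 2 ≤ L := half_le_log hz
  set u := √(d * L) with hu
  set g := √γ with hg
  set t := √(T : ℝ) with ht
  set k := √(I.batchSize : ℝ) with hk
  set q := √I.pMin with hq
  have hu2 : u ^ 2 = d * L := Real.sq_sqrt (by positivity)
  have ht2 : t ^ 2 = T := Real.sq_sqrt (by positivity)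
  have hk2 : k ^ 2 = I.batchSize := Real.sq_sqrt (by positivity)
  have hq2 : q ^ 2 = I.pMin := Real.sq_sqrt hp.le
  have hg2 : g ^ 2 = γ := Real.sq_sqrt hγ0.le
  have hq0 : 0 < q := Real.sqrt_pos.2 hp
  have hq1 : q ≤ 1 := Real.sqrt_le_one.2 hp1
  have ht1 : 1 ≤ t := Real.one_le_sqrt.2 hT'
  have hg1 : 1 ≤ g := Real.one_le_sqrt.2 hγ
  have hk0 : 0 ≤ k := Real.sqrt_nonneg _
  have hu1 : 1 / 2 ≤ u := Real.le_sqrt_of_sq_le (by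
    have := mul_le_mul hd' hL2 (by norm_num) (by linarith)
    linarith)
  have hv : √(T * d * L) = t * u := by rw [mul_assoc, Real.sqrt_mul (by positivity)]
  have hkg : 4 * (I.batchSize : ℝ) ≤ γ → k ≤ g := fun h => Real.sqrt_le_sqrt (by linarith)
  have hkq : (I.batchSize : ℝ) ≤ I.pMin * T → k ≤ q * t := fun h => by
    rw [hq, ht, ← Real.sqrt_mul hp.le]
    exact Real.sqrt_le_sqrt h
  have hkt : (I.batchSize * T : ℝ) ≤ d ^ 2 → k * t ≤ d := fun h => by
    rw [hk, ht, ← Real.sqrt_mul (by positivity)]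
    exact (Real.sqrt_le_left (by positivity)).2 h
  have hu0 : 0 < u := by linarith
  clear_value L u t k q
  rw [hv]
  have hrhs : Bv / q * (u + g) * (t * u) = Bv * (u + g) * t * u / q := by ring
  rw [hrhs]
  have key : ∀ x : ℝ, 0 ≤ x → x ≤ x / q := fun x hx => by
    rw [le_div_iff₀ hq0]; exact mul_le_of_le_one_right hx hq1
  -- For `d² ≤ KT` the factor `d` inside the logarithm of the radius is harmless. Otherwise `√(KT) ≤
  -- d`, and the trivial bound is already of the claimed size.
  rcases le_total (d ^ 2 : ℝ) (I.batchSize * T) with hdn | hdn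
  · have hrad : radius d I.batchSize T γ ≤ 54 * (u + g) := by
      -- `13² = 169` exceeds the constant `168` of `logTerm_le_of_sq_le`, and `4 · 13 + 2 = 54`.
      have := radius_le_of_logTerm_le (c := 13) (u := u) hγ (by norm_num) (by linarith)
        ((logTerm_le_of_sq_le hA.dim_pos hA.one_le_batchSize hT hγ hn hdn).trans (by
          rw [← hL, ← hu2, ← hg, ← hg2]
          have h : (13 * (u + g)) ^ 2 = 169 * u ^ 2 + 338 * (u * g) + 169 * g ^ 2 := by ring
          rw [h]
          linarith [mul_nonneg hu0.le (by linarith : 0 ≤ g), sq_nonneg u, sq_nonneg g]))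
      linarith
    have hP : 2 * d * Real.log (1 + 3 * I.batchSize * T / γ) ≤ 6 * u ^ 2 := by
      have := mul_le_mul_of_nonneg_left (log_one_add_three_mul_le hz) (zero_le_one.trans hd')
      rw [show 1 + 3 * (I.batchSize : ℝ) * T / γ = 1 + 3 * (I.batchSize * T / γ) by ring, hu2, hL]
      linarith
    have hsqrt : √(T * (6 * u ^ 2) / I.pMin) ≤ 5 / 2 * (t * u / q) := by
      refine (Real.sqrt_le_left (by positivity)).2 ?_
      rw [← ht2, ← hq2]
      have : (5 / 2 * (t * u / q)) ^ 2 = 25 / 4 * (t ^ 2 * u ^ 2 / q ^ 2) := by ring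
      rw [this]
      have : t ^ 2 * (6 * u ^ 2) / q ^ 2 = 6 * (t ^ 2 * u ^ 2 / q ^ 2) := by ring
      rw [this]
      gcongr
      norm_num
    have hmain : 12 * radius d I.batchSize T γ * Bv * √(T * (6 * u ^ 2) / I.pMin) ≤
        1620 * (Bv * (u + g) * t * u / q) := by
      calc _ ≤ 12 * (54 * (u + g)) * Bv * (5 / 2 * (t * u / q)) := by gcongr
        _ = _ := by ring
    have hlast : 4 * Bv * k ≤ 8 * (Bv * (u + g) * t * u / q) := by
      have h1 : k ≤ g * t := by
        rcases hcase with h | h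
        · exact (hkg h).trans (le_mul_of_one_le_right (by linarith) ht1)
        · exact (hkq h).trans (mul_le_mul_of_nonneg_right (hq1.trans hg1) (by linarith))
      calc 4 * Bv * k ≤ 4 * Bv * (g * t) := by gcongr
        _ = 8 * (Bv * g * t * (1 / 2)) := by ring
        _ ≤ 8 * (Bv * (u + g) * t * u) := by gcongr; linarith
        _ ≤ _ := by gcongr; exact key _ (by positivity)
    -- If `γ ≥ 4K`, all summed bonuses are at most one and `J = 0` will do. Otherwise `J` has order
    -- `B_v √K`, and `K ≤ p_min T` makes `J P / p_min` of order `B_v u² √(T/p_min)`.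
    rcases hcase with h | h
    · have := regret_le_of_log_le hA hR hT le_rfl (P := 6 * u ^ 2) (by positivity) (.inl h) hP
      have h0 : 0 ≤ Bv * (u + g) * t * u / q := by positivity
      rw [zero_mul, zero_div, ← hk] at this
      linarith
    · have := regret_le_of_log_le hA hR hT (J := 8 * Bv * k) (by positivity) (P := 6 * u ^ 2)
        (by positivity) (.inr (by rw [hk])) hP
      rw [← hk] at this
      have h1 := hkq h
      have h2 : 8 * Bv * k * (6 * u ^ 2) / I.pMin ≤ 48 * (Bv * (u + g) * t * u / q) := by
        rw [← hq2]
        calc _ ≤ 8 * Bv * (q * t) * (6 * u ^ 2) / q ^ 2 := by gcongr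
          _ = 48 * (Bv * u * t * u / q) := by field_simp; ring
          _ ≤ _ := by gcongr; linarith
      have h0 : 0 ≤ Bv * (u + g) * t * u / q := by positivity
      linarith
  · refine (regret_le_trivial hA hR).trans ?_
    rw [← hk]
    have h2 : (d : ℝ) ≤ 2 * u ^ 2 := by
      rw [hu2]
      linarith [mul_le_mul_of_nonneg_left hL2 (zero_le_one.trans hd')]
    calc 4 * Bv * k * T = 4 * Bv * (k * t) * t := by rw [← ht2]; ring
      _ ≤ 4 * Bv * (2 * u ^ 2) * t := by have := (hkt hdn).trans h2; gcongr
      _ = 8 * (Bv * u * t * u) := by ring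
      _ ≤ 8 * (Bv * (u + g) * t * u) := by gcongr; linarith
      _ ≤ 2000 * (Bv * (u + g) * t * u / q) := by
        have h0 : 0 ≤ Bv * (u + g) * t * u := by positivity
        linarith [key _ h0]

/-- The hypothesis on `γ` lets `√(d log T)` absorb `√γ`, and `K ≤ T` lets `√T` absorb `√K`. For `d ≥
T` the trivial bound is enough. -/
theorem regret_le_of_pMin_eq_one (hA : Admissible I θ env γ)
    (hR : RewardAssumptions I solver α β Bv B1) (hp : I.pMin = 1) (hKT : I.batchSize ≤ T)
    (hγT : γ ≤ d * Real.log T) :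
    regret I θ env solver γ T α β ≤ 2000 * (Bv * d * √T * Real.log T) := by
  have hBv := hR.smooth_nonneg
  have hγ := hA.one_le
  have hγ0 := hA.pos
  have hT : 2 ≤ T := by
    by_contra! h
    have h1 : T = 1 := by have := hA.one_le_batchSize; omega
    rw [h1, Nat.cast_one, Real.log_one, mul_zero] at hγT
    linarith
  have hT' : (2 : ℝ) ≤ T := by exact_mod_cast hT
  have hd' : (1 : ℝ) ≤ d := by exact_mod_cast hA.dim_pos
  have hK' : (I.batchSize : ℝ) ≤ T := by exact_mod_cast hKT
  have hL2 := half_le_log hT'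
  set L := Real.log T with hL
  set u := √(d * L) with hu
  set t := √(T : ℝ) with ht
  set k := √(I.batchSize : ℝ) with hk
  have hu2 : u ^ 2 = d * L := Real.sq_sqrt (by positivity)
  have ht2 : t ^ 2 = T := Real.sq_sqrt (by positivity)
  have hu1 : 1 ≤ u := Real.one_le_sqrt.2 (hγ.trans hγT)
  have ht0 : 0 ≤ t := Real.sqrt_nonneg _
  have hg : √γ ≤ u := Real.sqrt_le_sqrt hγT
  have hk0 : 0 ≤ k := Real.sqrt_nonneg _
  have hkt : k ≤ t := Real.sqrt_le_sqrt hK'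
  have hrhs : Bv * d * t * L = Bv * u ^ 2 * t := by rw [hu2]; ring
  clear_value L u t k
  rw [hrhs]
  rcases le_total d T with hdT | hdT
  · have hrad : radius d I.batchSize T γ ≤ 76 / 2 * u := by
      have h1 := logTerm_le_of_le hA.dim_pos hA.one_le_batchSize hT hKT hdT
      have h2 : √(logTerm d I.batchSize T) ≤ 9 * u := by
        refine (Real.sqrt_le_left (by positivity)).2 (h1.trans ?_)
        have h : 0 ≤ u ^ 2 := sq_nonneg u
        rw [mul_pow, ← hL, ← hu2]
        linarith
      rw [radius_eq]
      unfold noiseRadius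
      linarith
    have hP : 2 * d * Real.log (1 + 3 * I.batchSize * T / γ) ≤ 8 * u ^ 2 := by
      have h1 : 1 + 3 * (I.batchSize : ℝ) * T / γ ≤ (T : ℝ) ^ 4 := by
        have h2 : 3 * (I.batchSize : ℝ) * T / γ ≤ 3 * T * T :=
          (div_le_self (by positivity) hγ).trans (by gcongr)
        have h3 : (4 : ℝ) ≤ T * T := by
          linarith [mul_le_mul hT' hT' zero_le_two (zero_le_two.trans hT')]
        have h4 := mul_le_mul_of_nonneg_right h3 (zero_le_four.trans h3)
        have h5 : (T : ℝ) ^ 4 = T * T * (T * T) := by ring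
        rw [h5]
        linarith
      have h2 := Real.log_le_log (by positivity) h1
      rw [Real.log_pow] at h2
      push_cast at h2
      have := mul_le_mul_of_nonneg_left h2 (zero_le_one.trans hd')
      rw [hu2, hL]
      linarith
    have := regret_le_of_log_le hA hR (one_le_two.trans hT) (J := 8 * Bv * k) (by positivity)
      (P := 8 * u ^ 2) (by positivity) (.inr (by rw [hk])) hP
    rw [hp, div_one, div_one, ← hk] at this
    have hsqrt : √(T * (8 * u ^ 2)) ≤ 3 * (t * u) := by
      refine (Real.sqrt_le_left (by positivity)).2 ?_
      rw [← ht2]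
      have h : (3 * (t * u)) ^ 2 = 9 * (t ^ 2 * u ^ 2) := by ring
      rw [h]
      linarith [mul_nonneg (sq_nonneg t) (sq_nonneg u)]
    have h1 : 12 * radius d I.batchSize T γ * Bv * √(T * (8 * u ^ 2)) ≤
        1368 * (Bv * u ^ 2 * t) := by
      calc _ ≤ 12 * (76 / 2 * u) * Bv * (3 * (t * u)) := by gcongr
        _ = _ := by ring
    have h2 : 8 * Bv * k * (8 * u ^ 2) ≤ 64 * (Bv * u ^ 2 * t) := by
      calc _ ≤ 8 * Bv * t * (8 * u ^ 2) := by gcongr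
        _ = _ := by ring
    have h3 : 4 * Bv * k ≤ 4 * (Bv * u ^ 2 * t) := by
      calc 4 * Bv * k ≤ 4 * Bv * t := by gcongr
        _ = 4 * (Bv * 1 * t) := by ring
        _ ≤ _ := by gcongr; exact one_le_pow₀ hu1
    have h0 : 0 ≤ Bv * u ^ 2 * t := by positivity
    linarith
  · refine (regret_le_trivial hA hR).trans ?_
    rw [← hk]
    have h1 : (T : ℝ) ≤ 2 * u ^ 2 := by
      have : (T : ℝ) ≤ d := by exact_mod_cast hdT
      rw [hu2]
      linarith [mul_le_mul_of_nonneg_left hL2 (zero_le_one.trans hd')]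
    calc 4 * Bv * k * T ≤ 4 * Bv * t * (2 * u ^ 2) := by gcongr
      _ = 8 * (Bv * u ^ 2 * t) := by ring
      _ ≤ 2000 * (Bv * u ^ 2 * t) := by
        have h0 : 0 ≤ Bv * u ^ 2 * t := by positivity
        linarith

theorem summable_regretTerm (hA : Admissible I θ env γ)
    (hR : RewardAssumptions I solver α β Bv B1) :
    Summable (regretTerm I θ env solver γ T α β) :=
  (bdd_historyRegret (T := T) hA hR T).summable

end Conclusion

end C2MAB

end

theorem mainTheorem2 :
    ∃ C : ℝ, 0 < C ∧
      ∀ (m d T : ℕ) (𝒜 : Type*) (I : C2MAB.Instance m d 𝒜)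
        (θ : EuclideanSpace ℝ (Fin d))
        (env : List (C2MAB.Round m d 𝒜) → Fin m → EuclideanSpace ℝ (Fin d))
        (oracle : (Fin m → ℝ) → PMF 𝒜) (α β γ Bv B1 : ℝ),
        0 < d → θ ∈ I.params → ‖θ‖ ≤ 1 → (∀ h, env h ∈ I.features) →
        I.UniformTriggering → I.BoundedReward → 0 < I.pMin →
        I.Monotonicity → I.VMSmooth Bv B1 →
        α ∈ Set.Icc (0 : ℝ) 1 → β ∈ Set.Icc (0 : ℝ) 1 → I.IsApproxOracle α β oracle →
        1 ≤ γ →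
        (2 * γ ≤ I.batchSize * T → (4 * I.batchSize ≤ γ ∨ I.batchSize ≤ I.pMin * T) →
          Summable (C2MAB.regretTerm I θ env oracle γ T α β) ∧
          C2MAB.regret I θ env oracle γ T α β ≤
            C * (Bv / √I.pMin
              * (√(d * Real.log (I.batchSize * T / γ)) + √γ)
              * √(T * d * Real.log (I.batchSize * T / γ)))) ∧
        (I.pMin = 1 → I.batchSize ≤ T → γ ≤ d * Real.log T →
          Summable (C2MAB.regretTerm I θ env oracle γ T α β) ∧
          C2MAB.regret I θ env oracle γ T α β ≤ C * (Bv * d * √T * Real.log T)) := by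
  refine ⟨2000, by norm_num, fun m d T 𝒜 I θ env oracle α β γ Bv B1 hd hθ hnorm henv hunif hbdd
    hpMin hmono hsmooth hα hβ horacle hγ => ?_⟩
  have hA : C2MAB.Admissible I θ env γ := ⟨hd, hθ, hnorm, henv, hunif, hpMin, hγ⟩
  have hR : C2MAB.RewardAssumptions I oracle α β Bv B1 := by
    refine ⟨hbdd, hmono, hsmooth, hα, hβ, horacle, ?_⟩
    -- The sign of `Bv` is not assumed; it follows from smoothness because some action can trigger
    -- an arm.
    obtain ⟨S, i, hi⟩ := C2MAB.Instance.exists_mem_trigSet hpMin hunif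
    exact hsmooth.nonneg hi
  exact ⟨fun hn hcase => ⟨C2MAB.summable_regretTerm hA hR,
      C2MAB.regret_le_of_triggering hA hR hn hcase⟩,
    fun hp hKT hγT => ⟨C2MAB.summable_regretTerm hA hR,
      C2MAB.regret_le_of_pMin_eq_one hA hR hp hKT hγT⟩⟩
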